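/- Let $d\ge 1$, let $P\subset\mathbb R^{d+1}$ be a (possibly unbounded) convex polyhedron of dimension $d+1$, i.e. a finite intersection of closed half-spaces that does not lie in a proper affine subspace, and let $S=\partial P$, with its intrinsic metric $\mu$: $\mu(a,b)$ is the infimum of the lengths of paths in $S$ from $a$ to $b$. A path in $S$ is a shortest path if its length equals the distance $\mu$ between its endpoints; two shortest paths are regarded as equal if they coincide as subsets of $S$. Let $v$ be a source point, i.e. a point in the relative interior of a facet ($d$-dimensional face) of $P$. A cut point is a point of $S$ that has more than one shortest path to $v$; let $K_v$ be the set of cut points and let the cut locus $\overline K_v$ be its closure. Let $S_{d-2}$ be the union of all faces of $P$ of dimension at most $d-2$; its points are called warped. Then: 1. The cut locus $\overline K_v$ is (the underlying set of) a finite polyhedral complex in $\mathbb R^{d+1}$, whose dimension is exactly $d-1$ if $\overline K_v\neq\emptyset$. Moreover $\overline K_v\ne\emptyset$ unless $P$ contains a closed half-space of some $d$-dimensional affine subspace of $\mathbb R^{d+1}$ (in particular, $\overline K_v\neq\emptyset$ whenever $P$ is bounded). 2. The cut locus is the union of the cut points and the warped points: $\overline K_v=K_v\cup S_{d-2}$.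 -/

import Mathlib

open Set
open scoped ENNReal

namespace CutLoci

section General

variable {E : Type*} [NormedAddCommGroup E] [NormedSpace ℝ E]

/-- A convex polyhedron (possibly unbounded): a finite intersection of closed half-spaces. -/
def IsPolyhedron (P : Set E) : Prop :=
  ∃ (n : ℕ) (a : Fin n → E →L[ℝ] ℝ) (b : Fin n → ℝ), P = {x | ∀ i, a i x ≤ b i}

/-- The nonempty faces of a convex polyhedron (the polyhedron itself is one of them):
the nonempty sets of points of `P` at which some linear functional attains its maximum on `P`. -/
def IsFace (P F : Set E) : Prop :=
  F.Nonempty ∧ IsExposed ℝ P F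

/-- The dimension of (the affine span of) a nonempty subset of a vector space. -/
noncomputable def dim (F : Set E) : ℕ :=
  Module.finrank ℝ (vectorSpan ℝ F)

/-- The union of all faces of `P` of dimension at most `d - 2`. For `P` of dimension `d + 1` this
is the `(d - 2)`-skeleton of the boundary of `P`; its points are the warped points. -/
def warpedPoints (P : Set E) (d : ℕ) : Set E :=
  ⋃₀ {F | IsFace P F ∧ dim F + 2 ≤ d}

/-- A source point: a point in the relative interior of a face of dimension `d`
(a facet of the boundary, when `P` has dimension `d + 1`). -/
def IsSourcePoint (P : Set E) (d : ℕ) (v : E) : Prop :=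
  ∃ F, IsFace P F ∧ dim F = d ∧ v ∈ intrinsicInterior ℝ F

/-- The length of a path. -/
noncomputable def pathLength {a b : E} (γ : Path a b) : ℝ≥0∞ :=
  eVariationOn γ univ

/-- The intrinsic metric of `S`: the infimum of the lengths of the paths in `S` from `a` to `b`
(it is `∞` if there are none). -/
noncomputable def intrinsicDist (S : Set E) (a b : E) : ℝ≥0∞ :=
  ⨅ (γ : Path a b) (_ : range γ ⊆ S), pathLength γ

/-- `γ` is a shortest path in `S` from `a` to `b`. -/
def IsShortestPath (S : Set E) {a b : E} (γ : Path a b) : Prop :=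
  range γ ⊆ S ∧ pathLength γ = intrinsicDist S a b

/-- The cut points of the boundary of `P` with respect to `v`: those with more than one shortest
path to `v`. Two paths are the same if they agree as subsets of the boundary, that is, up to
parametrization. -/
def cutPoints (P : Set E) (v : E) : Set E :=
  {x | x ∈ frontier P ∧ ∃ γ₁ γ₂ : Path x v,
    IsShortestPath (frontier P) γ₁ ∧ IsShortestPath (frontier P) γ₂ ∧ range γ₁ ≠ range γ₂}

/-- The cut locus: the closure of the set of cut points (the boundary of `P` is closed, so this is
also the closure within the boundary). -/
def cutLocus (P : Set E) (v : E) : Set E :=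
  closure (cutPoints P v)

/-- `P` contains a closed half-space of some `k`-dimensional affine subspace. -/
def ContainsHalfFlat (P : Set E) (k : ℕ) : Prop :=
  ∃ (p u : E) (L : Submodule ℝ E), Module.finrank ℝ L + 1 = k ∧ u ∉ L ∧
    ∀ y ∈ L, ∀ t : ℝ, 0 ≤ t → p + y + t • u ∈ P

end General

/-- A finite polyhedral complex in `E`: a finite set of nonempty convex polyhedra, closed under
taking nonempty faces, any two of which are disjoint or meet in a common face. -/
structure PolyhedralComplex (E : Type*) [NormedAddCommGroup E] [NormedSpace ℝ E] where
  cells : Set (Set E)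
  finite : cells.Finite
  nonempty : ∀ s ∈ cells, s.Nonempty
  polyhedron : ∀ s ∈ cells, IsPolyhedron s
  face_mem : ∀ s ∈ cells, ∀ t, IsFace s t → t ∈ cells
  inter_face : ∀ s ∈ cells, ∀ t ∈ cells, (s ∩ t).Nonempty → IsFace s (s ∩ t) ∧ IsFace t (s ∩ t)

/-- The underlying set of a polyhedral complex. -/
def PolyhedralComplex.support {E : Type*} [NormedAddCommGroup E] [NormedSpace ℝ E]
    (C : PolyhedralComplex E) : Set E :=
  ⋃₀ C.cells

/-- The largest dimension of a cell of the (nonempty) complex `C` is `n`. -/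
def PolyhedralComplex.HasDim {E : Type*} [NormedAddCommGroup E] [NormedSpace ℝ E]
    (C : PolyhedralComplex E) (n : ℕ) : Prop :=
  (∀ s ∈ C.cells, dim s ≤ n) ∧ ∃ s ∈ C.cells, dim s = n

end CutLoci

open Set
open scoped ENNReal
set_option linter.unusedSectionVars false

/-! Shortest paths are studied by unfolding. The nearest-point projection onto P is nonexpanding and
sends points outside the interior to S, so a broken line whose pieces each lie beyond a bounding
hyperplane is at least as long as the intrinsic distance of its ends (`intrinsicDist_le_exterior`).
Pushing corners outwards thus yields a first variation inequality. From it `corner` deduces that a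
shortest path is straight inside facets, crosses a ridge (a face of dimension d-1) so that it
becomes straight after unfolding, and never runs through a warped point. Since it never returns to a
facet it has left, it has finitely many pieces. The source is therefore seen from x as one of
finitely many images ω, obtained from v by reflections, lying in the hyperplane of the first facet
at distance `rho x` from x.

The central estimate is `Desc.rho_le`: the distance to an image seen in a facet bounds `rho` from
above on that whole facet. The reason is that along a segment `rho`² minus a fixed quadratic has
affine upper supports. Hence, away from v, in the relative interior of a facet `rho` is the minimum
of the distances to finitely many images, the set `T x` of images seen from x is described by
equations and inequalities (`mem_T_iff`), and x is a cut point exactly when `T x` has at least two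
elements (`mem_cutPoints_iff`).

For the second statement, call a point flat if its active normals span dimension at most two; the
warped points are the boundary points that are not flat. Near a flat point, only images seen from
that point are seen, up to unfolding, so a flat limit of cut points is a cut point. If instead x is
warped, maximize `rho` on a small sphere around x in the normal space of its face. If the maximizer
were neither warped nor a cut point, and all nearby points of smaller codimension were like it, the
second order condition on the sphere would place the source image opposite to the maximizer, and a
shortest path would run through x, which is impossible. Induction on the codimension then yields cut
points arbitrarily close to x.

For the first statement, the cut locus is the finite union of the polyhedra on which two images are
tied; the tie is a linear condition, and two independent equations bound the dimension by d-1. For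
the lower bound, either the cut points near some cut point separate the regions of two images inside
a facet, or there are none inside facets and they fill a neighbourhood in a ridge. If the cut locus
is empty, P is a planar polyhedron times a linear space; a bounded planar section would carry a
maximum of `rho`, contradicting the strict convexity of the squared distance in the unfolding, and
an unbounded one gives a half-flat in P. -/

namespace CutLoci

open Filter Topology

local notation "⟪" x ", " y "⟫" => inner ℝ x y

/-! ### Path length and the intrinsic distance. -/

section Paths

variable {E : Type*} [NormedAddCommGroup E] [NormedSpace ℝ E]

theorem edist_le_pathLength {a b : E} (γ : Path a b) : edist a b ≤ pathLength γ := by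
  have := eVariationOn.edist_le (γ : unitInterval → E) (mem_univ 0) (mem_univ 1)
  simpa [pathLength] using this

theorem pathLength_trans_le {a b c : E} (γ : Path a b) (γ' : Path b c) :
    pathLength (γ.trans γ') ≤ pathLength γ + pathLength γ' := by
  let h : unitInterval := ⟨1 / 2, by norm_num, by norm_num⟩
  have hs : IsGreatest (Iic h) h := isGreatest_Iic
  have ht : IsLeast (Ici h) h := isLeast_Ici
  unfold pathLength
  rw [← Iic_union_Ici (a := h), eVariationOn.union _ hs ht]
  have m1 : Monotone fun t : unitInterval => projIcc (0 : ℝ) 1 zero_le_one (2 * (t : ℝ)) :=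
    fun x y hxy => monotone_projIcc _ (by have : (x : ℝ) ≤ y := hxy; linarith)
  have m2 : Monotone fun t : unitInterval => projIcc (0 : ℝ) 1 zero_le_one (2 * (t : ℝ) - 1) :=
    fun x y hxy => monotone_projIcc _ (by have : (x : ℝ) ≤ y := hxy; linarith)
  have e1 : EqOn (γ.trans γ') (γ ∘ fun t : unitInterval =>
      projIcc (0 : ℝ) 1 zero_le_one (2 * (t : ℝ))) (Iic h) := by
    intro t ht
    have : (t : ℝ) ≤ 1 / 2 := ht
    have h1 := Path.extend_trans_of_le_half γ γ' this
    rw [Path.extend_apply _ t.2] at h1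
    exact h1
  have e2 : EqOn (γ.trans γ') (γ' ∘ fun t : unitInterval =>
      projIcc (0 : ℝ) 1 zero_le_one (2 * (t : ℝ) - 1)) (Ici h) := by
    intro t ht
    have : 1 / 2 ≤ (t : ℝ) := ht
    have h1 := Path.extend_trans_of_half_le γ γ' this
    rw [Path.extend_apply _ t.2] at h1
    exact h1
  rw [eVariationOn.congr e1, eVariationOn.congr e2, Iic_union_Ici]
  exact add_le_add
    (eVariationOn.comp_le_of_monotoneOn _ _ (m1.monotoneOn _) fun _ _ => mem_univ _)
    (eVariationOn.comp_le_of_monotoneOn _ _ (m2.monotoneOn _) fun _ _ => mem_univ _)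

theorem pathLength_subpath_le {a b : E} (γ : Path a b) {s t : unitInterval} (hst : s ≤ t) :
    pathLength (γ.subpath s t) ≤ eVariationOn γ (Icc s t) := by
  refine eVariationOn.comp_le_of_monotoneOn (γ : unitInterval → E) (Icc.convexComb s t) ?_ ?_
  · intro x _ y _ hxy
    have h1 : (x : ℝ) ≤ y := hxy
    have h2 : (s : ℝ) ≤ t := hst
    change (1 - (x : ℝ)) * s + x * t ≤ (1 - (y : ℝ)) * s + y * t
    nlinarith
  · intro x _
    have := mem_range_self (f := Icc.convexComb s t) x
    rwa [Path.range_subpathAux, uIcc_of_le hst] at this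

theorem intrinsicDist_subpath_le {S : Set E} {a b : E} (γ : Path a b) (hγ : range γ ⊆ S)
    {s t : unitInterval} (hst : s ≤ t) :
    intrinsicDist S (γ s) (γ t) ≤ eVariationOn γ (Icc s t) := by
  refine (iInf₂_le (γ.subpath s t) ?_).trans (pathLength_subpath_le γ hst)
  rw [Path.range_subpath]
  exact (image_subset_range _ _).trans hγ

theorem pathLength_split {a b : E} (γ : Path a b) (t : unitInterval) :
    eVariationOn γ (Icc 0 t) + eVariationOn γ (Icc t 1) = pathLength γ := by
  have := eVariationOn.Icc_add_Icc (γ : unitInterval → E) (s := univ) (a := 0) (b := t) (c := 1)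
    t.2.1 t.2.2 (mem_univ t)
  simp only [univ_inter] at this
  rw [this]
  congr 1
  exact eq_univ_of_forall fun x => ⟨x.2.1, x.2.2⟩

theorem intrinsicDist_triangle (S : Set E) (a b c : E) :
    intrinsicDist S a c ≤ intrinsicDist S a b + intrinsicDist S b c := by
  unfold intrinsicDist
  simp only [ENNReal.iInf_add, ENNReal.add_iInf]
  refine le_iInf₂ fun γ hγ => le_iInf₂ fun γ' hγ' => ?_
  refine (iInf₂_le (γ'.trans γ) ?_).trans ((pathLength_trans_le _ _))
  rw [Path.trans_range]
  exact union_subset hγ' hγ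

theorem edist_le_intrinsicDist (S : Set E) (a b : E) : edist a b ≤ intrinsicDist S a b :=
  le_iInf₂ fun γ _ => edist_le_pathLength γ

theorem intrinsicDist_self {S : Set E} {a : E} (ha : a ∈ S) : intrinsicDist S a a = 0 := by
  refine le_antisymm ((iInf₂_le (Path.refl a) ?_).trans ?_) zero_le
  · simpa using ha
  · refine (eVariationOn.constant_on ?_).le
    rintro _ ⟨x, -, rfl⟩ _ ⟨y, -, rfl⟩
    rfl

/-- Along a shortest path, distances add up. -/
theorem IsShortestPath.add_le {S : Set E} {a b : E} {γ : Path a b} (hγ : IsShortestPath S γ)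
    (hfin : intrinsicDist S a b ≠ ⊤) {s t : unitInterval} (hst : s ≤ t) :
    intrinsicDist S (γ s) (γ t) + intrinsicDist S (γ t) b ≤ intrinsicDist S (γ s) b := by
  have h1 : eVariationOn γ (Icc 0 s) + eVariationOn γ (Icc s 1) = intrinsicDist S a b := by
    rw [pathLength_split, hγ.2]
  have h2 : eVariationOn γ (Icc s t) + eVariationOn γ (Icc t 1) = eVariationOn γ (Icc s 1) := by
    simpa using eVariationOn.Icc_add_Icc (γ : unitInterval → E) (s := univ) hst t.2.2 (mem_univ t)
  have h3 : intrinsicDist S (γ t) b ≤ eVariationOn γ (Icc t 1) := by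
    simpa using intrinsicDist_subpath_le γ hγ.1 (show t ≤ 1 from t.2.2)
  have h4 : intrinsicDist S a (γ s) ≤ eVariationOn γ (Icc 0 s) := by
    simpa using intrinsicDist_subpath_le γ hγ.1 (show 0 ≤ s from s.2.1)
  have h5 := intrinsicDist_triangle S a (γ s) b
  have h6 : eVariationOn γ (Icc s 1) ≤ intrinsicDist S (γ s) b := by
    rw [← h1] at h5
    have hne : eVariationOn γ (Icc 0 s) ≠ ⊤ := fun h => hfin (by rw [← h1, h, top_add])
    exact (ENNReal.add_le_add_iff_left hne).1 (h5.trans (add_le_add_left h4 _))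
  exact (add_le_add (intrinsicDist_subpath_le γ hγ.1 hst) h3).trans (h2.le.trans h6)

/-- Every path from `a` to `b` leaving a sphere around `a` passes through it. -/
theorem exists_sphere_split {S : Set E} {a b : E} (γ : Path a b) (hγ : range γ ⊆ S) {r : ℝ}
    (hr : 0 ≤ r) (hab : r ≤ dist b a) :
    ∃ t, dist (γ t) a = r ∧ intrinsicDist S a (γ t) + intrinsicDist S (γ t) b ≤ pathLength γ := by
  have hc : Continuous fun t : unitInterval => dist (γ t) a := by fun_prop
  obtain ⟨t, ht⟩ := mem_range_of_exists_le_of_exists_ge hc (c := r) ⟨0, by simpa using hr⟩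
    ⟨1, by simpa using hab⟩
  refine ⟨t, ht, ?_⟩
  rw [← pathLength_split γ t]
  exact add_le_add (by simpa using intrinsicDist_subpath_le γ hγ (show 0 ≤ t from t.2.1))
    (by simpa using intrinsicDist_subpath_le γ hγ (show t ≤ 1 from t.2.2))

theorem eVariationOn_unitInterval_val_le :
    eVariationOn (Subtype.val : unitInterval → ℝ) univ ≤ 1 := by
  have := MonotoneOn.eVariationOn_eq (f := (Subtype.val : unitInterval → ℝ)) (s := univ)
    (fun x _ y _ h => h) (mem_univ 0) (mem_univ 1)
  have h : (Icc 0 1 : Set unitInterval) = univ := eq_univ_of_forall fun x => ⟨x.2.1, x.2.2⟩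
  rw [univ_inter, h] at this
  simp [this]

/-- The image of a segment under a map that is nonexpanding on it is a path of at most the same
length. -/
theorem intrinsicDist_le_of_segment {S : Set E} (f : E → E) (hf : LipschitzWith 1 f) {a b : E}
    (hS : ∀ x ∈ segment ℝ a b, f x ∈ S) : intrinsicDist S (f a) (f b) ≤ edist a b := by
  have hline : LipschitzWith (nndist a b) (AffineMap.lineMap a b : ℝ → E) :=
    lipschitzWith_lineMap a b
  have hg : LipschitzWith (nndist a b) fun t : unitInterval => f (AffineMap.lineMap a b (t : ℝ)) := by
    have := (hf.comp hline).comp (LipschitzWith.subtype_val (Icc (0 : ℝ) 1))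
    rwa [one_mul, mul_one] at this
  let γ : Path (f a) (f b) :=
    { toFun := fun t => f (AffineMap.lineMap a b (t : ℝ))
      continuous_toFun := hg.continuous
      source' := by simp
      target' := by simp }
  refine (iInf₂_le γ ?_).trans ?_
  · rintro _ ⟨t, rfl⟩
    exact hS _ (by rw [segment_eq_image_lineMap]; exact ⟨t, t.2, rfl⟩)
  · have h1 : LipschitzOnWith (nndist a b) (fun t : ℝ => f (AffineMap.lineMap a b t)) univ := by
      have := hf.comp hline
      rw [one_mul] at this
      exact this.lipschitzOnWith
    have h2 := h1.comp_eVariationOn_le (g := (Subtype.val : unitInterval → ℝ)) (s := univ)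
      (fun _ _ => mem_univ _)
    refine h2.trans ((mul_le_mul_right eVariationOn_unitInterval_val_le _).trans ?_)
    rw [mul_one, edist_nndist]

theorem isShortestPath_segment {S : Set E} {a b : E} (hS : segment ℝ a b ⊆ S) :
    ∃ γ : Path a b, range γ = segment ℝ a b ∧ IsShortestPath S γ := by
  have hline : LipschitzWith (nndist a b) (AffineMap.lineMap a b : ℝ → E) :=
    lipschitzWith_lineMap a b
  let γ : Path a b :=
    { toFun := fun t => AffineMap.lineMap a b (t : ℝ)
      continuous_toFun := hline.continuous.comp continuous_subtype_val
      source' := by simp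
      target' := by simp }
  have hr : range γ = segment ℝ a b := by
    rw [segment_eq_image_lineMap]
    ext x
    constructor
    · rintro ⟨t, rfl⟩
      exact ⟨t, t.2, rfl⟩
    · rintro ⟨t, ht, rfl⟩
      exact ⟨⟨t, ht⟩, rfl⟩
  have hrS : range γ ⊆ S := hr ▸ hS
  refine ⟨γ, hr, hrS, le_antisymm ?_ (iInf₂_le γ hrS)⟩
  refine le_trans ?_ (edist_le_intrinsicDist S a b)
  have h2 := hline.lipschitzOnWith (s := univ) |>.comp_eVariationOn_le
    (g := (Subtype.val : unitInterval → ℝ)) (s := univ) (fun _ _ => mem_univ _)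
  refine h2.trans ((mul_le_mul_right eVariationOn_unitInterval_val_le _).trans ?_)
  rw [mul_one, edist_nndist]

theorem intrinsicDist_eq_edist {S : Set E} {a b : E} (hS : segment ℝ a b ⊆ S) :
    intrinsicDist S a b = edist a b :=
  le_antisymm (intrinsicDist_le_of_segment id LipschitzWith.id hS) (edist_le_intrinsicDist S a b)

theorem IsShortestPath.trans {S : Set E} {a b c : E} {γ : Path a b} {γ' : Path b c}
    (h : IsShortestPath S γ) (h' : IsShortestPath S γ')
    (hd : intrinsicDist S a b + intrinsicDist S b c ≤ intrinsicDist S a c) :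
    IsShortestPath S (γ.trans γ') := by
  have hr : range (γ.trans γ') ⊆ S := by
    rw [Path.trans_range]
    exact union_subset h.1 h'.1
  refine ⟨hr, le_antisymm ?_ (iInf₂_le (γ.trans γ') hr)⟩
  refine (pathLength_trans_le _ _).trans ?_
  rw [h.2, h'.2]
  exact hd

end Paths

/-! ### Projection onto a closed convex set. -/

section Projection

variable {E : Type*} [NormedAddCommGroup E] [InnerProductSpace ℝ E] [CompleteSpace E]

/-- The nearest-point projection onto a closed convex set is nonexpanding, and it maps points
outside the interior to the boundary. -/
theorem exists_nearest_point_map {P : Set E} (hne : P.Nonempty) (hcl : IsClosed P)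
    (hconv : Convex ℝ P) :
    ∃ f : E → E, LipschitzWith 1 f ∧ (∀ x ∈ P, f x = x) ∧
      ∀ x ∉ interior P, f x ∈ frontier P := by
  have h1 : ∀ u : E, ∃ w ∈ P, ∀ y ∈ P, ⟪u - w, y - w⟫ ≤ 0 := by
    intro u
    obtain ⟨w, hw, h⟩ := exists_norm_eq_iInf_of_complete_convex hne hcl.isComplete hconv u
    exact ⟨w, hw, (norm_eq_iInf_iff_real_inner_le_zero hconv hw).1 h⟩
  choose f hfP hf using h1
  have hid : ∀ x ∈ P, f x = x := by
    intro x hx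
    have h := hf x x hx
    rw [real_inner_self_eq_norm_sq] at h
    have h0 : ‖x - f x‖ = 0 := by nlinarith [norm_nonneg (x - f x)]
    exact (sub_eq_zero.1 (norm_eq_zero.1 h0)).symm
  refine ⟨f, LipschitzWith.of_dist_le_mul fun x y => ?_, hid, fun x hx => ?_⟩
  · rw [NNReal.coe_one, one_mul, dist_eq_norm, dist_eq_norm]
    have a1 := hf x (f y) (hfP y)
    have a2 := hf y (f x) (hfP x)
    have a3 : ‖f x - f y‖ ^ 2 ≤ ⟪x - y, f x - f y⟫ := by
      rw [← real_inner_self_eq_norm_sq]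
      simp only [inner_sub_left, inner_sub_right] at *
      linarith
    have a4 := real_inner_le_norm (x - y) (f x - f y)
    by_contra hlt
    push Not at hlt
    nlinarith [norm_nonneg (x - y), norm_nonneg (f x - f y)]
  · refine ⟨subset_closure (hfP x), fun hint => ?_⟩
    have hmem : ∀ᶠ t : ℝ in nhdsWithin 0 (Ioi 0), f x + t • (x - f x) ∈ P := by
      have hc : Continuous fun t : ℝ => f x + t • (x - f x) := by fun_prop
      have := hc.tendsto 0
      rw [zero_smul, add_zero] at this
      exact (this.eventually (mem_interior_iff_mem_nhds.1 hint)).filter_mono nhdsWithin_le_nhds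
    obtain ⟨t, ht, htpos⟩ := (hmem.and self_mem_nhdsWithin).exists
    have h := hf x _ ht
    rw [add_sub_cancel_left, inner_smul_right, real_inner_self_eq_norm_sq] at h
    have h0 : ‖x - f x‖ = 0 := by
      have htp : (0 : ℝ) < t := htpos
      by_contra hne0
      have : 0 < t * ‖x - f x‖ ^ 2 := by positivity
      linarith
    have : x = f x := sub_eq_zero.1 (norm_eq_zero.1 h0)
    exact hx (this ▸ hint)

end Projection

/-! ### Half-space systems and their boundary. -/

/-- A finite system of half-spaces with distinct boundary hyperplanes and a common interior
point. -/
structure HalfspaceSystem (E : Type*) [NormedAddCommGroup E] [InnerProductSpace ℝ E]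
    (ι : Type*) where
  n : ι → E
  b : ι → ℝ
  norm_n : ∀ i, ‖n i‖ = 1
  inj : ∀ i j, n i = n j → b i = b j → i = j
  x₀ : E
  hx₀ : ∀ i, ⟪n i, x₀⟫ < b i

namespace HalfspaceSystem

variable {E : Type*} [NormedAddCommGroup E] [InnerProductSpace ℝ E] [FiniteDimensional ℝ E]
variable {ι : Type*} [Finite ι] (D : HalfspaceSystem E ι)

/-- The signed distance to the `i`-th hyperplane. -/
def g (i : ι) (x : E) : ℝ := ⟪D.n i, x⟫ - D.b i

def P : Set E := {x | ∀ i, D.g i x ≤ 0}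

def S : Set E := {x | x ∈ D.P ∧ ∃ i, D.g i x = 0}

def F (i : ι) : Set E := {x | x ∈ D.P ∧ D.g i x = 0}

variable {D}

theorem g_add (i : ι) (x y : E) : D.g i (x + y) = D.g i x + ⟪D.n i, y⟫ := by
  simp only [g, inner_add_right]; ring

theorem g_add_smul (i : ι) (x y : E) (t : ℝ) : D.g i (x + t • y) = D.g i x + t * ⟪D.n i, y⟫ := by
  rw [g_add, inner_smul_right]

theorem g_sub (i : ι) (x y : E) : D.g i x - D.g i y = ⟪D.n i, x - y⟫ := by
  simp only [g, inner_sub_right]; ring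

theorem g_combo (i : ι) (x y : E) (t : ℝ) :
    D.g i (x + t • (y - x)) = (1 - t) * D.g i x + t * D.g i y := by
  rw [g_add_smul, ← g_sub]; ring

@[fun_prop]
theorem continuous_g (i : ι) : Continuous (D.g i) := by
  unfold g; fun_prop

theorem F_subset_S (i : ι) : D.F i ⊆ D.S := fun _ h => ⟨h.1, i, h.2⟩

theorem isClosed_P : IsClosed D.P := by
  have : D.P = ⋂ i, {x | D.g i x ≤ 0} := by ext; simp [P]
  rw [this]
  exact isClosed_iInter fun i => isClosed_le (continuous_g i) continuous_const

theorem isClosed_F (i : ι) : IsClosed (D.F i) :=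
  isClosed_P.inter (isClosed_eq (continuous_g i) continuous_const)

theorem S_eq_iUnion : D.S = ⋃ i, D.F i := by
  ext x; simp [S, F]

theorem isClosed_S : IsClosed D.S := by
  rw [S_eq_iUnion]; exact isClosed_iUnion_of_finite isClosed_F

theorem P_combo {x y : E} (hx : x ∈ D.P) (hy : y ∈ D.P) {t : ℝ} (h0 : 0 ≤ t) (h1 : t ≤ 1) :
    x + t • (y - x) ∈ D.P := by
  intro i
  rw [g_combo]
  have h2 : (1 - t) * D.g i x ≤ 0 := mul_nonpos_of_nonneg_of_nonpos (by linarith) (hx i)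
  have h3 : t * D.g i y ≤ 0 := mul_nonpos_of_nonneg_of_nonpos h0 (hy i)
  linarith

theorem F_combo {i : ι} {x y : E} (hx : x ∈ D.F i) (hy : y ∈ D.F i) {t : ℝ} (h0 : 0 ≤ t)
    (h1 : t ≤ 1) : x + t • (y - x) ∈ D.F i := by
  refine ⟨P_combo hx.1 hy.1 h0 h1, ?_⟩
  rw [g_combo, hx.2, hy.2]; ring

theorem convex_P : Convex ℝ D.P := by
  rw [convex_iff_segment_subset]
  intro x hx y hy z hz
  rw [segment_eq_image'] at hz
  obtain ⟨t, ht, rfl⟩ := hz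
  exact P_combo hx hy ht.1 ht.2

theorem convex_F (i : ι) : Convex ℝ (D.F i) := by
  rw [convex_iff_segment_subset]
  intro x hx y hy z hz
  rw [segment_eq_image'] at hz
  obtain ⟨t, ht, rfl⟩ := hz
  exact F_combo hx hy ht.1 ht.2

theorem interior_P : interior D.P = {x | ∀ i, D.g i x < 0} := by
  refine subset_antisymm (fun x hx i => ?_) (interior_maximal (fun x hx i => (hx i).le) ?_)
  · by_contra hlt
    have hge : 0 ≤ D.g i x := not_lt.1 hlt
    have hc : Continuous fun t : ℝ => x + t • D.n i := by fun_prop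
    have h0 := hc.tendsto 0
    rw [zero_smul, add_zero] at h0
    have hmem : ∀ᶠ t : ℝ in 𝓝[>] 0, x + t • D.n i ∈ D.P :=
      (h0.eventually (mem_interior_iff_mem_nhds.1 hx)).filter_mono nhdsWithin_le_nhds
    obtain ⟨t, ht, htpos⟩ := (hmem.and self_mem_nhdsWithin).exists
    have h := ht i
    rw [g_add_smul, real_inner_self_eq_norm_sq, D.norm_n] at h
    have : (0 : ℝ) < t := htpos
    linarith
  · have : {x | ∀ i, D.g i x < 0} = ⋂ i, {x | D.g i x < 0} := by ext; simp
    rw [this]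
    exact isOpen_iInter_of_finite fun i => isOpen_lt (continuous_g i) continuous_const

theorem frontier_P : frontier D.P = D.S := by
  rw [isClosed_P.frontier_eq, interior_P]
  ext x
  refine and_congr_right fun hx => ⟨fun h => ?_, ?_⟩
  · by_contra hcon
    push Not at hcon
    exact h fun i => lt_of_le_of_ne (hx i) (hcon i)
  · rintro ⟨i, hi⟩ h
    exact (h i).ne hi

theorem P_nonempty : D.P.Nonempty := ⟨D.x₀, fun i => by have := D.hx₀ i; unfold g; linarith⟩

theorem g_x₀ (i : ι) : D.g i D.x₀ < 0 := by have := D.hx₀ i; unfold g; linarith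

/-- Two distinct constraints that are active at a point have independent normals. -/
theorem inner_n_lt {i j : ι} (hij : i ≠ j) {x : E} (hi : D.g i x = 0) (hj : D.g j x = 0) :
    -1 < ⟪D.n i, D.n j⟫ ∧ ⟪D.n i, D.n j⟫ < 1 := by
  have h1 : ⟪D.n i, D.n j⟫ ≠ 1 := by
    intro h
    have := (inner_eq_one_iff_of_norm_eq_one (D.norm_n i) (D.norm_n j)).1 h
    refine hij (D.inj i j this ?_)
    unfold g at hi hj
    rw [this] at hi
    linarith
  have h2 : ⟪D.n i, D.n j⟫ ≠ -1 := by
    intro h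
    have h3 : ⟪D.n i, -D.n j⟫ = (1 : ℝ) := by rw [inner_neg_right, h, neg_neg]
    have h4 := (inner_eq_one_iff_of_norm_eq_one (𝕜 := ℝ) (D.norm_n i)
      (by rw [norm_neg, D.norm_n j])).1 h3
    have hi' := D.g_x₀ i
    have hj' := D.g_x₀ j
    unfold g at hi hj hi' hj'
    rw [h4, inner_neg_left] at hi hi'
    linarith
  have h3 := abs_real_inner_le_norm (D.n i) (D.n j)
  rw [D.norm_n, D.norm_n, one_mul, abs_le] at h3
  exact ⟨lt_of_le_of_ne h3.1 (Ne.symm h2), lt_of_le_of_ne h3.2 h1⟩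

/-- Near `x`, only constraints active at `x` can be active. -/
theorem eventually_lt (x : E) (hx : x ∈ D.P) :
    ∀ᶠ y in 𝓝 x, ∀ k, D.g k x ≠ 0 → D.g k y < 0 := by
  refine eventually_all.2 fun k => ?_
  by_cases hk : D.g k x = 0
  · simp [hk]
  · have : D.g k x < 0 := lt_of_le_of_ne (hx k) hk
    filter_upwards [(continuous_g k).continuousAt.eventually_lt continuousAt_const this] with y hy _
    exact hy

theorem eventually_common_facet {x : E} (hx : x ∈ D.P) :
    ∀ᶠ y in 𝓝 x, ∀ i, y ∈ D.F i → x ∈ D.F i := by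
  filter_upwards [eventually_lt x hx] with y hy i hyi
  by_contra h
  have := hy i (fun h0 => h ⟨hx, h0⟩)
  rw [hyi.2] at this
  exact lt_irrefl _ this

theorem segment_notMem_interior {i : ι} {a b : E} (ha : 0 ≤ D.g i a) (hb : 0 ≤ D.g i b) :
    ∀ x ∈ segment ℝ a b, x ∉ interior D.P := by
  intro x hx hint
  rw [interior_P] at hint
  rw [segment_eq_image'] at hx
  obtain ⟨t, ht, rfl⟩ := hx
  have h := hint i
  rw [g_combo] at h
  have h2 : 0 ≤ (1 - t) * D.g i a := mul_nonneg (by linarith [ht.2]) ha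
  have h3 : 0 ≤ t * D.g i b := mul_nonneg ht.1 hb
  linarith

theorem intrinsicDist_facet {i : ι} {x y : E} (hx : x ∈ D.F i) (hy : y ∈ D.F i) :
    intrinsicDist D.S x y = edist x y :=
  intrinsicDist_eq_edist (((convex_F i).segment_subset hx hy).trans (F_subset_S i))

theorem exists_projection (D : HalfspaceSystem E ι) :
    ∃ f : E → E, (∀ x ∈ D.P, f x = x) ∧ ∀ (i : ι) (a b : E), 0 ≤ D.g i a → 0 ≤ D.g i b →
      intrinsicDist D.S (f a) (f b) ≤ edist a b := by
  obtain ⟨f, h1, h2, h3⟩ := exists_nearest_point_map D.P_nonempty D.isClosed_P D.convex_P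
  refine ⟨f, h2, fun i a b ha hb => intrinsicDist_le_of_segment f h1 fun x hx => ?_⟩
  rw [← frontier_P]
  exact h3 x (segment_notMem_interior ha hb x hx)

/-- A broken line with three pieces, each of which lies beyond one of the hyperplanes, bounds the
intrinsic distance of its endpoints. -/
theorem intrinsicDist_le_exterior {x y a c : E} (hx : x ∈ D.P) (hy : y ∈ D.P) (i j k : ι)
    (h1 : 0 ≤ D.g i x) (h2 : 0 ≤ D.g i a) (h3 : 0 ≤ D.g k a) (h4 : 0 ≤ D.g k c)
    (h5 : 0 ≤ D.g j c) (h6 : 0 ≤ D.g j y) :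
    intrinsicDist D.S x y ≤ edist x a + edist a c + edist c y := by
  obtain ⟨f, hf, hd⟩ := D.exists_projection
  calc intrinsicDist D.S x y = intrinsicDist D.S (f x) (f y) := by rw [hf x hx, hf y hy]
    _ ≤ intrinsicDist D.S (f x) (f c) + intrinsicDist D.S (f c) (f y) :=
        intrinsicDist_triangle ..
    _ ≤ intrinsicDist D.S (f x) (f a) + intrinsicDist D.S (f a) (f c) +
        intrinsicDist D.S (f c) (f y) := by gcongr; exact intrinsicDist_triangle ..
    _ ≤ _ := by
        gcongr
        exacts [hd i _ _ h1 h2, hd k _ _ h3 h4, hd j _ _ h5 h6]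

/-- If not all hyperplanes are parallel, any two boundary points have finite distance. -/
theorem intrinsicDist_ne_top (hD : ∃ i j, D.n i ≠ D.n j ∧ D.n i ≠ -D.n j) {x y : E}
    (hx : x ∈ D.S) (hy : y ∈ D.S) : intrinsicDist D.S x y ≠ ⊤ := by
  obtain ⟨f, hf, hd⟩ := D.exists_projection
  have hmeet : ∀ i j, D.n i ≠ D.n j → D.n i ≠ -D.n j → ∃ c, D.g i c = 0 ∧ D.g j c = 0 := by
    intro i j h1 h2
    set c := ⟪D.n i, D.n j⟫ with hc
    have hc1 : c ≠ 1 := fun h =>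
      h1 ((inner_eq_one_iff_of_norm_eq_one (D.norm_n i) (D.norm_n j)).1 h)
    have hc2 : c ≠ -1 := by
      intro h
      refine h2 ((inner_eq_one_iff_of_norm_eq_one (𝕜 := ℝ) (D.norm_n i)
        (by rw [norm_neg, D.norm_n j])).1 ?_)
      rw [inner_neg_right, ← hc, h, neg_neg]
    have hc3 : 1 - c ^ 2 ≠ 0 := by
      intro h
      have : (1 - c) * (1 + c) = 0 := by linarith
      rcases mul_eq_zero.1 this with h | h
      · exact hc1 (by linarith)
      · exact hc2 (by linarith)
    -- Cramer's rule for the common point in the span of the two normals, with Gram determinant 1 -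
    -- c².
    refine ⟨((D.b i - c * D.b j) / (1 - c ^ 2)) • D.n i +
      ((D.b j - c * D.b i) / (1 - c ^ 2)) • D.n j, ?_, ?_⟩
    · simp only [g, inner_add_right, inner_smul_right, real_inner_self_eq_norm_sq, D.norm_n]
      rw [← hc]
      field_simp
      ring
    · simp only [g, inner_add_right, inner_smul_right, real_inner_self_eq_norm_sq, D.norm_n]
      rw [real_inner_comm, ← hc]
      field_simp
      ring
  have hstep : ∀ i a b, D.g i a = 0 → D.g i b = 0 → intrinsicDist D.S (f a) (f b) ≠ ⊤ :=
    fun i a b ha hb => ne_top_of_le_ne_top (edist_ne_top a b) (hd i a b ha.ge hb.ge)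
  have htr : ∀ a b c, intrinsicDist D.S a b ≠ ⊤ → intrinsicDist D.S b c ≠ ⊤ →
      intrinsicDist D.S a c ≠ ⊤ := fun a b c h1 h2 =>
    ne_top_of_le_ne_top (ENNReal.add_ne_top.2 ⟨h1, h2⟩) (intrinsicDist_triangle D.S a b c)
  have hnp : ∀ i j a b, D.n i ≠ D.n j → D.n i ≠ -D.n j → D.g i a = 0 → D.g j b = 0 →
      intrinsicDist D.S (f a) (f b) ≠ ⊤ := by
    intro i j a b h1 h2 ha hb
    obtain ⟨c, hc1, hc2⟩ := hmeet i j h1 h2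
    exact htr _ (f c) _ (hstep i a c ha hc1) (hstep j c b hc2 hb)
  obtain ⟨hxP, i, hi⟩ := hx
  obtain ⟨hyP, j, hj⟩ := hy
  rw [← hf x hxP, ← hf y hyP]
  by_cases hpar : D.n i ≠ D.n j ∧ D.n i ≠ -D.n j
  · exact hnp i j x y hpar.1 hpar.2 hi hj
  · have hpar' : D.n j = D.n i ∨ D.n j = -D.n i := by
      by_contra hcon
      push Not at hcon
      refine hpar ⟨hcon.1.symm, fun h => hcon.2 (by rw [h, neg_neg])⟩
    -- Two parallel hyperplanes are linked through a third one that meets both.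
    have hk : ∃ k, D.n i ≠ D.n k ∧ D.n i ≠ -D.n k := by
      by_contra hcon
      push Not at hcon
      obtain ⟨a, c, h1, h2⟩ := hD
      have ha : D.n a = D.n i ∨ D.n a = -D.n i := by
        by_cases h : D.n i = D.n a
        · exact Or.inl h.symm
        · right; rw [hcon a h, neg_neg]
      have hc : D.n c = D.n i ∨ D.n c = -D.n i := by
        by_cases h : D.n i = D.n c
        · exact Or.inl h.symm
        · right; rw [hcon c h, neg_neg]
      rcases ha with ha | ha <;> rcases hc with hc | hc <;> simp [ha, hc] at h1 h2
    obtain ⟨k, hk1, hk2⟩ := hk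
    obtain ⟨c, hc1, hc2⟩ := hmeet i k hk1 hk2
    have hk3 : D.n k ≠ D.n j ∧ D.n k ≠ -D.n j := by
      rcases hpar' with h | h <;> rw [h]
      · exact ⟨hk1.symm, fun h' => hk2 (by rw [h', neg_neg])⟩
      · exact ⟨fun h' => hk2 (by rw [h', neg_neg]), by rw [neg_neg]; exact hk1.symm⟩
    exact htr _ (f c) _ (hstep i x c hi hc1) (hnp k j c y hk3.1 hk3.2 hc2 hj)

end HalfspaceSystem

/-! ### The distance to the source and initial segments of shortest paths. -/

/-- A half-space system with a source point on its boundary, at which only one constraint is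
active and which has finite distance to all boundary points. -/
structure SourcedSystem (E : Type*) [NormedAddCommGroup E] [InnerProductSpace ℝ E]
    (ι : Type*) extends HalfspaceSystem E ι where
  v : E
  i₀ : ι
  hv : v ∈ toHalfspaceSystem.P
  hact : ∀ k, toHalfspaceSystem.g k v = 0 ↔ k = i₀
  hfin : ∀ x ∈ toHalfspaceSystem.S, intrinsicDist toHalfspaceSystem.S x v ≠ ⊤

namespace SourcedSystem

open HalfspaceSystem

variable {E : Type*} [NormedAddCommGroup E] [InnerProductSpace ℝ E] [FiniteDimensional ℝ E]
variable {ι : Type*} [Finite ι] (D : SourcedSystem E ι)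

/-- The intrinsic distance to the source. -/
noncomputable def rho (x : E) : ℝ := (intrinsicDist D.S x D.v).toReal

/-- A shortest path from `x` to the source may start with the segment from `x` to `m` in the
`i`-th facet. -/
def Desc (x : E) (i : ι) (m : E) : Prop :=
  x ∈ D.F i ∧ m ∈ D.F i ∧ m ≠ x ∧ D.rho x = ‖m - x‖ + D.rho m

variable {D}

theorem v_mem_F : D.v ∈ D.F D.i₀ := ⟨D.hv, (D.hact _).2 rfl⟩

theorem v_mem_S : D.v ∈ D.S := F_subset_S _ v_mem_F

theorem rho_nonneg (x : E) : 0 ≤ D.rho x := ENNReal.toReal_nonneg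

@[simp]
theorem rho_v : D.rho D.v = 0 := by
  rw [rho, intrinsicDist_self v_mem_S, ENNReal.toReal_zero]

theorem norm_le_rho {x : E} (hx : x ∈ D.S) : ‖x - D.v‖ ≤ D.rho x := by
  rw [← dist_eq_norm, dist_edist]
  exact ENNReal.toReal_mono (D.hfin x hx) (edist_le_intrinsicDist _ _ _)

theorem rho_pos {x : E} (hx : x ∈ D.S) (h : x ≠ D.v) : 0 < D.rho x :=
  lt_of_lt_of_le (norm_pos_iff.2 (sub_ne_zero.2 h)) (norm_le_rho hx)

theorem rho_le_of_intrinsicDist_le {x y : E} (hy : y ∈ D.S) {c : ℝ} (hc : 0 ≤ c)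
    (h : intrinsicDist D.S x y ≤ ENNReal.ofReal c) : D.rho x ≤ c + D.rho y := by
  have h1 := (intrinsicDist_triangle D.S x y D.v).trans (add_le_add_left h _)
  have h2 := ENNReal.toReal_mono (by simp [D.hfin y hy]) h1
  rwa [ENNReal.toReal_add ENNReal.ofReal_ne_top (D.hfin y hy), ENNReal.toReal_ofReal hc] at h2

theorem rho_le_of_facet {i : ι} {x y : E} (hx : x ∈ D.F i) (hy : y ∈ D.F i) :
    D.rho x ≤ ‖y - x‖ + D.rho y := by
  refine rho_le_of_intrinsicDist_le (F_subset_S i hy) (norm_nonneg _) ?_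
  rw [intrinsicDist_facet hx hy, ← dist_eq_norm, dist_comm, edist_dist]

theorem rho_le_exterior {x y a c : E} (hx : x ∈ D.P) (hy : y ∈ D.S) (i j k : ι)
    (h1 : 0 ≤ D.g i x) (h2 : 0 ≤ D.g i a) (h3 : 0 ≤ D.g k a) (h4 : 0 ≤ D.g k c)
    (h5 : 0 ≤ D.g j c) (h6 : 0 ≤ D.g j y) :
    D.rho x ≤ dist x a + dist a c + dist c y + D.rho y := by
  refine rho_le_of_intrinsicDist_le hy (by positivity) ?_
  refine (intrinsicDist_le_exterior hx hy.1 i j k h1 h2 h3 h4 h5 h6).trans ?_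
  rw [ENNReal.ofReal_add (by positivity) (by positivity),
    ENNReal.ofReal_add (by positivity) (by positivity), ← edist_dist, ← edist_dist, ← edist_dist]

theorem abs_rho_sub_le {i : ι} {x y : E} (hx : x ∈ D.F i) (hy : y ∈ D.F i) :
    |D.rho x - D.rho y| ≤ ‖x - y‖ := by
  have h1 := rho_le_of_facet hx hy
  have h2 := rho_le_of_facet hy hx
  rw [norm_sub_rev] at h1
  rw [abs_le]
  constructor <;> linarith

/-- On each facet `rho` is 1-Lipschitz, and every boundary point near x shares a facet with x. -/
theorem continuousOn_rho : ContinuousOn D.rho D.S := by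
  intro x hx
  rw [ContinuousWithinAt, tendsto_iff_dist_tendsto_zero]
  refine squeeze_zero' (g := fun y => ‖y - x‖) (Eventually.of_forall fun _ => dist_nonneg) ?_ ?_
  · filter_upwards [(eventually_common_facet hx.1).filter_mono nhdsWithin_le_nhds,
      self_mem_nhdsWithin] with y hy hyS
    obtain ⟨i, hi⟩ := hyS.2
    have hyi : y ∈ D.F i := ⟨hyS.1, hi⟩
    rw [Real.dist_eq]
    exact abs_rho_sub_le hyi (hy i hyi)
  · have : Continuous fun y : E => ‖y - x‖ := by fun_prop
    have h := this.tendsto x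
    rw [sub_self, norm_zero] at h
    exact h.mono_left nhdsWithin_le_nhds

/-- Shortest paths start along facets. -/
theorem exists_desc {x : E} (hx : x ∈ D.S) (hxv : x ≠ D.v) :
    ∃ r₀ > 0, ∀ r, 0 < r → r < r₀ → ∃ i m, D.Desc x i m ∧ ‖m - x‖ = r := by
  obtain ⟨r₁, hr₁, hball⟩ := Metric.eventually_nhds_iff.1 (eventually_common_facet hx.1)
  -- The bound r₁ puts points of the sphere into common facets with x; the other bound makes every
  -- path to the source cross the sphere.
  refine ⟨min r₁ (dist D.v x), lt_min hr₁ (dist_pos.2 hxv.symm), fun r hr hr' => ?_⟩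
  set M := D.S ∩ Metric.sphere x r
  have hM : IsCompact M := (isCompact_sphere x r).inter_left isClosed_S
  have hfacet : ∀ m ∈ M, ∃ i, x ∈ D.F i ∧ m ∈ D.F i := by
    rintro m ⟨⟨hmP, i, hi⟩, hm⟩
    refine ⟨i, hball ?_ i ⟨hmP, hi⟩, hmP, hi⟩
    rw [Metric.mem_sphere.1 hm]
    exact hr'.trans_le (min_le_left _ _)
  have hsplit : ∀ γ : Path x D.v, range γ ⊆ D.S → ∃ m ∈ M,
      intrinsicDist D.S x m + intrinsicDist D.S m D.v ≤ pathLength γ := by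
    intro γ hγ
    obtain ⟨t, ht, h⟩ := exists_sphere_split γ hγ hr.le (hr'.le.trans (min_le_right _ _))
    exact ⟨γ t, ⟨hγ (mem_range_self t), ht⟩, h⟩
  have hne : M.Nonempty := by
    have h := D.hfin x hx
    rw [intrinsicDist] at h
    simp only [ne_eq, iInf_eq_top, not_forall] at h
    obtain ⟨γ, hγ, -⟩ := h
    obtain ⟨m, hm, -⟩ := hsplit γ hγ
    exact ⟨m, hm⟩
  obtain ⟨m, hm, hmin⟩ := hM.exists_isMinOn hne (continuousOn_rho.mono inter_subset_left)
  obtain ⟨i, hxi, hmi⟩ := hfacet m hm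
  have hnorm : ‖m - x‖ = r := by rw [← dist_eq_norm]; exact hm.2
  refine ⟨i, m, ⟨hxi, hmi, ?_, ?_⟩, hnorm⟩
  · intro h
    rw [h, sub_self, norm_zero] at hnorm
    exact hr.ne hnorm
  · refine le_antisymm (rho_le_of_facet hxi hmi) ?_
    -- Any path costs at least r up to the sphere and afterwards at least `rho` of its crossing
    -- point, which m minimizes.
    have hle : ENNReal.ofReal (r + D.rho m) ≤ intrinsicDist D.S x D.v := by
      refine le_iInf₂ fun γ hγ => ?_
      obtain ⟨m', hm', h⟩ := hsplit γ hγ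
      refine le_trans ?_ h
      rw [ENNReal.ofReal_add hr.le (rho_nonneg _)]
      refine add_le_add ?_ ?_
      · have := edist_le_intrinsicDist D.S x m'
        rwa [edist_comm, edist_dist, Metric.mem_sphere.1 hm'.2] at this
      · refine (ENNReal.ofReal_le_ofReal (hmin hm')).trans ?_
        rw [rho, ENNReal.ofReal_toReal (D.hfin m' hm'.1)]
    have := (ENNReal.ofReal_le_iff_le_toReal (D.hfin x hx)).1 hle
    rw [hnorm]
    exact this

end SourcedSystem

/-! ### Euclidean geometry of a wedge. -/

section Euclidean

variable {E : Type*} [NormedAddCommGroup E] [InnerProductSpace ℝ E]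

/-- The unit vector pointing from `x` to `m`. -/
noncomputable def udir (x m : E) : E := ‖m - x‖⁻¹ • (m - x)

theorem norm_udir {x m : E} (h : m ≠ x) : ‖udir x m‖ = 1 := by
  have : ‖m - x‖ ≠ 0 := norm_ne_zero_iff.2 (sub_ne_zero.2 h)
  rw [udir, norm_smul, norm_inv, norm_norm, inv_mul_cancel₀ this]

theorem norm_smul_udir (x m : E) : ‖m - x‖ • udir x m = m - x := by
  by_cases h : m - x = 0
  · simp [h]
  · rw [udir, smul_smul, mul_inv_cancel₀ (norm_ne_zero_iff.2 h), one_smul]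

theorem udir_add_smul {x e : E} (he : ‖e‖ = 1) {t : ℝ} (ht : 0 < t) : udir x (x + t • e) = e := by
  rw [udir, add_sub_cancel_left, norm_smul, he, Real.norm_of_nonneg ht.le, mul_one, smul_smul,
    inv_mul_cancel₀ ht.ne', one_smul]

/-- A first order expansion of the norm with explicit quadratic error, from 2‖a‖‖a - δy‖ ≤ ‖a‖² + ‖a
- δy‖². -/
theorem norm_sub_smul_le {a : E} (ha : a ≠ 0) (y : E) (δ : ℝ) :
    ‖a - δ • y‖ ≤ ‖a‖ - δ * ⟪‖a‖⁻¹ • a, y⟫ + δ ^ 2 * (‖y‖ ^ 2 / (2 * ‖a‖)) := by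
  have hpos : 0 < ‖a‖ := norm_pos_iff.2 ha
  have h1 : ‖a - δ • y‖ ^ 2 = ‖a‖ ^ 2 - 2 * (δ * ⟪a, y⟫) + δ ^ 2 * ‖y‖ ^ 2 := by
    rw [norm_sub_sq_real, inner_smul_right, norm_smul, mul_pow, Real.norm_eq_abs, sq_abs]
  have h2 : 2 * ‖a‖ * ‖a - δ • y‖ ≤ ‖a‖ ^ 2 + ‖a - δ • y‖ ^ 2 := two_mul_le_add_sq _ _
  have h3 : ‖a‖ - δ * ⟪‖a‖⁻¹ • a, y⟫ + δ ^ 2 * (‖y‖ ^ 2 / (2 * ‖a‖)) =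
      (‖a‖ ^ 2 + ‖a - δ • y‖ ^ 2) / (2 * ‖a‖) := by
    rw [h1, real_inner_smul_left]
    field_simp
    ring
  rw [h3, le_div_iff₀ (by positivity)]
  linarith

theorem exists_orthogonal_pos (K : Submodule ℝ E) [FiniteDimensional ℝ K] {s : E} (hs : s ∉ K) :
    ∃ y, (∀ z ∈ K, ⟪z, y⟫ = 0) ∧ 0 < ⟪s, y⟫ := by
  obtain ⟨z, hz, y, hy, rfl⟩ := K.exists_add_mem_mem_orthogonal s
  refine ⟨y, fun z hz => (K.mem_orthogonal y).1 hy z hz, ?_⟩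
  rw [inner_add_left, (K.mem_orthogonal y).1 hy z hz, zero_add, real_inner_self_eq_norm_sq]
  have : y ≠ 0 := by
    rintro rfl
    exact hs (by simpa using hz)
  positivity

/-- Two unit vectors in the sides of a wedge whose sum is normal to the edge of the wedge. -/
theorem wedge_straight {n₁ n₂ u w : E} (h₁ : ‖n₁‖ = 1) (h₂ : ‖n₂‖ = 1) (hu : ‖u‖ = 1)
    (hw : ‖w‖ = 1) (hc : -1 < ⟪n₁, n₂⟫ ∧ ⟪n₁, n₂⟫ < 1) (hs : u + w ≠ 0)
    (hspan : u + w ∈ Submodule.span ℝ {n₁, n₂}) (hu1 : ⟪n₁, u⟫ = 0) (hw2 : ⟪n₂, w⟫ = 0)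
    (hu2 : ⟪n₂, u⟫ ≤ 0) (hw1 : ⟪n₁, w⟫ ≤ 0) : ∃ α < (0 : ℝ), u + w = α • (n₁ + n₂) := by
  obtain ⟨a, b, hab⟩ := Submodule.mem_span_pair.1 hspan
  have i1 : ⟪n₁, u + w⟫ = a + b * ⟪n₁, n₂⟫ := by
    rw [← hab, inner_add_right, inner_smul_right, inner_smul_right, real_inner_self_eq_norm_sq, h₁]
    ring
  have i2 : ⟪n₂, u + w⟫ = a * ⟪n₁, n₂⟫ + b := by
    rw [← hab, inner_add_right, inner_smul_right, inner_smul_right, real_inner_self_eq_norm_sq, h₂,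
      real_inner_comm]
    ring
  have j1 : ⟪u, u + w⟫ = b * ⟪n₂, u⟫ := by
    rw [← hab, inner_add_right, inner_smul_right, inner_smul_right, real_inner_comm, hu1,
      real_inner_comm]
    ring
  have j2 : ⟪w, u + w⟫ = a * ⟪n₁, w⟫ := by
    rw [← hab, inner_add_right, inner_smul_right, inner_smul_right, real_inner_comm,
      real_inner_comm n₂ w, hw2]
    ring
  rw [inner_add_right, hu1, zero_add] at i1
  rw [inner_add_right, hw2, add_zero] at i2
  have j3 : ⟪u, u + w⟫ = ⟪w, u + w⟫ := by
    rw [inner_add_right, inner_add_right, real_inner_self_eq_norm_sq, real_inner_self_eq_norm_sq,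
      hu, hw, real_inner_comm w u]
    ring
  rw [j1, j2, i1, i2] at j3
  set c := ⟪n₁, n₂⟫
  -- Since u and w are unit vectors, both have the same inner product with u + w; in the
  -- coefficients this reads b(ac + b) = a(a + bc), that is, a² = b².
  have hsq : (b - a) * (b + a) = 0 := by linarith
  rcases mul_eq_zero.1 hsq with h | h
  · have hba : b = a := by linarith
    subst hba
    have hab' : u + w = b • (n₁ + n₂) := by rw [← hab, smul_add]
    refine ⟨b, ?_, hab'⟩
    have hb0 : b ≠ 0 := by
      rintro rfl
      exact hs (by rw [hab', zero_smul])
    have : b ≤ 0 := by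
      by_contra hb
      push Not at hb
      nlinarith
    exact lt_of_le_of_ne this hb0
  · exfalso
    have hba : b = -a := by linarith
    subst hba
    have ha1 : a ≤ 0 := by
      by_contra ha
      push Not at ha
      nlinarith
    have ha2 : 0 ≤ a := by
      by_contra ha
      push Not at ha
      nlinarith
    have ha : a = 0 := le_antisymm ha1 ha2
    exact hs (by rw [← hab, ha]; simp)

end Euclidean

/-! ### Unfolding across a ridge by a reflection. -/

namespace HalfspaceSystem

variable {E : Type*} [NormedAddCommGroup E] [InnerProductSpace ℝ E] [FiniteDimensional ℝ E]
variable {ι : Type*} [Finite ι] (D : HalfspaceSystem E ι)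

/-- The reflection that rotates the `i`-th hyperplane into the `j`-th one, exchanging the two sides
of their intersection. -/
noncomputable def refl (i j : ι) (x : E) : E :=
  x - ((D.g i x + D.g j x) / (1 + ⟪D.n i, D.n j⟫)) • (D.n i + D.n j)

variable {D}

theorem refl_comm (i j : ι) (x : E) : D.refl i j x = D.refl j i x := by
  rw [refl, refl, real_inner_comm, add_comm (D.g i x), add_comm (D.n i)]

theorem g_refl_left {i j : ι} (h : -1 < ⟪D.n i, D.n j⟫) (x : E) :
    D.g i (D.refl i j x) = -D.g j x := by
  have h0 : 1 + ⟪D.n i, D.n j⟫ ≠ 0 := by linarith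
  rw [refl, sub_eq_add_neg, ← neg_smul, g_add_smul, inner_add_right, real_inner_self_eq_norm_sq,
    D.norm_n]
  field_simp
  ring

theorem g_refl_right {i j : ι} (h : -1 < ⟪D.n i, D.n j⟫) (x : E) :
    D.g j (D.refl i j x) = -D.g i x := by
  rw [refl_comm, g_refl_left (by rwa [real_inner_comm])]

theorem refl_refl {i j : ι} (h : -1 < ⟪D.n i, D.n j⟫) (x : E) :
    D.refl i j (D.refl i j x) = x := by
  rw [refl, g_refl_left h, g_refl_right h, refl]
  have : (-D.g j x + -D.g i x) / (1 + ⟪D.n i, D.n j⟫) =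
      -((D.g i x + D.g j x) / (1 + ⟪D.n i, D.n j⟫)) := by ring
  rw [this, neg_smul]
  abel

theorem refl_sub {i j : ι} (x y : E) : D.refl i j x - D.refl i j y =
    (x - y) - ((⟪D.n i, x - y⟫ + ⟪D.n j, x - y⟫) / (1 + ⟪D.n i, D.n j⟫)) •
      (D.n i + D.n j) := by
  rw [refl, refl, ← g_sub, ← g_sub]
  module

theorem norm_refl_sub {i j : ι} (h : -1 < ⟪D.n i, D.n j⟫) (x y : E) :
    ‖D.refl i j x - D.refl i j y‖ = ‖x - y‖ := by
  have h0 : 1 + ⟪D.n i, D.n j⟫ ≠ 0 := by linarith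
  rw [← sq_eq_sq₀ (norm_nonneg _) (norm_nonneg _), refl_sub, norm_sub_sq_real, inner_smul_right,
    norm_smul, mul_pow, Real.norm_eq_abs, sq_abs, norm_add_sq_real, D.norm_n, D.norm_n,
    inner_add_right, real_inner_comm, real_inner_comm (D.n j) (x - y)]
  field_simp
  ring

theorem refl_of_mem {i j : ι} {x : E} (hi : D.g i x = 0) (hj : D.g j x = 0) :
    D.refl i j x = x := by
  rw [refl, hi, hj]; simp

theorem norm_refl_sub_of_mem {i j : ι} (h : -1 < ⟪D.n i, D.n j⟫) {x : E} (hi : D.g i x = 0)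
    (hj : D.g j x = 0) (y : E) : ‖x - D.refl i j y‖ = ‖x - y‖ := by
  conv_lhs => rw [← refl_of_mem hi hj]
  exact norm_refl_sub h x y

/-- Reflection of a point on a ray that continues straight across the edge of a wedge. -/
theorem refl_ray {i j : ι} (h : -1 < ⟪D.n i, D.n j⟫) {p u w : E} {α : ℝ} (hi : D.g i p = 0)
    (hj : D.g j p = 0) (hu : ⟪D.n i, u⟫ = 0) (hw : ⟪D.n j, w⟫ = 0)
    (hs : u + w = α • (D.n i + D.n j)) (t : ℝ) : D.refl i j (p + t • w) = p - t • u := by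
  have h0 : 1 + ⟪D.n i, D.n j⟫ ≠ 0 := by linarith
  have h1 : ⟪D.n i, w⟫ = α * (1 + ⟪D.n i, D.n j⟫) := by
    have : ⟪D.n i, u + w⟫ = α * (1 + ⟪D.n i, D.n j⟫) := by
      rw [hs, inner_smul_right, inner_add_right, real_inner_self_eq_norm_sq, D.norm_n]; ring
    rwa [inner_add_right, hu, zero_add] at this
  have h2 : (t * (α * (1 + ⟪D.n i, D.n j⟫))) / (1 + ⟪D.n i, D.n j⟫) = t * α := by
    field_simp
  rw [refl, g_add_smul, g_add_smul, hi, hj, hw, h1]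
  simp only [mul_zero, add_zero, zero_add]
  rw [h2, mul_smul, ← hs]
  module

theorem eq_of_mem_span_singleton {i k : ι} {x : E} (hi : D.g i x = 0) (hk : D.g k x = 0) {a : ℝ}
    (h : D.n k = a • D.n i) : k = i := by
  by_contra hne
  have h1 := inner_n_lt hne hk hi
  have h2 : |a| = 1 := by
    have := congrArg norm h
    rwa [norm_smul, D.norm_n, D.norm_n, mul_one, Real.norm_eq_abs, eq_comm] at this
  rw [h, real_inner_smul_left, real_inner_self_eq_norm_sq, D.norm_n] at h1
  rcases eq_or_eq_neg_of_abs_eq h2 with h | h <;> rw [h] at h1 <;> norm_num at h1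

end HalfspaceSystem

/-! ### First variation and the crossing of ridges. -/

namespace SourcedSystem

open HalfspaceSystem

variable {E : Type*} [NormedAddCommGroup E] [InnerProductSpace ℝ E] [FiniteDimensional ℝ E]
variable {ι : Type*} [Finite ι] {D : SourcedSystem E ι}

/-- First variation: pushing a corner of a shortest path outwards does not shorten it. -/
theorem corner_first_order {q x m : E} {i j : ι} (hq : q ∈ D.F i) (hx : x ∈ D.F i)
    (hx' : x ∈ D.F j) (hm : m ∈ D.F j) (hqx : q ≠ x) (hmx : m ≠ x)
    (h : D.rho q = ‖q - x‖ + ‖m - x‖ + D.rho m) {k : ι} (hk : D.g k x = 0) {y₁ y₂ : E}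
    (h1 : 0 ≤ ⟪D.n i, y₁⟫) (h2 : 0 ≤ ⟪D.n k, y₁⟫) (h3 : 0 ≤ ⟪D.n k, y₂⟫)
    (h4 : 0 ≤ ⟪D.n j, y₂⟫) : ⟪udir x q, y₁⟫ + ⟪udir x m, y₂⟫ ≤ ‖y₁ - y₂‖ := by
  by_contra hlt
  push Not at hlt
  set c := ⟪udir x q, y₁⟫ + ⟪udir x m, y₂⟫ - ‖y₁ - y₂‖ with hc
  have hcpos : 0 < c := by linarith
  set C := ‖y₁‖ ^ 2 / (2 * ‖q - x‖) + ‖y₂‖ ^ 2 / (2 * ‖m - x‖) with hC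
  have hCnn : 0 ≤ C := by positivity
  -- Small enough that the second order error δ²C stays below the first order gain δc.
  set δ := c / (C + 1) with hδ
  have hδpos : 0 < δ := by positivity
  have hlt2 : δ ^ 2 * C < δ * c := by
    have : δ * (C + 1) = c := by rw [hδ]; field_simp
    have h5 : δ * c = δ ^ 2 * C + δ ^ 2 := by rw [← this]; ring
    rw [h5]
    have : 0 < δ ^ 2 := by positivity
    linarith
  have hpos : ∀ l y, D.g l x = 0 → 0 ≤ ⟪D.n l, y⟫ → 0 ≤ D.g l (x + δ • y) := by
    intro l y hl hy
    rw [g_add_smul, hl, zero_add]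
    positivity
  have hle := rho_le_exterior hq.1 (F_subset_S j hm) i j k hq.2.ge (hpos i y₁ hx.2 h1)
    (hpos k y₁ hk h2) (hpos k y₂ hk h3) (hpos j y₂ hx'.2 h4) hm.2.ge
  have e1 : dist q (x + δ • y₁) ≤ ‖q - x‖ - δ * ⟪udir x q, y₁⟫ +
      δ ^ 2 * (‖y₁‖ ^ 2 / (2 * ‖q - x‖)) := by
    rw [dist_eq_norm, ← sub_sub]
    exact norm_sub_smul_le (sub_ne_zero.2 hqx) y₁ δ
  have e2 : dist (x + δ • y₂) m ≤ ‖m - x‖ - δ * ⟪udir x m, y₂⟫ +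
      δ ^ 2 * (‖y₂‖ ^ 2 / (2 * ‖m - x‖)) := by
    rw [dist_comm, dist_eq_norm, ← sub_sub]
    exact norm_sub_smul_le (sub_ne_zero.2 hmx) y₂ δ
  have e3 : dist (x + δ • y₁) (x + δ • y₂) = δ * ‖y₁ - y₂‖ := by
    rw [dist_eq_norm, add_sub_add_left_eq_sub, ← smul_sub, norm_smul, Real.norm_of_nonneg hδpos.le]
  rw [h] at hle
  have e4 : δ ^ 2 * C = δ ^ 2 * (‖y₁‖ ^ 2 / (2 * ‖q - x‖)) +
      δ ^ 2 * (‖y₂‖ ^ 2 / (2 * ‖m - x‖)) := by rw [hC]; ring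
  have e5 : δ * c = δ * ⟪udir x q, y₁⟫ + δ * ⟪udir x m, y₂⟫ - δ * ‖y₁ - y₂‖ := by rw [hc]; ring
  linarith

/-- A shortest path continues straight across an edge between two facets, and it does not meet
faces of smaller dimension. -/
theorem corner {q x m : E} {i j : ι} (hq : q ∈ D.F i) (hqx : q ≠ x) (hx : x ∈ D.F i)
    (hqr : D.rho q = ‖q - x‖ + D.rho x) (hd : D.Desc x j m) :
    udir x m = -udir x q ∨ (i ≠ j ∧ (∃ α < (0 : ℝ), udir x q + udir x m = α • (D.n i + D.n j)) ∧
      ∀ k, D.g k x = 0 → D.n k ∈ Submodule.span ℝ {D.n i, D.n j}) := by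
  obtain ⟨hx', hm, hmx, hmr⟩ := hd
  by_cases hs0 : udir x q + udir x m = 0
  · left; rw [eq_neg_iff_add_eq_zero, add_comm]; exact hs0
  right
  have hfo := fun k (hk : D.g k x = 0) y₁ y₂ => corner_first_order (k := k) (y₁ := y₁) (y₂ := y₂)
    hq hx hx' hm hqx hmx (by rw [hqr, hmr]; ring) hk
  set u := udir x q with hu
  set w := udir x m with hw
  have hun : ‖u‖ = 1 := norm_udir hqx
  have hwn : ‖w‖ = 1 := norm_udir hmx
  have hgu : ∀ k, D.g k x = 0 → ⟪D.n k, u⟫ = ‖q - x‖⁻¹ * D.g k q := by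
    intro k hk
    rw [hu, udir, inner_smul_right, ← g_sub, hk, sub_zero]
  have hgw : ∀ k, D.g k x = 0 → ⟪D.n k, w⟫ = ‖m - x‖⁻¹ * D.g k m := by
    intro k hk
    rw [hw, udir, inner_smul_right, ← g_sub, hk, sub_zero]
  have hiu : ⟪D.n i, u⟫ = 0 := by rw [hgu i hx.2, hq.2, mul_zero]
  have hjw : ⟪D.n j, w⟫ = 0 := by rw [hgw j hx'.2, hm.2, mul_zero]
  have hju : ⟪D.n j, u⟫ ≤ 0 := by
    rw [hgu j hx'.2]; exact mul_nonpos_of_nonneg_of_nonpos (by positivity) (hq.1 j)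
  have hiw : ⟪D.n i, w⟫ ≤ 0 := by
    rw [hgw i hx.2]; exact mul_nonpos_of_nonneg_of_nonpos (by positivity) (hm.1 i)
  set K := Submodule.span ℝ {D.n i, D.n j} with hK
  have hiK : D.n i ∈ K := Submodule.subset_span (by simp)
  have hjK : D.n j ∈ K := Submodule.subset_span (by simp)
  have hsK : u + w ∈ K := by
    -- Otherwise the whole corner can be shifted inside both hyperplanes, orthogonally to the two
    -- normals, with a first order gain.
    by_contra hsK
    obtain ⟨y, hy, hpos⟩ := exists_orthogonal_pos K hsK
    have := hfo i hx.2 y y (hy _ hiK).ge (hy _ hiK).ge (hy _ hiK).ge (hy _ hjK).ge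
    rw [sub_self, norm_zero, ← inner_add_left] at this
    linarith
  have hij : i ≠ j := by
    rintro rfl
    have h1 : ∀ z ∈ K, ⟪z, u + w⟫ = 0 := by
      intro z hz
      obtain ⟨a, b, rfl⟩ := Submodule.mem_span_pair.1 hz
      have h2 : ⟪D.n i, u + w⟫ = 0 := by rw [inner_add_right, hiu, hjw, add_zero]
      rw [inner_add_left, real_inner_smul_left, real_inner_smul_left, h2]
      simp
    exact hs0 (inner_self_eq_zero.1 (h1 _ hsK))
  refine ⟨hij, wedge_straight (D.norm_n i) (D.norm_n j) hun hwn (inner_n_lt hij hx.2 hx'.2) hs0 hsK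
    hiu hjw hju hiw, fun k hk => ?_⟩
  by_contra hkK
  obtain ⟨y, hy, hpos⟩ := exists_orthogonal_pos K hkK
  set ε := ⟪D.n k, y⟫ with hε
  have hbound : ∀ z : E, ‖z‖ = 1 → -1 ≤ ⟪D.n k, z⟫ := by
    intro z hz
    have := abs_real_inner_le_norm (D.n k) z
    rw [D.norm_n, hz, one_mul, abs_le] at this
    exact this.1
  -- The corner is cut off by a segment beyond the k-th hyperplane. As ⟪n k, y⟫ = ε and unit vectors
  -- have inner product at least -1 with n k, both new corners lie beyond it. The gain 2ε against
  -- the length ε‖u - w‖ then forces ‖u - w‖ ≥ 2, hence u + w = 0 by the parallelogram law.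
  have := hfo k hk (y + ε • u) (y + ε • w)
    (by rw [inner_add_right, hy _ hiK, inner_smul_right, hiu]; simp)
    (by rw [inner_add_right, inner_smul_right]; nlinarith [hbound u hun])
    (by rw [inner_add_right, inner_smul_right]; nlinarith [hbound w hwn])
    (by rw [inner_add_right, hy _ hjK, inner_smul_right, hjw]; simp)
  have h1 : ⟪u, y⟫ + ⟪w, y⟫ = 0 := by rw [← inner_add_left]; exact hy _ hsK
  have h2 : y + ε • u - (y + ε • w) = ε • (u - w) := by module
  rw [h2, norm_smul, Real.norm_of_nonneg hpos.le, inner_add_right, inner_add_right,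
    inner_smul_right, inner_smul_right, real_inner_self_eq_norm_sq, real_inner_self_eq_norm_sq,
    hun, hwn] at this
  have h3 : 2 ≤ ‖u - w‖ := by
    by_contra hcon
    push Not at hcon
    nlinarith
  have h4 := parallelogram_law_with_norm ℝ u w
  rw [hun, hwn] at h4
  have h5 : 0 < ‖u + w‖ := norm_pos_iff.2 hs0
  nlinarith

/-- The facets met by shortest paths from `x` to the source, other than in `x`. -/
def visible (D : SourcedSystem E ι) (x : E) : Set ι :=
  {k | ∃ p ∈ D.F k, p ≠ x ∧ intrinsicDist D.S x p + intrinsicDist D.S p D.v ≤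
    intrinsicDist D.S x D.v}

theorem rho_eq_iff {i : ι} {x p : E} (hx : x ∈ D.F i) (hp : p ∈ D.F i) :
    D.rho x = ‖p - x‖ + D.rho p ↔
      intrinsicDist D.S x p + intrinsicDist D.S p D.v ≤ intrinsicDist D.S x D.v := by
  have h1 := D.hfin x (F_subset_S i hx)
  have h2 := D.hfin p (F_subset_S i hp)
  rw [intrinsicDist_facet hx hp, ← ENNReal.toReal_le_toReal (by simp [h2, edist_ne_top]) h1,
    ENNReal.toReal_add (edist_ne_top _ _) h2, ← dist_edist, dist_comm, dist_eq_norm]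
  exact ⟨fun h => h.ge, fun h => le_antisymm (rho_le_of_facet hx hp) h⟩

/-- The last point in which a shortest path leaves a facet. -/
theorem exists_last {x m : E} {i : ι} (hd : D.Desc x i m) :
    ∃ p, D.Desc x i p ∧ udir x p = udir x m ∧ D.visible p ⊂ D.visible x ∧
      ∀ p' ∈ D.F i, p' ≠ p → D.rho p ≠ ‖p' - p‖ + D.rho p' := by
  obtain ⟨hx, hm, hmx, hmr⟩ := hd
  set e := udir x m with he
  have hen : ‖e‖ = 1 := norm_udir hmx
  set A := {p ∈ D.F i | D.rho x = ‖p - x‖ + D.rho p ∧ p - x = ‖p - x‖ • e} with hA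
  have hAne : A.Nonempty := ⟨m, hm, hmr, (norm_smul_udir x m).symm⟩
  have hAcl : IsClosed A := by
    have hc : ContinuousOn (fun p => D.rho x - (‖p - x‖ + D.rho p)) (D.F i) :=
      continuousOn_const.sub ((by fun_prop : Continuous fun p : E => ‖p - x‖).continuousOn.add
        (continuousOn_rho.mono (F_subset_S i)))
    have h1 := hc.preimage_isClosed_of_isClosed (isClosed_F i) (isClosed_singleton (x := (0 : ℝ)))
    have h2 : IsClosed {p : E | p - x = ‖p - x‖ • e} :=
      isClosed_eq (by fun_prop) (by fun_prop)
    convert h1.inter h2 using 1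
    ext p
    simp only [hA, mem_inter_iff, mem_preimage, mem_singleton_iff, sub_eq_zero]
    constructor
    · rintro ⟨h1, h2, h3⟩; exact ⟨⟨h1, h2⟩, h3⟩
    · rintro ⟨⟨h1, h2⟩, h3⟩; exact ⟨h1, h2, h3⟩
  have hAc : IsCompact A := by
    refine (isCompact_closedBall x (D.rho x)).of_isClosed_subset hAcl fun p hp => ?_
    rw [Metric.mem_closedBall, dist_eq_norm]
    have := rho_nonneg (D := D) p
    linarith [hp.2.1]
  obtain ⟨p, hp, hmax⟩ := hAc.exists_isMaxOn hAne
    (by fun_prop : Continuous fun p : E => ‖p - x‖).continuousOn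
  have hpm : ‖m - x‖ ≤ ‖p - x‖ := hmax ⟨hm, hmr, (norm_smul_udir x m).symm⟩
  have hppos : 0 < ‖p - x‖ := (norm_pos_iff.2 (sub_ne_zero.2 hmx)).trans_le hpm
  have hpx : p ≠ x := by
    rintro rfl
    simp at hppos
  have hpe : udir x p = e := by
    have : p = x + ‖p - x‖ • e := by rw [← hp.2.2]; abel
    conv_lhs => rw [this]
    exact udir_add_smul hen hppos
  -- A further point of descent gives equality in the triangle inequality, so it lies on the same
  -- ray from x and contradicts the maximality of p.
  have hlast : ∀ p' ∈ D.F i, p' ≠ p → D.rho p ≠ ‖p' - p‖ + D.rho p' := by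
    intro p' hp' hne heq
    have h1 := rho_le_of_facet hx hp'
    have h2 : ‖p' - x‖ = ‖p - x‖ + ‖p' - p‖ := by
      refine le_antisymm ?_ (by linarith [hp.2.1])
      rw [show p' - x = (p - x) + (p' - p) by abel]
      exact norm_add_le _ _
    have hray : SameRay ℝ (p - x) (p' - p) := by
      rw [sameRay_iff_norm_add, ← h2]
      congr 1
      abel
    have h3 : p' - p = ‖p' - p‖ • e := by
      have := sameRay_iff_norm_smul_eq.1 hray
      rw [hp.2.2, norm_smul, hen, norm_norm, mul_one, smul_comm] at this
      exact smul_right_injective E hppos.ne' this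
    have hp'A : p' ∈ A := by
      refine ⟨hp', by linarith [hp.2.1], ?_⟩
      rw [h2, add_smul, ← h3, ← hp.2.2]
      abel
    have h4 : ‖p' - x‖ ≤ ‖p - x‖ := hmax hp'A
    have h5 : 0 < ‖p' - p‖ := norm_pos_iff.2 (sub_ne_zero.2 hne)
    linarith
  have hENN := (rho_eq_iff hx hp.1).1 hp.2.1
  refine ⟨p, ⟨hx, hp.1, hpx, hp.2.1⟩, hpe, ?_, hlast⟩
  -- A facet visible from p is visible from x, and i is lost at p. The number of visible facets is
  -- the induction measure along shortest paths.
  refine ssubset_of_subset_not_subset ?_ fun hsub => ?_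
  · rintro k ⟨p', hp', hne, hle⟩
    refine ⟨p', hp', ?_, ?_⟩
    · rintro rfl
      have h1 : intrinsicDist D.S p' D.v ≤ intrinsicDist D.S p D.v := le_add_self.trans hle
      have h2 := ENNReal.toReal_mono (D.hfin p (F_subset_S i hp.1)) h1
      have h3 : D.rho p' ≤ D.rho p := h2
      linarith [hp.2.1]
    · calc intrinsicDist D.S x p' + intrinsicDist D.S p' D.v
          ≤ intrinsicDist D.S x p + intrinsicDist D.S p p' + intrinsicDist D.S p' D.v := by
            gcongr; exact intrinsicDist_triangle ..
        _ = intrinsicDist D.S x p + (intrinsicDist D.S p p' + intrinsicDist D.S p' D.v) :=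
            add_assoc ..
        _ ≤ intrinsicDist D.S x p + intrinsicDist D.S p D.v := by gcongr
        _ ≤ _ := hENN
  · obtain ⟨p', hp', hne, hle⟩ := hsub (show i ∈ D.visible x from ⟨p, hp.1, hpx, hENN⟩)
    exact hlast p' hp' hne ((rho_eq_iff hp.1 hp').2 hle)

theorem Desc.inner_udir {x m : E} {i : ι} (hd : D.Desc x i m) : ⟪D.n i, udir x m⟫ = 0 := by
  rw [udir, inner_smul_right, ← g_sub, hd.1.2, hd.2.1.2]; simp

theorem Desc.inner_udir_nonpos {x m : E} {i k : ι} (hd : D.Desc x i m) (hk : D.g k x = 0) :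
    ⟪D.n k, udir x m⟫ ≤ 0 := by
  rw [udir, inner_smul_right, ← g_sub, hk, sub_zero]
  exact mul_nonpos_of_nonneg_of_nonpos (by positivity) (hd.2.1.1 k)

theorem Desc.eq_add {x m : E} {i : ι} (_ : D.Desc x i m) : m = x + ‖m - x‖ • udir x m := by
  rw [norm_smul_udir]; abel

theorem Desc.rho_pos {x m : E} {i : ι} (hd : D.Desc x i m) : 0 < D.rho x := by
  have h1 := hd.2.2.2
  have h2 := rho_nonneg (D := D) m
  have h3 : 0 < ‖m - x‖ := norm_pos_iff.2 (sub_ne_zero.2 hd.2.2.1)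
  linarith

theorem Desc.ne_v {x m : E} {i : ι} (hd : D.Desc x i m) : x ≠ D.v := by
  rintro rfl
  have := hd.rho_pos
  rw [rho_v] at this
  exact lt_irrefl _ this

/-- At the last point in a facet, a shortest path crosses an edge transversally. -/
theorem last_corner {x p m' : E} {i j : ι} (hd : D.Desc x i p)
    (hlast : ∀ p' ∈ D.F i, p' ≠ p → D.rho p ≠ ‖p' - p‖ + D.rho p') (hd' : D.Desc p j m') :
    i ≠ j ∧ (∃ α < (0 : ℝ), udir p x + udir p m' = α • (D.n i + D.n j)) ∧
      ∀ k, D.g k p = 0 → D.n k ∈ Submodule.span ℝ {D.n i, D.n j} := by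
  have hr : D.rho x = ‖x - p‖ + D.rho p := by rw [hd.2.2.2, norm_sub_rev]
  rcases corner hd.1 hd.2.2.1.symm hd.2.1 hr hd' with h | h
  · exfalso
    refine hlast m' ⟨hd'.2.1.1, ?_⟩ hd'.2.2.1 hd'.2.2.2
    rw [hd'.eq_add, h, smul_neg, ← neg_smul, g_add_smul, hd.2.1.2, udir, inner_smul_right, ← g_sub,
      hd.1.2, hd.2.1.2]
    simp
  · exact h

theorem inner_neg_of_sum {x q w : E} {i j : ι} (hij : i ≠ j) (hi : D.g i x = 0)
    (hj : D.g j x = 0) (hw : ⟪D.n j, w⟫ = 0) {α : ℝ} (hα : α < 0)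
    (hs : udir x q + w = α • (D.n i + D.n j)) : ⟪D.n j, udir x q⟫ < 0 := by
  have h1 : ⟪D.n j, udir x q + w⟫ = α * (1 + ⟪D.n i, D.n j⟫) := by
    rw [hs, inner_smul_right, inner_add_right, real_inner_self_eq_norm_sq, D.norm_n,
      real_inner_comm]
    ring
  rw [inner_add_right, hw, add_zero] at h1
  rw [h1]
  exact mul_neg_of_neg_of_pos hα (by linarith [(inner_n_lt hij hi hj).1])

theorem udir_swap (x p : E) : udir p x = -udir x p := by
  rw [udir, udir, norm_sub_rev, ← smul_neg, neg_sub]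

/-- Shortest paths to the source run in the relative interiors of facets. -/
theorem Desc.inner_neg {x m : E} {i k : ι} (hd : D.Desc x i m) (hk : D.g k x = 0) (hki : k ≠ i) :
    ⟪D.n k, udir x m⟫ < 0 := by
  refine lt_of_le_of_ne (hd.inner_udir_nonpos hk) fun h0 => hki ?_
  obtain ⟨p, hp, hpe, -, hlast⟩ := exists_last hd
  have hkp : D.g k p = 0 := by
    rw [hp.eq_add, g_add_smul, hk, hpe, h0]; simp
  by_cases hpv : p = D.v
  · have h1 := (D.hact k).1 (hpv ▸ hkp)
    have h2 := (D.hact i).1 (hpv ▸ hp.2.1.2)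
    rw [h1, h2]
  · obtain ⟨r, hr, hex⟩ := exists_desc (F_subset_S i hp.2.1) hpv
    obtain ⟨j, m', hd', -⟩ := hex (r / 2) (by linarith) (by linarith)
    obtain ⟨hij, ⟨α, hα, hs⟩, hspan⟩ := last_corner hp hlast hd'
    have hju := inner_neg_of_sum hij hp.2.1.2 hd'.1.2 hd'.inner_udir hα hs
    -- Pairing n k = a n i + b n j with the incoming direction, which is orthogonal to n k and n i
    -- but not to n j, gives b = 0; then the two constraints coincide.
    obtain ⟨a, b, hab⟩ := Submodule.mem_span_pair.1 (hspan k hkp)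
    have h1 : ⟪D.n k, udir p x⟫ = 0 := by
      rw [udir_swap, hpe, inner_neg_right, h0, neg_zero]
    have h2 : ⟪D.n i, udir p x⟫ = 0 := by
      rw [udir_swap, inner_neg_right, hp.inner_udir, neg_zero]
    rw [← hab, inner_add_left, real_inner_smul_left, real_inner_smul_left, h2, mul_zero,
      zero_add] at h1
    have hb : b = 0 := by
      rcases mul_eq_zero.1 h1 with h | h
      · exact h
      · exact absurd h hju.ne
    rw [hb, zero_smul, add_zero] at hab
    exact eq_of_mem_span_singleton hp.2.1.2 hkp hab.symm

end SourcedSystem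

/-! ### Upper supports on a segment, and relative interiors of facets. -/

/-- A function on the unit interval that has affine upper supports at all interior points stays
below an affine function that supports it at the left end. -/
theorem le_of_local_support {f : ℝ → ℝ} {b : ℝ} (hf : ContinuousOn f (Icc 0 1))
    (h0 : ∀ᶠ t in 𝓝[>] 0, f t ≤ f 0 + b * t)
    (hloc : ∀ t ∈ Ioo (0 : ℝ) 1, ∃ c, ∀ᶠ s in 𝓝 t, f s ≤ f t + c * (s - t)) :
    f 1 ≤ f 0 + b := by
  by_contra hlt
  push Not at hlt
  set e := f 1 - f 0 - b with he
  have hepos : 0 < e := by linarith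
  -- Subtracting the chord makes h vanish at both ends, while h is negative just right of 0, so its
  -- minimum is interior.
  set h : ℝ → ℝ := fun t => f t - f 0 - (b + e) * t with hh
  have hc : ContinuousOn h (Icc 0 1) := by
    refine (hf.sub continuousOn_const).sub ?_
    exact (by fun_prop : Continuous fun t : ℝ => (b + e) * t).continuousOn
  have hh0 : h 0 = 0 := by simp [hh]
  have hh1 : h 1 = 0 := by simp only [hh, he]; ring
  obtain ⟨t₀, ht₀, hmin⟩ := isCompact_Icc.exists_isMinOn (nonempty_Icc.2 zero_le_one) hc
  have hneg : h t₀ < 0 := by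
    have h1 : ∀ᶠ t : ℝ in 𝓝[>] 0, t < 1 :=
      (eventually_lt_nhds one_pos).filter_mono nhdsWithin_le_nhds
    obtain ⟨t, ⟨ht, ht1⟩, htpos⟩ := ((h0.and h1).and self_mem_nhdsWithin).exists
    have htp : (0 : ℝ) < t := htpos
    have h2 : h t₀ ≤ h t := hmin ⟨htp.le, ht1.le⟩
    have h3 : h t ≤ -(e * t) := by simp only [hh]; linarith
    have : 0 < e * t := by positivity
    linarith
  set Z := {t ∈ Icc (0 : ℝ) 1 | h t = h t₀} with hZ
  have hZc : IsCompact Z := by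
    refine isCompact_Icc.of_isClosed_subset ?_ (fun t ht => ht.1)
    exact hc.preimage_isClosed_of_isClosed isClosed_Icc (isClosed_singleton (x := h t₀))
  -- At the leftmost minimizer the affine upper support has nonnegative slope because of the points
  -- to the right, so points slightly to the left are minimizers too, a contradiction.
  obtain ⟨s₀, hs₀, hleast⟩ := hZc.exists_isLeast ⟨t₀, ht₀, rfl⟩
  have hs0 : s₀ ≠ 0 := by
    rintro rfl
    rw [← hs₀.2, hh0] at hneg
    exact lt_irrefl _ hneg
  have hs1 : s₀ ≠ 1 := by
    rintro rfl
    rw [← hs₀.2, hh1] at hneg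
    exact lt_irrefl _ hneg
  have hmem : s₀ ∈ Ioo (0 : ℝ) 1 :=
    ⟨lt_of_le_of_ne hs₀.1.1 (Ne.symm hs0), lt_of_le_of_ne hs₀.1.2 hs1⟩
  obtain ⟨c, hc'⟩ := hloc s₀ hmem
  obtain ⟨δ, hδ, hball⟩ := Metric.eventually_nhds_iff.1 (hc'.and (Ioo_mem_nhds hmem.1 hmem.2))
  have hl := @hball (s₀ - δ / 2) (by
    rw [Real.dist_eq, sub_sub_cancel_left, abs_neg, abs_of_pos (by linarith)]; linarith)
  have hr := @hball (s₀ + δ / 2) (by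
    rw [Real.dist_eq, add_sub_cancel_left, abs_of_pos (by linarith)]; linarith)
  have hml : h t₀ ≤ h (s₀ - δ / 2) := hmin (Ioo_subset_Icc_self hl.2)
  have hmr : h t₀ ≤ h (s₀ + δ / 2) := hmin (Ioo_subset_Icc_self hr.2)
  have hle : ∀ s, f s ≤ f s₀ + c * (s - s₀) → h s ≤ h t₀ + (c - (b + e)) * (s - s₀) := by
    intro s hs
    rw [← hs₀.2]
    simp only [hh]
    linarith
  have hl' := hle _ hl.1
  have hr' := hle _ hr.1
  have hcz : 0 ≤ c - (b + e) := by
    by_contra hcon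
    push Not at hcon
    nlinarith
  have : h (s₀ - δ / 2) = h t₀ := le_antisymm (by nlinarith) hml
  have := hleast ⟨Ioo_subset_Icc_self hl.2, this⟩
  linarith

namespace HalfspaceSystem

variable {E : Type*} [NormedAddCommGroup E] [InnerProductSpace ℝ E] [FiniteDimensional ℝ E]
variable {ι : Type*} [Finite ι] (D : HalfspaceSystem E ι)

/-- The relative interior of the `i`-th facet. -/
def Fo (i : ι) : Set E := {x | D.g i x = 0 ∧ ∀ k, k ≠ i → D.g k x < 0}

variable {D}

theorem Fo_subset_F (i : ι) : D.Fo i ⊆ D.F i := by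
  refine fun x hx => ⟨fun k => ?_, hx.1⟩
  by_cases hk : k = i
  · rw [hk, hx.1]
  · exact (hx.2 k hk).le

theorem eq_of_mem_Fo {i k : ι} {x : E} (hx : x ∈ D.Fo i) (hk : D.g k x = 0) : k = i := by
  by_contra h
  exact (hx.2 k h).ne hk

theorem F_combo_mem_Fo {i : ι} {x c : E} (hx : x ∈ D.F i) (hc : c ∈ D.Fo i) {t : ℝ} (h0 : 0 < t)
    (h1 : t ≤ 1) : x + t • (c - x) ∈ D.Fo i := by
  refine ⟨(F_combo hx (Fo_subset_F i hc) h0.le h1).2, fun k hk => ?_⟩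
  rw [g_combo]
  have h2 : (1 - t) * D.g k x ≤ 0 := mul_nonpos_of_nonneg_of_nonpos (by linarith) (hx.1 k)
  have h3 : t * D.g k c < 0 := mul_neg_of_pos_of_neg h0 (hc.2 k hk)
  linarith

/-- Near a point p whose active normals lie in span {n i, n j}, this puts all solutions of the two
equations g i = g j = 0 into P: the other active constraints hold with equality, the inactive ones
persist. -/
theorem g_eq_zero_of_mem_span {i j k : ι} {p z : E}
    (hk : D.n k ∈ Submodule.span ℝ {D.n i, D.n j}) (hkp : D.g k p = 0) (hip : D.g i p = 0)
    (hjp : D.g j p = 0) (hiz : D.g i z = 0) (hjz : D.g j z = 0) : D.g k z = 0 := by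
  obtain ⟨a, b, hab⟩ := Submodule.mem_span_pair.1 hk
  have h := g_sub (D := D) k z p
  rw [← hab, inner_add_left, real_inner_smul_left, real_inner_smul_left, ← g_sub, ← g_sub, hip, hjp,
    hiz, hjz, hkp] at h
  linarith

/-- There are at most two facets at a point of an edge. -/
theorem three_facets {i j k : ι} (hk : D.n k ∈ Submodule.span ℝ {D.n i, D.n j}) {u w z : E}
    (h1 : ⟪D.n i, u⟫ = 0) (h2 : ⟪D.n j, u⟫ < 0) (h3 : ⟪D.n k, u⟫ < 0) (h4 : ⟪D.n j, w⟫ = 0)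
    (h5 : ⟪D.n i, w⟫ < 0) (h6 : ⟪D.n k, w⟫ < 0) (h7 : ⟪D.n k, z⟫ = 0) (h8 : ⟪D.n i, z⟫ < 0)
    (h9 : ⟪D.n j, z⟫ < 0) : False := by
  obtain ⟨a, b, hab⟩ := Submodule.mem_span_pair.1 hk
  have e : ∀ y : E, ⟪D.n k, y⟫ = a * ⟪D.n i, y⟫ + b * ⟪D.n j, y⟫ := fun y => by
    rw [← hab, inner_add_left, real_inner_smul_left, real_inner_smul_left]
  rw [e, h1, mul_zero, zero_add] at h3
  rw [e, h4, mul_zero, add_zero] at h6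
  rw [e] at h7
  have hb : 0 < b := by
    by_contra hcon
    push Not at hcon
    nlinarith
  have ha : 0 < a := by
    by_contra hcon
    push Not at hcon
    nlinarith
  nlinarith

end HalfspaceSystem

/-! ### Source images and the distances to them. -/

namespace SourcedSystem

open HalfspaceSystem

variable {E : Type*} [NormedAddCommGroup E] [InnerProductSpace ℝ E] [FiniteDimensional ℝ E]
variable {ι : Type*} [Finite ι] {D : SourcedSystem E ι}

/-- The path is assembled from last segments in facets; it ends because the set of visible facets
shrinks, so no compactness of path spaces is involved. -/
theorem exists_isShortestPath {x : E} (hx : x ∈ D.S) :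
    ∃ γ : Path x D.v, IsShortestPath D.S γ := by
  induction hn : (D.visible x).ncard using Nat.strong_induction_on generalizing x with
  | _ n ih =>
    by_cases hxv : x = D.v
    · subst hxv
      obtain ⟨γ, -, hγ⟩ := isShortestPath_segment (S := D.S) (a := D.v) (b := D.v)
        (by rw [segment_same]; exact singleton_subset_iff.2 v_mem_S)
      exact ⟨γ, hγ⟩
    · obtain ⟨r, hr, hex⟩ := exists_desc hx hxv
      obtain ⟨i, m, hd, -⟩ := hex (r / 2) (by linarith) (by linarith)
      obtain ⟨p, hp, -, hvis, -⟩ := exists_last hd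
      have hlt : (D.visible p).ncard < n := hn ▸ ncard_lt_ncard hvis (toFinite _)
      obtain ⟨γ, hγ⟩ := ih _ hlt (F_subset_S i hp.2.1) rfl
      obtain ⟨σ, -, hσ⟩ := isShortestPath_segment (S := D.S) (a := x) (b := p)
        (((convex_F i).segment_subset hp.1 hp.2.1).trans (F_subset_S i))
      exact ⟨σ.trans γ, hσ.trans hγ ((rho_eq_iff hp.1 hp.2.1).1 hp.2.2.2)⟩

theorem Desc.exists_shortestPath {x m : E} {i : ι} (hd : D.Desc x i m) :
    ∃ γ : Path x D.v, IsShortestPath D.S γ ∧ m ∈ range γ := by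
  obtain ⟨γ, hγ⟩ := exists_isShortestPath (F_subset_S i hd.2.1)
  obtain ⟨σ, -, hσ⟩ := isShortestPath_segment (S := D.S) (a := x) (b := m)
    (((convex_F i).segment_subset hd.1 hd.2.1).trans (F_subset_S i))
  refine ⟨σ.trans γ, hσ.trans hγ ((rho_eq_iff hd.1 hd.2.1).1 hd.2.2.2), ?_⟩
  rw [Path.trans_range]
  exact Or.inr ⟨0, γ.source⟩

/-- The source image seen from `x` in the direction of `m`. -/
noncomputable def im (D : SourcedSystem E ι) (x m : E) : E := x + D.rho x • udir x m

/-- The candidates for source images: images of the source under at most `n` reflections. -/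
def cand (D : SourcedSystem E ι) : ℕ → Set E
  | 0 => {D.v}
  | n + 1 => cand D n ∪ ⋃ i, ⋃ j, D.refl i j '' cand D n

theorem finite_cand (n : ℕ) : (D.cand n).Finite := by
  induction n with
  | zero => exact finite_singleton _
  | succ n ih => exact ih.union (finite_iUnion fun i => finite_iUnion fun j => ih.image _)

theorem v_mem_cand (n : ℕ) : D.v ∈ D.cand n := by
  induction n with
  | zero => rfl
  | succ n ih => exact Or.inl ih

theorem norm_sub_im {x m : E} (hm : m ≠ x) : ‖x - D.im x m‖ = D.rho x := by
  rw [im, sub_add_cancel_left, norm_neg, norm_smul, norm_udir hm, mul_one,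
    Real.norm_of_nonneg (rho_nonneg x)]

theorem Desc.g_im {x m : E} {i : ι} (hd : D.Desc x i m) : D.g i (D.im x m) = 0 := by
  rw [im, g_add_smul, hd.1.2, hd.inner_udir]; simp

/-- The source image as seen from the far end of the first segment of a shortest path. -/
theorem Desc.im_eq {x p : E} {i : ι} (hd : D.Desc x i p) : D.im x p = p - D.rho p • udir p x := by
  rw [udir_swap, smul_neg, sub_neg_eq_add, im, hd.2.2.2, add_smul, norm_smul_udir]
  abel

theorem norm_crossing {z ω : E} {τ : ℝ} (h0 : 0 ≤ τ) (h1 : τ ≤ 1) :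
    ‖z + τ • (ω - z) - z‖ + ‖z + τ • (ω - z) - ω‖ = ‖z - ω‖ := by
  have e1 : z + τ • (ω - z) - z = τ • (ω - z) := by module
  have e2 : z + τ • (ω - z) - ω = (1 - τ) • (z - ω) := by module
  rw [e1, e2, norm_smul, norm_smul, Real.norm_of_nonneg h0, Real.norm_of_nonneg (by linarith),
    norm_sub_rev ω z]
  ring

/-- Source images are candidates, and the distance to a source image is a local upper bound of the
distance to the source. -/
theorem im_mem_cand_and_local (n : ℕ) : ∀ (x m : E) (i : ι), (D.visible x).ncard ≤ n →
    D.Desc x i m → D.im x m ∈ D.cand n ∧ ∀ᶠ z in 𝓝 x, z ∈ D.F i → D.rho z ≤ ‖z - D.im x m‖ := by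
  induction n with
  | zero =>
    intro x m i hn hd
    obtain ⟨p, -, -, hvis, -⟩ := exists_last hd
    have := ncard_lt_ncard hvis (toFinite _)
    omega
  | succ n ih =>
    intro x m i hn hd
    obtain ⟨p, hp, hpe, hvis, hlast⟩ := exists_last hd
    have him : D.im x m = D.im x p := by rw [im, im, hpe]
    rw [him]
    by_cases hpv : p = D.v
    · subst hpv
      have : D.im x D.v = D.v := by rw [hp.im_eq, rho_v, zero_smul, sub_zero]
      rw [this]
      refine ⟨v_mem_cand _, Eventually.of_forall fun z hz => ?_⟩
      have := rho_le_of_facet hz hp.2.1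
      rwa [rho_v, add_zero, norm_sub_rev] at this
    obtain ⟨r, hr, hex⟩ := exists_desc (F_subset_S i hp.2.1) hpv
    obtain ⟨j, m', hd', -⟩ := hex (r / 2) (by linarith) (by linarith)
    obtain ⟨hij, ⟨α, hα, hs⟩, hspan⟩ := last_corner hp hlast hd'
    have hip := hp.2.1.2
    have hjp := hd'.1.2
    have hju := inner_neg_of_sum hij hip hjp hd'.inner_udir hα hs
    have hcn := (inner_n_lt hij hip hjp).1
    have hiu : ⟪D.n i, udir p x⟫ = 0 := by
      rw [udir_swap, inner_neg_right, hp.inner_udir, neg_zero]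
    have hlt := ncard_lt_ncard hvis (toFinite _)
    obtain ⟨hc, hloc⟩ := ih p m' j (by omega) hd'
    have hrefl : D.refl i j (D.im p m') = D.im x p := by
      rw [hp.im_eq, im]
      exact refl_ray hcn hip hjp hiu hd'.inner_udir hs _
    refine ⟨Or.inr (mem_iUnion₂.2 ⟨i, j, _, hc, hrefl⟩), ?_⟩
    set ω := D.im x p with hω
    have hiω : D.g i ω = 0 := hp.g_im
    have hjω : 0 < D.g j ω := by
      rw [hω, hp.im_eq, sub_eq_add_neg, ← neg_smul, g_add_smul, hjp, zero_add]
      exact mul_pos_of_neg_of_neg (neg_neg_of_pos hd'.rho_pos) hju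
    -- The point where the segment from z to ω crosses the j-th hyperplane. At z = x it is p, and
    -- for nearby z it still lies on the ridge, where the bound from the other facet applies.
    set c : E → E := fun z => z + (D.g j z / (D.g j z - D.g j ω)) • (ω - z) with hcdef
    have hden : D.g j x - D.g j ω ≠ 0 := by
      have := hp.1.1 j
      linarith
    have hcc : ContinuousAt c x := by
      have h1 : ContinuousAt (D.g j) x := (continuous_g j).continuousAt
      exact continuousAt_id.add ((h1.div (h1.sub continuousAt_const) hden).smul
        (continuousAt_const.sub continuousAt_id))
    have hcx : c x = p := by
      have hκ : D.g j x = -(‖p - x‖ * ⟪D.n j, udir x p⟫) := by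
        have : D.g j p = D.g j x + ‖p - x‖ * ⟪D.n j, udir x p⟫ := by
          rw [← g_add_smul, ← hp.eq_add]
        linarith
      have hκ2 : D.g j x - D.g j ω = -(D.rho x * ⟪D.n j, udir x p⟫) := by
        rw [hω, im, g_add_smul]; ring
      have hκ0 : ⟪D.n j, udir x p⟫ ≠ 0 := by
        rw [udir_swap, inner_neg_right] at hju
        linarith
      have hr0 := hd.rho_pos.ne'
      have : D.g j x / (D.g j x - D.g j ω) * D.rho x = ‖p - x‖ := by
        rw [hκ2, hκ]
        field_simp
      simp only [hcdef]
      rw [show ω - x = D.rho x • udir x p by rw [hω, im]; abel, smul_smul, this, ← hp.eq_add]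
    have hev := (hloc.and (eventually_lt p hp.2.1.1))
    rw [← hcx] at hev
    filter_upwards [hcc.eventually hev] with z hz hzF
    obtain ⟨hz1, hz2⟩ := hz
    rw [hcx] at hz1 hz2
    have hzj := hzF.1 j
    have hden' : D.g j z - D.g j ω < 0 := by linarith
    set τ := D.g j z / (D.g j z - D.g j ω) with hτ
    have hτ0 : 0 ≤ τ := div_nonneg_of_nonpos hzj hden'.le
    have hτ1 : τ ≤ 1 := by
      rw [hτ, div_le_one_of_neg hden']
      linarith
    have hic : D.g i (c z) = 0 := by
      simp only [hcdef]
      rw [g_combo, hzF.2, hiω]; ring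
    have hjc : D.g j (c z) = 0 := by
      simp only [hcdef]
      rw [g_combo]
      field_simp [hden'.ne]
      ring
    have hcP : c z ∈ D.P := by
      intro k
      by_cases hk : D.g k p = 0
      · exact (g_eq_zero_of_mem_span (hspan k hk) hk hip hjp hic hjc).le
      · exact (hz2 k hk).le
    have h1 := rho_le_of_facet hzF (show c z ∈ D.F i from ⟨hcP, hic⟩)
    have h2 := hz1 ⟨hcP, hjc⟩
    rw [← norm_refl_sub_of_mem hcn hic hjc, hrefl] at h2
    have h3 := norm_crossing (z := z) (ω := ω) hτ0 hτ1
    linarith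

theorem Desc.mem_Fo {x m : E} {i : ι} (hd : D.Desc x i m) {t : ℝ} (h0 : 0 < t) (h1 : t < 1) :
    x + t • (m - x) ∈ D.Fo i := by
  refine ⟨(F_combo hd.1 hd.2.1 h0.le h1.le).2, fun k hk => ?_⟩
  by_cases hkx : D.g k x = 0
  · have h2 := hd.inner_neg hkx hk
    have h3 : 0 < ‖m - x‖ := norm_pos_iff.2 (sub_ne_zero.2 hd.2.2.1)
    rw [g_add_smul, hkx, ← norm_smul_udir, inner_smul_right, zero_add]
    exact mul_neg_of_pos_of_neg h0 (mul_neg_of_pos_of_neg h3 h2)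
  · rw [g_combo]
    have h2 : (1 - t) * D.g k x < 0 :=
      mul_neg_of_pos_of_neg (by linarith) (lt_of_le_of_ne (hd.1.1 k) hkx)
    have h3 : t * D.g k m ≤ 0 := mul_nonpos_of_nonneg_of_nonpos h0.le (hd.2.1.1 k)
    linarith

/-- From a relative interior point of a facet every shortest path starts in that facet, so its image
supports `rho` there from above. -/
theorem exists_support_of_mem_Fo {i : ι} {y : E} (hy : y ∈ D.Fo i) :
    ∃ ω, ‖y - ω‖ = D.rho y ∧ ∀ᶠ z in 𝓝 y, z ∈ D.F i → D.rho z ≤ ‖z - ω‖ := by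
  have hyF := Fo_subset_F i hy
  by_cases hyv : y = D.v
  · subst hyv
    refine ⟨D.v, by simp, Eventually.of_forall fun z hz => ?_⟩
    have := rho_le_of_facet hz hyF
    rwa [rho_v, add_zero, norm_sub_rev] at this
  · obtain ⟨r, hr, hex⟩ := exists_desc (F_subset_S i hyF) hyv
    obtain ⟨j, m, hd, -⟩ := hex (r / 2) (by linarith) (by linarith)
    obtain rfl := eq_of_mem_Fo hy hd.1.2
    exact ⟨D.im y m, norm_sub_im hd.2.2.1, (im_mem_cand_and_local _ y m j le_rfl hd).2⟩

/-- After subtracting t²‖z - x‖², the squared distance to any fixed point is affine in t. -/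
theorem sq_norm_line (x z ω : E) (t : ℝ) : ‖x + t • (z - x) - ω‖ ^ 2 =
    ‖x - ω‖ ^ 2 + 2 * t * ⟪x - ω, z - x⟫ + t ^ 2 * ‖z - x‖ ^ 2 := by
  rw [show x + t • (z - x) - ω = (x - ω) + t • (z - x) by abel, norm_add_sq_real, inner_smul_right,
    norm_smul, mul_pow, Real.norm_eq_abs, sq_abs]
  ring

/-- The distance to a source image is an upper bound of the distance to the source on the whole
facet. -/
theorem Desc.rho_le {x m : E} {i : ι} (hd : D.Desc x i m) {z : E} (hz : z ∈ D.F i) :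
    D.rho z ≤ ‖z - D.im x m‖ := by
  set ω := D.im x m with hω
  have hFo : ∀ z ∈ D.Fo i, D.rho z ≤ ‖z - ω‖ := by
    intro z hz
    have hzF := Fo_subset_F i hz
    -- With this correction, an upper bound of `rho` by the distance to an image is an affine upper
    -- support of f.
    set f : ℝ → ℝ := fun t => D.rho (x + t • (z - x)) ^ 2 - t ^ 2 * ‖z - x‖ ^ 2 with hf
    have hline : Continuous fun t : ℝ => x + t • (z - x) := by fun_prop
    have hmem : ∀ t ∈ Icc (0 : ℝ) 1, x + t • (z - x) ∈ D.F i := fun t ht =>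
      F_combo hd.1 hzF ht.1 ht.2
    have hcont : ContinuousOn f (Icc 0 1) := by
      refine ContinuousOn.sub (ContinuousOn.pow ?_ 2) (by fun_prop)
      exact continuousOn_rho.comp hline.continuousOn fun t ht => F_subset_S i (hmem t ht)
    have hf0 : f 0 = ‖x - ω‖ ^ 2 := by
      simp only [hf]
      rw [norm_sub_im hd.2.2.1]
      simp
    have key := le_of_local_support (f := f) (b := 2 * ⟪x - ω, z - x⟫) hcont ?_ ?_
    · rw [hf0] at key
      simp only [hf, one_smul, add_sub_cancel] at key
      have h1 := sq_norm_line x z ω 1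
      rw [one_smul, add_sub_cancel] at h1
      exact le_of_sq_le_sq (by linarith) (norm_nonneg _)
    · have hloc := (im_mem_cand_and_local _ x m i le_rfl hd).2
      have h0 := hline.tendsto 0
      rw [zero_smul, add_zero] at h0
      have h1 : ∀ᶠ t : ℝ in 𝓝[>] 0, t < 1 :=
        (eventually_lt_nhds one_pos).filter_mono nhdsWithin_le_nhds
      filter_upwards [(h0.eventually hloc).filter_mono nhdsWithin_le_nhds, h1,
        self_mem_nhdsWithin] with t ht ht1 ht0
      have h2 := ht (hmem t ⟨le_of_lt ht0, ht1.le⟩)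
      have h3 := pow_le_pow_left₀ (rho_nonneg _) h2 2
      rw [sq_norm_line] at h3
      rw [hf0]
      simp only [hf]
      linarith
    · intro t ht
      have hyFo := F_combo_mem_Fo hd.1 hz ht.1 ht.2.le
      obtain ⟨ω', hω', hloc⟩ := exists_support_of_mem_Fo hyFo
      refine ⟨2 * ⟪x - ω', z - x⟫, ?_⟩
      filter_upwards [hline.continuousAt.eventually hloc, Ioo_mem_nhds ht.1 ht.2] with s hs hs01
      have h2 := hs (hmem s (Ioo_subset_Icc_self hs01))
      have h3 := pow_le_pow_left₀ (rho_nonneg _) h2 2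
      have h4 := congrArg (fun r : ℝ => r ^ 2) hω'
      rw [sq_norm_line] at h3 h4
      simp only [hf]
      linarith
  -- The bound passes from the relative interior to the whole facet by moving z slightly towards the
  -- interior point c.
  have hc : x + (1 / 2 : ℝ) • (m - x) ∈ D.Fo i := hd.mem_Fo (by norm_num) (by norm_num)
  set c := x + (1 / 2 : ℝ) • (m - x)
  have hlim : Tendsto (fun t : ℝ => 2 * t * ‖c - z‖ + ‖z - ω‖) (𝓝[>] 0) (𝓝 (‖z - ω‖)) := by
    have : Continuous fun t : ℝ => 2 * t * ‖c - z‖ + ‖z - ω‖ := by fun_prop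
    have h := this.tendsto 0
    rw [mul_zero, zero_mul, zero_add] at h
    exact h.mono_left nhdsWithin_le_nhds
  refine ge_of_tendsto hlim ?_
  have h1 : ∀ᶠ t : ℝ in 𝓝[>] 0, t < 1 :=
    (eventually_lt_nhds one_pos).filter_mono nhdsWithin_le_nhds
  filter_upwards [h1, self_mem_nhdsWithin] with t ht1 ht0
  have ht0' : (0 : ℝ) < t := ht0
  have hzt := F_combo_mem_Fo hz hc ht0' ht1.le
  have h2 := rho_le_of_facet hz (Fo_subset_F i hzt)
  have h3 := hFo _ hzt
  rw [add_sub_cancel_left, norm_smul, Real.norm_of_nonneg ht0'.le] at h2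
  have h4 : ‖z + t • (c - z) - ω‖ ≤ ‖z - ω‖ + t * ‖c - z‖ := by
    rw [show z + t • (c - z) - ω = (z - ω) + t • (c - z) by abel]
    refine (norm_add_le _ _).trans ?_
    rw [norm_smul, Real.norm_of_nonneg ht0'.le]
  linarith

/-- The source images seen from `x`, with the facets in which they are seen. -/
def T (D : SourcedSystem E ι) (x : E) : Set (ι × E) :=
  {p | ∃ m, D.Desc x p.1 m ∧ p.2 = D.im x m}

/-- The source images that are seen from somewhere. -/
def images (D : SourcedSystem E ι) : Set (ι × E) := {p | ∃ x, p ∈ D.T x}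

theorem finite_images : D.images.Finite := by
  refine Finite.subset ((finite_univ (α := ι)).prod (finite_cand (D := D) (Nat.card ι))) ?_
  rintro ⟨i, ω⟩ ⟨x, m, hd, h⟩
  refine ⟨mem_univ _, ?_⟩
  rw [h]
  exact (im_mem_cand_and_local _ x m i (ncard_le_card _) hd).1

/-- A small step from x towards ω stays in the facet, and there the global bound makes the triangle
inequality an equality. Weak signs suffice here; they become strict in `mem_T_iff` because shortest
paths run in relative interiors. -/
theorem mem_T_of_le {x : E} {i : ι} {ω : E} (hx : x ∈ D.F i) (hxv : x ≠ D.v)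
    (hω : D.g i ω = 0) (hr : ‖x - ω‖ = D.rho x) (hle : ∀ z ∈ D.F i, D.rho z ≤ ‖z - ω‖)
    (hneg : ∀ k, k ≠ i → D.g k x = 0 → D.g k ω ≤ 0) : (i, ω) ∈ D.T x := by
  have hpos := D.rho_pos (F_subset_S i hx) hxv
  have hline : Continuous fun t : ℝ => x + t • (ω - x) := by fun_prop
  have h0 := hline.tendsto 0
  rw [zero_smul, add_zero] at h0
  have h1 : ∀ᶠ t : ℝ in 𝓝[>] 0, t < 1 :=
    (eventually_lt_nhds one_pos).filter_mono nhdsWithin_le_nhds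
  obtain ⟨t, ⟨ht, ht1⟩, ht0⟩ := (((h0.eventually (eventually_lt x hx.1)).filter_mono
    nhdsWithin_le_nhds).and h1 |>.and self_mem_nhdsWithin).exists
  have ht0' : (0 : ℝ) < t := ht0
  set m := x + t • (ω - x) with hm
  have hmi : D.g i m = 0 := by rw [hm, g_combo, hx.2, hω]; ring
  have hmF : m ∈ D.F i := by
    refine ⟨fun k => ?_, hmi⟩
    by_cases hki : k = i
    · rw [hki, hmi]
    by_cases hk : D.g k x = 0
    · rw [hm, g_combo, hk, mul_zero, zero_add]
      exact mul_nonpos_of_nonneg_of_nonpos ht0'.le (hneg k hki hk)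
    · exact (ht k hk).le
  have hn : ‖ω - x‖ = D.rho x := by rw [norm_sub_rev, hr]
  have e1 : m - x = (t * D.rho x) • (D.rho x)⁻¹ • (ω - x) := by
    rw [smul_smul, mul_assoc, mul_inv_cancel₀ hpos.ne', mul_one, hm]
    abel
  have hun : ‖(D.rho x)⁻¹ • (ω - x)‖ = 1 := by
    rw [norm_smul, norm_inv, Real.norm_of_nonneg hpos.le, hn, inv_mul_cancel₀ hpos.ne']
  have e2 : ‖m - x‖ = t * D.rho x := by
    rw [e1, norm_smul, hun, mul_one, Real.norm_of_nonneg (by positivity)]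
  have hcr := norm_crossing (z := x) (ω := ω) ht0'.le ht1.le
  refine ⟨m, ⟨hx, hmF, ?_, le_antisymm (rho_le_of_facet hx hmF) ?_⟩, ?_⟩
  · intro h
    rw [h, sub_self, norm_zero] at e2
    have : 0 < t * D.rho x := by positivity
    linarith
  · have := hle m hmF
    linarith
  · have : udir x m = (D.rho x)⁻¹ • (ω - x) := by
      have h2 : m = x + (t * D.rho x) • (D.rho x)⁻¹ • (ω - x) := by rw [← e1]; abel
      rw [h2]
      exact udir_add_smul hun (by positivity)
    simp only
    rw [im, this, smul_smul, mul_inv_cancel₀ hpos.ne', one_smul]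
    abel

/-- This replaces paths by inequalities, so that images can be carried from one point to another. -/
theorem mem_T_iff {x : E} {i : ι} {ω : E} : (i, ω) ∈ D.T x ↔ x ∈ D.F i ∧ x ≠ D.v ∧
    D.g i ω = 0 ∧ ‖x - ω‖ = D.rho x ∧ (∀ z ∈ D.F i, D.rho z ≤ ‖z - ω‖) ∧
    ∀ k, k ≠ i → D.g k x = 0 → D.g k ω < 0 := by
  constructor
  · rintro ⟨m, hd, h⟩
    simp only at hd h
    subst h
    refine ⟨hd.1, hd.ne_v, hd.g_im, norm_sub_im hd.2.2.1, fun z hz => hd.rho_le hz, ?_⟩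
    intro k hki hk
    rw [im, g_add_smul, hk, zero_add]
    exact mul_neg_of_pos_of_neg hd.rho_pos (hd.inner_neg hk hki)
  · rintro ⟨hx, hxv, hω, hr, hle, hneg⟩
    exact mem_T_of_le hx hxv hω hr hle fun k hk hkx => (hneg k hk hkx).le

theorem T_nonempty {x : E} (hx : x ∈ D.S) (hxv : x ≠ D.v) : (D.T x).Nonempty := by
  obtain ⟨r, hr, hex⟩ := exists_desc hx hxv
  obtain ⟨i, m, hd, -⟩ := hex (r / 2) (by linarith) (by linarith)
  exact ⟨(i, D.im x m), m, hd, rfl⟩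

theorem T_subset_images (x : E) : D.T x ⊆ D.images := fun _ h => ⟨x, h⟩

/-- The source image seen from an interior point `y` of a shortest path from `q`. -/
theorem corner_image {q y m : E} {i j : ι} (hq : q ∈ D.F i) (hqy : q ≠ y) (hy : y ∈ D.F i)
    (hqr : D.rho q = ‖q - y‖ + D.rho y) (hd : D.Desc y j m) :
    (j = i ∧ D.im y m = y - D.rho y • udir y q ∧ y ∈ D.Fo i) ∨
    (i ≠ j ∧ D.refl i j (y - D.rho y • udir y q) = D.im y m ∧
      (∀ k, D.g k y = 0 → D.n k ∈ Submodule.span ℝ {D.n i, D.n j}) ∧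
      ⟪D.n j, udir y q⟫ < 0) := by
  have hiu : ⟪D.n i, udir y q⟫ = 0 := by
    rw [udir, inner_smul_right, ← g_sub, hq.2, hy.2]; simp
  rcases corner hq hqy hy hqr hd with h | ⟨hij, ⟨α, hα, hs⟩, hspan⟩
  · left
    have hmi : D.g i m = 0 := by
      rw [hd.eq_add, h, g_add_smul, hy.2, inner_neg_right, hiu]; simp
    have hmF : m ∈ D.F i := ⟨hd.2.1.1, hmi⟩
    set a := ‖q - y‖ with ha
    set b := ‖m - y‖ with hb
    have hapos : 0 < a := norm_pos_iff.2 (sub_ne_zero.2 hqy)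
    have hbpos : 0 < b := norm_pos_iff.2 (sub_ne_zero.2 hd.2.2.1)
    have hqe : q - y = a • udir y q := (norm_smul_udir y q).symm
    have hme : m - y = -(b • udir y q) := by rw [← smul_neg, ← h, norm_smul_udir]
    have hmq : m - q = -((a + b) • udir y q) := by
      rw [show m - q = (m - y) - (q - y) by abel, hme, hqe]; module
    have hmqn : ‖m - q‖ = a + b := by
      rw [hmq, norm_neg, norm_smul, norm_udir hqy, mul_one, Real.norm_of_nonneg (by positivity)]
    -- The straight piece from q to m passes y, and inner points of a piece of descent lie in the
    -- relative interior of the facet.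
    have hdq : D.Desc q i m := by
      refine ⟨hq, hmF, ?_, ?_⟩
      · intro he
        rw [he, sub_self, norm_zero] at hmqn
        linarith
      · rw [hmqn, hqr, hd.2.2.2]; ring
    have hyFo : y ∈ D.Fo i := by
      have hab : a / (a + b) < 1 := by rw [div_lt_one (by positivity)]; linarith
      have h1 := hdq.mem_Fo (t := a / (a + b)) (by positivity) hab
      have h2 : q + (a / (a + b)) • (m - q) = y := by
        rw [hmq, smul_neg, smul_smul, div_mul_cancel₀ _ (by positivity), ← hqe]
        abel
      rwa [h2] at h1
    refine ⟨eq_of_mem_Fo hyFo hd.1.2, ?_, hyFo⟩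
    rw [im, h, smul_neg, sub_eq_add_neg]
  · right
    have hc := (inner_n_lt hij hy.2 hd.1.2).1
    refine ⟨hij, ?_, hspan, inner_neg_of_sum hij hy.2 hd.1.2 hd.inner_udir hα hs⟩
    rw [← refl_ray hc hy.2 hd.1.2 hiu hd.inner_udir hs, refl_refl hc, im]

/-- Shortest paths to the source do not branch. -/
theorem T_subsingleton {q y : E} {i : ι} (hq : q ∈ D.F i) (hqy : q ≠ y) (hy : y ∈ D.F i)
    (hqr : D.rho q = ‖q - y‖ + D.rho y) : (D.T y).Subsingleton := by
  rintro ⟨j, ω⟩ ⟨m, hd, h⟩ ⟨k, ω'⟩ ⟨m', hd', h'⟩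
  simp only at hd hd' h h'
  subst h h'
  rcases corner_image hq hqy hy hqr hd with ⟨h1, h2, h3⟩ | ⟨h1, h2, h3, h4⟩
  · obtain rfl := eq_of_mem_Fo h3 hd'.1.2
    rcases corner_image hq hqy hy hqr hd' with ⟨h1', h2', -⟩ | ⟨h1', -⟩
    · rw [h1, h2, h2']
    · exact absurd rfl h1'
  · rcases corner_image hq hqy hy hqr hd' with ⟨-, -, h3'⟩ | ⟨h1', h2', h3', h4'⟩
    · exact absurd (eq_of_mem_Fo h3' hd.1.2).symm h1
    · by_cases hjk : j = k
      · subst hjk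
        rw [← h2, ← h2']
      · exfalso
        -- Two different outgoing facets together with the incoming one would be three facets along
        -- one ridge.
        have hiu : ⟪D.n i, udir y q⟫ = 0 := by
          rw [udir, inner_smul_right, ← g_sub, hq.2, hy.2]; simp
        exact three_facets (h3 k hd'.1.2) hiu h4 h4' hd.inner_udir (hd.inner_neg hy.2 h1)
          (hd.inner_neg hd'.1.2 (Ne.symm hjk)) hd'.inner_udir (hd'.inner_neg hy.2 h1')
          (hd'.inner_neg hd.1.2 hjk)

end SourcedSystem

/-! ### Flat points: active normals of rank at most two. -/

namespace HalfspaceSystem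

variable {E : Type*} [NormedAddCommGroup E] [InnerProductSpace ℝ E] [FiniteDimensional ℝ E]
variable {ι : Type*} [Finite ι] (D : HalfspaceSystem E ι)

/-- The span of the normals of the constraints that are active at `x`. -/
def N (x : E) : Submodule ℝ E := Submodule.span ℝ (D.n '' {k | D.g k x = 0})

/-- The points of faces of codimension at most two. -/
def IsFlat (x : E) : Prop := Module.finrank ℝ (D.N x) ≤ 2

variable {D}

theorem n_mem_N {x : E} {k : ι} (hk : D.g k x = 0) : D.n k ∈ D.N x :=
  Submodule.subset_span ⟨k, hk, rfl⟩

theorem linearIndependent_n {i k : ι} (hik : i ≠ k) {x : E} (hi : D.g i x = 0)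
    (hk : D.g k x = 0) : LinearIndependent ℝ ![D.n i, D.n k] := by
  have hi0 : D.n i ≠ 0 := by
    intro h
    have := D.norm_n i
    rw [h, norm_zero] at this
    exact zero_ne_one this
  rw [LinearIndependent.pair_iff' hi0]
  intro a ha
  exact hik (eq_of_mem_span_singleton hi hk ha.symm).symm

theorem finrank_span_pair {i k : ι} (hik : i ≠ k) {x : E} (hi : D.g i x = 0)
    (hk : D.g k x = 0) : Module.finrank ℝ (Submodule.span ℝ {D.n i, D.n k}) = 2 := by
  have := finrank_span_eq_card (linearIndependent_n hik hi hk)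
  rw [Matrix.range_cons, Matrix.range_cons, Matrix.range_empty, union_empty,
    singleton_union] at this
  simpa using this

theorem IsFlat.mem_span {x : E} (hx : D.IsFlat x) {i k l : ι} (hik : i ≠ k) (hi : D.g i x = 0)
    (hk : D.g k x = 0) (hl : D.g l x = 0) : D.n l ∈ Submodule.span ℝ {D.n i, D.n k} := by
  have hle : Submodule.span ℝ {D.n i, D.n k} ≤ D.N x := by
    rw [Submodule.span_le]
    rintro _ (rfl | rfl)
    exacts [n_mem_N hi, n_mem_N hk]
  have := Submodule.eq_of_le_of_finrank_le hle (by rw [finrank_span_pair hik hi hk]; exact hx)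
  rw [this]
  exact n_mem_N hl

theorem isFlat_of_mem_span {x : E} {i k : ι} (hik : i ≠ k) (hi : D.g i x = 0) (hk : D.g k x = 0)
    (h : ∀ l, D.g l x = 0 → D.n l ∈ Submodule.span ℝ {D.n i, D.n k}) : D.IsFlat x := by
  have hle : D.N x ≤ Submodule.span ℝ {D.n i, D.n k} := by
    rw [N, Submodule.span_le]
    rintro _ ⟨l, hl, rfl⟩
    exact h l hl
  have := Submodule.finrank_mono hle
  rwa [finrank_span_pair hik hi hk] at this

theorem isFlat_of_unique {x : E} {i : ι} (h : ∀ k, D.g k x = 0 → k = i) : D.IsFlat x := by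
  have hle : D.N x ≤ Submodule.span ℝ {D.n i} := by
    rw [N, Submodule.span_le]
    rintro _ ⟨l, hl, rfl⟩
    rw [h l hl]
    exact Submodule.subset_span rfl
  have h1 := Submodule.finrank_mono hle
  have h2 := finrank_span_le_card (R := ℝ) ({D.n i} : Set E)
  have h3 : ({D.n i} : Set E).toFinset.card = 1 := by simp
  unfold IsFlat
  omega

/-- Redundant constraints may be active along a ridge; a nonempty `Fo` singles out the genuine
facets, of which a ridge has at most two. -/
theorem not_three_facets {y : E} (hy : D.IsFlat y) {i j k : ι} (hij : i ≠ j) (hik : i ≠ k)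
    (hjk : j ≠ k) (hi : D.g i y = 0) (hj : D.g j y = 0) (hk : D.g k y = 0)
    (hFi : (D.Fo i).Nonempty) (hFj : (D.Fo j).Nonempty) (hFk : (D.Fo k).Nonempty) : False := by
  obtain ⟨a, ha⟩ := hFi
  obtain ⟨b, hb⟩ := hFj
  obtain ⟨c, hc⟩ := hFk
  have e : ∀ l (z : E), D.g l y = 0 → ⟪D.n l, z - y⟫ = D.g l z := fun l z h => by
    rw [← g_sub, h, sub_zero]
  refine three_facets (hy.mem_span hij hi hj hk) (u := a - y) (w := b - y) (z := c - y)
    ?_ ?_ ?_ ?_ ?_ ?_ ?_ ?_ ?_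
  · rw [e i a hi]; exact ha.1
  · rw [e j a hj]; exact ha.2 j hij.symm
  · rw [e k a hk]; exact ha.2 k hik.symm
  · rw [e j b hj]; exact hb.1
  · rw [e i b hi]; exact hb.2 i hij
  · rw [e k b hk]; exact hb.2 k hjk.symm
  · rw [e k c hk]; exact hc.1
  · rw [e i c hi]; exact hc.2 i hik
  · rw [e j c hj]; exact hc.2 j hjk

end HalfspaceSystem

/-! ### Cut points as points that see several images. -/

namespace SourcedSystem

open HalfspaceSystem

variable {E : Type*} [NormedAddCommGroup E] [InnerProductSpace ℝ E] [FiniteDimensional ℝ E]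
variable {ι : Type*} [Finite ι] {D : SourcedSystem E ι}

section CutPoints

theorem path_rho_le {x : E} {γ : Path x D.v} (hx : x ∈ D.S) (hγ : IsShortestPath D.S γ)
    {s t : unitInterval} (hst : s ≤ t) : D.rho (γ t) ≤ D.rho (γ s) := by
  have h := hγ.add_le (D.hfin x hx) hst
  exact ENNReal.toReal_mono (D.hfin _ (hγ.1 (mem_range_self s))) (le_add_self.trans h)

/-- `rho` strictly decreases along a shortest path except where the parametrization pauses. -/
theorem path_eq_of_rho_le {x : E} {γ : Path x D.v} (hx : x ∈ D.S) (hγ : IsShortestPath D.S γ)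
    {s t : unitInterval} (hst : s ≤ t) (h : D.rho (γ s) ≤ D.rho (γ t)) : γ s = γ t := by
  have h1 := hγ.add_le (D.hfin x hx) hst
  have hs := D.hfin _ (hγ.1 (mem_range_self s))
  have ht := D.hfin _ (hγ.1 (mem_range_self t))
  have h2 : intrinsicDist D.S (γ s) D.v ≤ intrinsicDist D.S (γ t) D.v :=
    (ENNReal.toReal_le_toReal hs ht).1 h
  have h3 : intrinsicDist D.S (γ s) (γ t) + intrinsicDist D.S (γ t) D.v ≤
      0 + intrinsicDist D.S (γ t) D.v := by rw [zero_add]; exact h1.trans h2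
  have h4 := (ENNReal.add_le_add_iff_right ht).1 h3
  have h5 := (edist_le_intrinsicDist D.S (γ s) (γ t)).trans h4
  exact edist_le_zero.1 h5

theorem path_desc {x : E} {γ : Path x D.v} (hx : x ∈ D.S) (hγ : IsShortestPath D.S γ)
    {s t : unitInterval} (hst : s ≤ t) {i : ι} (hs : γ s ∈ D.F i) (ht : γ t ∈ D.F i)
    (hne : γ t ≠ γ s) : D.Desc (γ s) i (γ t) :=
  ⟨hs, ht, hne, (rho_eq_iff hs ht).2 (hγ.add_le (D.hfin x hx) hst)⟩

theorem Desc.shorten {x m : E} {i : ι} (hd : D.Desc x i m) {r : ℝ} (h0 : 0 < r)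
    (h1 : r < ‖m - x‖) : D.Desc x i (x + r • udir x m) ∧ x + r • udir x m ∈ D.Fo i ∧
      D.rho (x + r • udir x m) = D.rho x - r := by
  have hpos := h0.trans h1
  have ht : r / ‖m - x‖ < 1 := (div_lt_one hpos).2 h1
  have ht0 : 0 < r / ‖m - x‖ := by positivity
  have e : x + r • udir x m = x + (r / ‖m - x‖) • (m - x) := by
    rw [udir, smul_smul, div_eq_mul_inv]
  have hFo : x + r • udir x m ∈ D.Fo i := e ▸ hd.mem_Fo ht0 ht
  have hF := Fo_subset_F i hFo
  have hn : ‖x + r • udir x m - x‖ = r := by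
    rw [add_sub_cancel_left, norm_smul, norm_udir hd.2.2.1, mul_one, Real.norm_of_nonneg h0.le]
  have h2 := rho_le_of_facet hd.1 hF
  have h3 := rho_le_of_facet hF hd.2.1
  have h4 : ‖m - (x + r • udir x m)‖ = ‖m - x‖ - r := by
    have : m - (x + r • udir x m) = (‖m - x‖ - r) • udir x m := by
      rw [sub_smul, norm_smul_udir]; abel
    rw [this, norm_smul, norm_udir hd.2.2.1, mul_one, Real.norm_of_nonneg (by linarith)]
  rw [hn] at h2
  rw [h4] at h3
  have h5 := hd.2.2.2
  have h6 : D.rho (x + r • udir x m) = D.rho x - r := by linarith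
  refine ⟨⟨hd.1, hF, ?_, ?_⟩, hFo, h6⟩
  · intro h
    rw [h, sub_self, norm_zero] at hn
    linarith
  · rw [hn]; linarith

theorem udir_eq_of_im_eq {x m m' : E} (hx : 0 < D.rho x) (h : D.im x m = D.im x m') :
    udir x m = udir x m' := by
  rw [im, im, add_right_inj] at h
  exact smul_right_injective E hx.ne' h

/-- A point other than x on a shortest path is reached from a nearby point in a common facet, and
shortest paths do not branch. -/
theorem path_T_subsingleton {x : E} {γ : Path x D.v} (hx : x ∈ D.S) (hγ : IsShortestPath D.S γ)
    (hT : (D.T x).Subsingleton) (t : unitInterval) : (D.T (γ t)).Subsingleton := by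
  by_cases hy : γ t = x
  · rwa [hy]
  set y := γ t with hydef
  set Z := {s : unitInterval | γ s = y} with hZ
  have hZc : IsClosed Z := isClosed_eq γ.continuous continuous_const
  -- The first arrival at y is taken so that earlier points of the path differ from y.
  obtain ⟨t₀, ht₀, hleast⟩ := hZc.isCompact.exists_isLeast ⟨t, rfl⟩
  have ht₀y : γ t₀ = y := ht₀
  have h0 : (0 : unitInterval) < t₀ := by
    refine lt_of_le_of_ne t₀.2.1 fun h => hy ?_
    rw [← ht₀y, ← h, γ.source]
  have hyS : y ∈ D.S := hγ.1 (mem_range_self t)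
  have hev := γ.continuous.continuousAt.eventually
    (show ∀ᶠ z in 𝓝 (γ t₀), _ from ht₀y ▸ eventually_common_facet hyS.1)
  have : (𝓝[<] t₀).NeBot := nhdsLT_neBot_of_exists_lt ⟨0, h0⟩
  obtain ⟨s, hs, hst⟩ := ((hev.filter_mono (nhdsWithin_le_nhds (s := Iio t₀))).and
    self_mem_nhdsWithin).exists
  have hst' : s < t₀ := hst
  obtain ⟨hsP, i, hi⟩ := hγ.1 (mem_range_self s)
  have hsF : γ s ∈ D.F i := ⟨hsP, hi⟩
  rw [ht₀y] at hs
  have hyF := hs i hsF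
  have hne : γ s ≠ y := fun h => (hleast h).not_gt hst'
  have hd := path_desc hx hγ hst'.le hsF (ht₀y.symm ▸ hyF) (by rw [ht₀y]; exact hne.symm)
  rw [ht₀y] at hd
  exact T_subsingleton hsF hne hyF (by rw [hd.2.2.2, norm_sub_rev])

theorem path_exists_desc {x : E} {γ : Path x D.v} (hx : x ∈ D.S) (hγ : IsShortestPath D.S γ)
    {t : unitInterval} (hv : γ t ≠ D.v) : ∃ ε₀ > 0, ∀ ε, 0 < ε → ε < ε₀ →
      ∃ z ∈ range γ, ∃ j, D.Desc (γ t) j z ∧ ‖z - γ t‖ = ε := by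
  set y := γ t with hy
  have hyS : y ∈ D.S := hγ.1 (mem_range_self t)
  obtain ⟨r, hr, hball⟩ := Metric.eventually_nhds_iff.1 (eventually_common_facet hyS.1)
  refine ⟨min r (dist D.v y), lt_min hr (dist_pos.2 hv.symm), fun ε hε hε' => ?_⟩
  have hcont : ContinuousOn (fun s : unitInterval => dist (γ s) y) (Icc t 1) := by fun_prop
  have hivt := intermediate_value_Icc (show t ≤ 1 from t.2.2) hcont
  obtain ⟨s, hs, hsε⟩ := hivt (show ε ∈ _ by
    rw [γ.target, ← hy, dist_self]
    exact ⟨hε.le, hε'.le.trans (min_le_right _ _)⟩)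
  simp only at hsε
  obtain ⟨hsP, j, hj⟩ := hγ.1 (mem_range_self s)
  have hsF : γ s ∈ D.F j := ⟨hsP, hj⟩
  have hyF : y ∈ D.F j := hball (by rw [hsε]; exact hε'.trans_le (min_le_left _ _)) j hsF
  refine ⟨γ s, mem_range_self s, j, path_desc hx hγ hs.1 hyF hsF ?_, by rw [← dist_eq_norm, hsε]⟩
  intro h
  rw [h, ← hy, dist_self] at hsε
  exact hε.ne hsε

/-- The parameters at which γ lies on γ' form a closed set. It is also open to the right: both paths
leave a common point towards the only image seen there, hence through the same points. -/
theorem range_subset_of_T_subsingleton {x : E} (hx : x ∈ D.S) (hT : (D.T x).Subsingleton)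
    {γ γ' : Path x D.v} (hγ : IsShortestPath D.S γ) (hγ' : IsShortestPath D.S γ') :
    range γ ⊆ range γ' := by
  set B : Set unitInterval := {t | γ t ∈ range γ'} with hB
  have hBc : IsClosed B :=
    (isCompact_range γ'.continuous).isClosed.preimage γ.continuous
  have key : Icc (0 : unitInterval) 1 ⊆ B := by
    refine IsClosed.Icc_subset_of_forall_mem_nhdsWithin (hBc.inter isClosed_Icc)
      ⟨0, by rw [γ.source, γ'.source]⟩ ?_
    rintro t ⟨⟨t', ht'⟩, -⟩
    by_cases hyv : γ t = D.v
    -- Having reached the source, γ stays there, since `rho` does not increase.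
    · filter_upwards [self_mem_nhdsWithin] with s hs
      have h1 := path_rho_le hx hγ (le_of_lt hs)
      rw [hyv, rho_v] at h1
      have h2 : γ s = D.v := by
        by_contra hne
        have := D.rho_pos (hγ.1 (mem_range_self s)) hne
        linarith
      exact ⟨1, by rw [γ'.target, h2]⟩
    · have hTy := path_T_subsingleton hx hγ hT t
      obtain ⟨ε₀, hε₀, hex⟩ := path_exists_desc hx hγ' (t := t') (by rwa [ht'])
      rw [ht'] at hex
      have hyS : γ t ∈ D.S := hγ.1 (mem_range_self t)
      have hev := γ.continuous.continuousAt.eventually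
        ((eventually_common_facet hyS.1).and (Metric.ball_mem_nhds (γ t) hε₀))
      filter_upwards [hev.filter_mono nhdsWithin_le_nhds, self_mem_nhdsWithin] with s hs hst
      by_cases hne : γ s = γ t
      · exact ⟨t', by rw [ht', hne]⟩
      obtain ⟨hsP, i, hi⟩ := hγ.1 (mem_range_self s)
      have hsF : γ s ∈ D.F i := ⟨hsP, hi⟩
      have hd := path_desc hx hγ (le_of_lt hst) (hs.1 i hsF) hsF hne
      have hlt : ‖γ s - γ t‖ < ε₀ := by rw [← dist_eq_norm]; exact hs.2
      obtain ⟨z, hz, j, hdz, hzn⟩ := hex _ (norm_pos_iff.2 (sub_ne_zero.2 hne)) hlt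
      have heq := hTy (show (i, D.im (γ t) (γ s)) ∈ D.T (γ t) from ⟨_, hd, rfl⟩)
        (show (j, D.im (γ t) z) ∈ D.T (γ t) from ⟨_, hdz, rfl⟩)
      have him : D.im (γ t) (γ s) = D.im (γ t) z := (Prod.ext_iff.1 heq).2
      have hu := udir_eq_of_im_eq hd.rho_pos him
      have : γ s = z := by rw [hd.eq_add, hdz.eq_add, hu, hzn]
      show γ s ∈ range γ'
      rwa [this]
  rintro _ ⟨t, rfl⟩
  exact key ⟨t.2.1, t.2.2⟩

theorem mem_cutPoints_iff {x : E} :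
    x ∈ cutPoints D.P D.v ↔ x ∈ D.S ∧ ¬(D.T x).Subsingleton := by
  rw [cutPoints, frontier_P]
  constructor
  · rintro ⟨hx, γ, γ', hγ, hγ', hne⟩
    refine ⟨hx, fun hT => hne ?_⟩
    exact (range_subset_of_T_subsingleton hx hT hγ hγ').antisymm
      (range_subset_of_T_subsingleton hx hT hγ' hγ)
  · rintro ⟨hx, hT⟩
    refine ⟨hx, ?_⟩
    rw [not_subsingleton_iff] at hT
    obtain ⟨⟨i, ω⟩, ⟨m, hd, hω⟩, ⟨j, ω'⟩, ⟨m', hd', hω'⟩, hne⟩ := hT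
    simp only at hd hω hd' hω'
    subst hω hω'
    have h1 : 0 < ‖m - x‖ := norm_pos_iff.2 (sub_ne_zero.2 hd.2.2.1)
    have h2 : 0 < ‖m' - x‖ := norm_pos_iff.2 (sub_ne_zero.2 hd'.2.2.1)
    -- Both pieces are cut at the same length r. If the two paths had equal ranges, one path would
    -- contain both end points, which have equal `rho` and hence coincide; then so do the directions
    -- and the facets.
    obtain ⟨r, hr0, hr⟩ := exists_between (lt_min h1 h2)
    obtain ⟨hs1, hs2, hs3⟩ := hd.shorten hr0 (hr.trans_le (min_le_left _ _))
    obtain ⟨hs1', hs2', hs3'⟩ := hd'.shorten hr0 (hr.trans_le (min_le_right _ _))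
    obtain ⟨γ, hγ, ⟨s, hs⟩⟩ := hs1.exists_shortestPath
    obtain ⟨γ', hγ', hm'⟩ := hs1'.exists_shortestPath
    refine ⟨γ, γ', hγ, hγ', fun heq => hne ?_⟩
    rw [← heq] at hm'
    obtain ⟨t, ht⟩ := hm'
    have hst : γ s = γ t := by
      rcases le_total s t with h | h
      · exact path_eq_of_rho_le hx hγ h (by rw [hs, ht, hs3, hs3'])
      · exact (path_eq_of_rho_le hx hγ h (by rw [hs, ht, hs3, hs3'])).symm
    rw [hs, ht] at hst
    have hu : udir x m = udir x m' := smul_right_injective E hr0.ne' (add_left_cancel hst)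
    rw [hst] at hs2
    rw [im, im, hu, eq_of_mem_Fo hs2' (hs2.1)]

end CutPoints

/-! ### Stability of the images near flat points. -/

theorem Fo_nonempty_of_mem_T {x : E} {i : ι} {ω : E} (h : (i, ω) ∈ D.T x) : (D.Fo i).Nonempty := by
  obtain ⟨m, hd, -⟩ := h
  exact ⟨_, hd.mem_Fo (t := 1 / 2) (by norm_num) (by norm_num)⟩

/-- Source images seen near `y` are at distance `rho y` from `y`. -/
theorem eventually_touch {y : E} (hy : y ∈ D.S) : ∀ᶠ y' in 𝓝 y, ∀ i ω, (i, ω) ∈ D.T y' →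
    y ∈ D.F i ∧ ‖y - ω‖ = D.rho y := by
  have key : ∀ p ∈ D.images, ∀ᶠ y' in 𝓝 y, p ∈ D.T y' → y ∈ D.F p.1 ∧ ‖y - p.2‖ = D.rho y := by
    rintro ⟨i, ω⟩ -
    by_cases h1 : y ∈ D.F i
    · by_cases h2 : ‖y - ω‖ = D.rho y
      · exact Eventually.of_forall fun _ _ => ⟨h1, h2⟩
      · have hc : ContinuousWithinAt (fun z => ‖z - ω‖ - D.rho z) D.S y :=
          (by fun_prop : Continuous fun z : E => ‖z - ω‖).continuousWithinAt.sub
            (continuousOn_rho y hy)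
        have := hc.eventually_ne (sub_ne_zero.2 h2)
        filter_upwards [eventually_nhdsWithin_iff.1 this] with y' hy' hT
        have hT' := mem_T_iff.1 hT
        exact absurd (sub_eq_zero.2 hT'.2.2.2.1) (hy' (F_subset_S i hT'.1))
    · filter_upwards [(isClosed_F i).isOpen_compl.mem_nhds h1] with y' hy' hT
      exact absurd (mem_T_iff.1 hT).1 hy'
  filter_upwards [(eventually_all_finite finite_images).2 key] with y' h i ω hT
  exact h (i, ω) (T_subset_images _ hT) hT

/-- A source image seen near a flat point `y` is also seen from `y`, possibly after unfolding it
into the other facet at `y`. -/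
theorem eventually_transfer {y : E} (hy : y ∈ D.S) (hflat : D.IsFlat y) (hyv : y ≠ D.v) :
    ∀ᶠ y' in 𝓝 y, ∀ i ω, (i, ω) ∈ D.T y' →
      (i, ω) ∈ D.T y ∨ ∃ j, j ≠ i ∧ (j, D.refl i j ω) ∈ D.T y ∧ 0 < D.g j ω := by
  have key : ∀ p ∈ D.images, ∀ᶠ y' in 𝓝 y, p ∈ D.T y' →
      p ∈ D.T y ∨ ∃ j, j ≠ p.1 ∧ (j, D.refl p.1 j p.2) ∈ D.T y ∧ 0 < D.g j p.2 := by
    rintro ⟨i, ω⟩ ⟨x', hx'⟩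
    have himg := mem_T_iff.1 hx'
    by_cases hA : ∀ k, k ≠ i → D.g k y = 0 → D.g k ω ≤ 0
    · filter_upwards [eventually_touch hy] with y' hy' hT
      obtain ⟨h1, h2⟩ := hy' i ω hT
      exact Or.inl (mem_T_of_le h1 hyv himg.2.2.1 h2 himg.2.2.2.2.1 hA)
    · push Not at hA
      obtain ⟨k, hki, hky, hkω⟩ := hA
      -- Here ω lies strictly beyond the k-th facet, so the shortest path from y' towards ω must
      -- cross the ridge at c y', close to y; past the ridge the image is seen reflected in another
      -- facet.
      set c : E → E := fun z => z + (D.g k z / (D.g k z - D.g k ω)) • (ω - z) with hcdef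
      have hden : D.g k y - D.g k ω ≠ 0 := by rw [hky]; linarith
      have hcc : ContinuousAt c y := by
        have h1 : ContinuousAt (D.g k) y := (continuous_g k).continuousAt
        exact continuousAt_id.add ((h1.div (h1.sub continuousAt_const) hden).smul
          (continuousAt_const.sub continuousAt_id))
      have hcy : c y = y := by simp [hcdef, hky]
      have hev := hcc.eventually (show ∀ᶠ z in 𝓝 (c y), _ from
        hcy.symm ▸ eventually_lt y hy.1)
      filter_upwards [eventually_touch hy, hev] with y' hy' hz hT
      rw [hcy] at hz
      obtain ⟨h1, h2⟩ := hy' i ω hT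
      obtain ⟨hy'F, hy'v, hgω, hr', hle, hneg⟩ := mem_T_iff.1 hT
      right
      have hky' : D.g k y' < 0 := by
        refine lt_of_le_of_ne (hy'F.1 k) fun h => ?_
        have := hneg k hki h
        linarith
      have hden' : D.g k y' - D.g k ω < 0 := by linarith
      set τ := D.g k y' / (D.g k y' - D.g k ω) with hτ
      have hτ0 : 0 < τ := div_pos_of_neg_of_neg hky' hden'
      have hτ1 : τ ≤ 1 := by
        rw [hτ, div_le_one_of_neg hden']
        linarith
      set z := c y' with hzdef
      have hzeq : z = y' + τ • (ω - y') := rfl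
      have hiz : D.g i z = 0 := by rw [hzeq, g_combo, hy'F.2, hgω]; ring
      have hkz : D.g k z = 0 := by
        rw [hzeq, g_combo, hτ]
        field_simp [hden'.ne]
        ring
      have hact : ∀ l, D.g l y = 0 → D.g l z = 0 := fun l hl =>
        g_eq_zero_of_mem_span (hflat.mem_span (Ne.symm hki) h1.2 hky hl) hl h1.2 hky hiz hkz
      have hzP : z ∈ D.P := by
        intro l
        by_cases hl : D.g l y = 0
        · exact (hact l hl).le
        · exact (hz l hl).le
      have hact' : ∀ l, D.g l z = 0 → D.g l y = 0 := by
        intro l hl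
        by_contra hcon
        exact (hz l hcon).ne hl
      have hzF : z ∈ D.F i := ⟨hzP, hiz⟩
      have hzv : z ≠ D.v := by
        intro h
        have e1 := (D.hact i).1 (h ▸ hiz)
        have e2 := (D.hact k).1 (h ▸ hkz)
        exact hki (e2.trans e1.symm)
      have hcr := norm_crossing (z := y') (ω := ω) hτ0.le hτ1
      rw [← hzeq] at hcr
      have hle1 := rho_le_of_facet hy'F hzF
      have hle2 := hle z hzF
      have hrho : D.rho y' = ‖z - y'‖ + D.rho z := by linarith
      obtain ⟨m₀, hd₀, hω₀⟩ := hT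
      simp only at hd₀ hω₀
      have hpos := hd₀.rho_pos
      have hωy : ω - y' = D.rho y' • udir y' m₀ := by rw [hω₀, im]; abel
      have hzeq2 : z = y' + (τ * D.rho y') • udir y' m₀ := by
        rw [hzeq, hωy, smul_smul]
      have hudir : udir y' z = udir y' m₀ := by
        conv_lhs => rw [hzeq2]
        exact udir_add_smul (norm_udir hd₀.2.2.1) (by positivity)
      have hzy : z ≠ y' := by
        intro h
        have := hkz
        rw [h] at this
        exact hky'.ne this
      have hdz : D.Desc y' i z := ⟨hy'F, hzF, hzy, hrho⟩
      have hωz : ω = z - D.rho z • udir z y' := by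
        rw [← hdz.im_eq, im, hudir, hω₀, im]
      obtain ⟨r, hr, hex⟩ := exists_desc (F_subset_S i hzF) hzv
      obtain ⟨j, m, hd, -⟩ := hex (r / 2) (by linarith) (by linarith)
      rcases corner_image hy'F hzy.symm hzF (by rw [hrho, norm_sub_rev]) hd with
        ⟨-, -, hzo⟩ | ⟨hij, hrefl, -, -⟩
      · exact absurd (eq_of_mem_Fo hzo hkz) hki
      · rw [← hωz] at hrefl
        have hTz : (j, D.refl i j ω) ∈ D.T z := ⟨m, hd, hrefl⟩
        obtain ⟨hzFj, -, hj1, -, hj3, hj4⟩ := mem_T_iff.1 hTz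
        have hjy := hact' j hzFj.2
        have hcn := (inner_n_lt hij h1.2 hjy).1
        refine ⟨j, hij.symm, mem_T_iff.2 ⟨⟨hy.1, hjy⟩, hyv, hj1, ?_, hj3, fun l hl hly =>
          hj4 l hl (hact l hly)⟩, ?_⟩
        · rw [norm_refl_sub_of_mem hcn h1.2 hjy, h2]
        · have := hj4 i hij hiz
          rw [g_refl_left hcn] at this
          simpa using this
  filter_upwards [(eventually_all_finite finite_images).2 key] with y' h i ω hT
  exact h (i, ω) (T_subset_images _ hT) hT

/-- Near a flat point that is not a cut point there are no cut points. -/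
theorem eventually_T_subsingleton {y : E} (hy : y ∈ D.S) (hflat : D.IsFlat y)
    (hT : (D.T y).Subsingleton) : ∀ᶠ y' in 𝓝 y, (D.T y').Subsingleton := by
  by_cases hyv : y = D.v
  · filter_upwards [eventually_touch hy] with y' hy'
    rintro ⟨i, ω⟩ h1 ⟨j, ω'⟩ h2
    obtain ⟨a1, a2⟩ := hy' i ω h1
    obtain ⟨b1, b2⟩ := hy' j ω' h2
    rw [hyv, rho_v, norm_eq_zero, sub_eq_zero] at a2 b2
    have a3 := (D.hact i).1 (hyv ▸ a1.2)
    have b3 := (D.hact j).1 (hyv ▸ b1.2)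
    rw [← a2, ← b2, a3, b3]
  filter_upwards [eventually_transfer hy hflat hyv, eventually_touch hy] with y' htr hto
  -- An image seen in facet i and one unfolded into the same facet i exclude each other: y' would
  -- lie on that facet, while the second image lies strictly beyond it.
  have hmixed : ∀ i ω i' ω', (i, ω) ∈ D.T y' → (i', ω') ∈ D.T y' → (i, ω) ∈ D.T y →
      ∀ j, j ≠ i' → (j, D.refl i' j ω') ∈ D.T y → 0 < D.g j ω' → False := by
    intro i ω i' ω' h1 h2 h3 j hj h4 hpos
    have h5 := hT h3 h4
    have hij : i = j := (Prod.ext_iff.1 h5).1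
    subst hij
    have := (mem_T_iff.1 h2).2.2.2.2.2 i hj (mem_T_iff.1 h1).1.2
    linarith
  rintro ⟨i, ω⟩ h1 ⟨i', ω'⟩ h2
  rcases htr i ω h1 with a | ⟨j, hj, a, hpos⟩
  · rcases htr i' ω' h2 with b | ⟨j', hj', b, hpos'⟩
    · exact hT a b
    · exact (hmixed i ω i' ω' h1 h2 a j' hj' b hpos').elim
  · rcases htr i' ω' h2 with b | ⟨j', hj', b, hpos'⟩
    · exact (hmixed i' ω' i ω h2 h1 b j hj a hpos).elim
    · have h5 := hT a b
      have hjj : j = j' := (Prod.ext_iff.1 h5).1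
      subst hjj
      have hre : D.refl i j ω = D.refl i' j ω' := (Prod.ext_iff.1 h5).2
      have hiy := (hto i ω h1).1.2
      have hi'y := (hto i' ω' h2).1.2
      have hjy := (mem_T_iff.1 a).1.2
      by_cases hii : i = i'
      · subst hii
        have hcn := (inner_n_lt hj.symm hiy hjy).1
        rw [← refl_refl hcn ω, hre, refl_refl hcn]
      · exact (not_three_facets hflat hii hj.symm hj'.symm hiy hi'y hjy
          (Fo_nonempty_of_mem_T h1) (Fo_nonempty_of_mem_T h2) (Fo_nonempty_of_mem_T a)).elim

/-- Near a flat point that is not a cut point, only one source image is seen. -/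
theorem eventually_image {y : E} (hy : y ∈ D.S) (hflat : D.IsFlat y)
    (hT : (D.T y).Subsingleton) {i : ι} {ω : E} (hi : (i, ω) ∈ D.T y) :
    ∀ᶠ y' in 𝓝 y, ∀ i' ω', (i', ω') ∈ D.T y' →
      (i' = i ∧ ω' = ω) ∨ (i ≠ i' ∧ ω' = D.refl i i' ω ∧ 0 < D.g i ω' ∧ D.g i' y = 0) := by
  have hyv := (mem_T_iff.1 hi).2.1
  filter_upwards [eventually_transfer hy hflat hyv, eventually_touch hy] with y' htr hto i' ω' h
  have hi'y := (hto i' ω' h).1.2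
  rcases htr i' ω' h with a | ⟨j, hj, a, hpos⟩
  · left
    exact Prod.ext_iff.1 (hT a hi)
  · right
    have h5 := Prod.ext_iff.1 (hT a hi)
    simp only at h5
    obtain ⟨rfl, h6⟩ := h5
    refine ⟨hj, ?_, hpos, hi'y⟩
    have hcn := (inner_n_lt hj (mem_T_iff.1 hi).1.2 hi'y).1
    rw [← h6, refl_comm i' j, refl_refl hcn]

/-- The source images are constant on connected sets of points without cut points that have the
same active constraints. -/
theorem T_eq_of_isPreconnected {A : Set E} (hA : IsPreconnected A) (hS : A ⊆ D.S)
    (hv : D.v ∉ A) (hflat : ∀ z ∈ A, D.IsFlat z) (hT : ∀ z ∈ A, (D.T z).Subsingleton)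
    (hact : ∀ z ∈ A, ∀ z' ∈ A, ∀ k, D.g k z = 0 → D.g k z' = 0) {x y : E} (hx : x ∈ A)
    (hy : y ∈ A) : D.T x = D.T y := by
  have : PreconnectedSpace A := isPreconnected_iff_preconnectedSpace.1 hA
  have hloc : IsLocallyConstant fun z : A => D.T z := by
    rw [IsLocallyConstant.iff_eventually_eq]
    rintro ⟨z, hz⟩
    obtain ⟨⟨i, ω⟩, hi⟩ := T_nonempty (hS hz) (fun h => hv (h ▸ hz))
    have hev := eventually_image (hS hz) (hflat z hz) (hT z hz) hi
    filter_upwards [continuous_subtype_val.continuousAt.eventually hev] with z' hz'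
    obtain ⟨z', hz'A⟩ := z'
    obtain ⟨⟨i', ω'⟩, hi'⟩ := T_nonempty (hS hz'A) (fun h => hv (h ▸ hz'A))
    rcases hz' i' ω' hi' with ⟨rfl, rfl⟩ | ⟨hne, -, hpos, -⟩
    · rw [(hT z' hz'A).eq_singleton_of_mem hi', (hT z hz).eq_singleton_of_mem hi]
    · have h1 := hact z hz z' hz'A i (mem_T_iff.1 hi).1.2
      have h2 := (mem_T_iff.1 hi').2.2.2.2.2 i hne h1
      linarith
  exact hloc.apply_eq_of_preconnectedSpace ⟨x, hx⟩ ⟨y, hy⟩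

/-- Near a flat point `y` that is not a cut point, the boundary and the distance to the source look
like a flat space and the distance to the source image. -/
theorem eventually_chart {y : E} (hy : y ∈ D.S) (hflat : D.IsFlat y)
    (hT : (D.T y).Subsingleton) {i : ι} {ω : E} (hi : (i, ω) ∈ D.T y) :
    ∀ᶠ h in 𝓝 (0 : E), ⟪D.n i, h⟫ = 0 → ∃ z ∈ D.S, D.rho z = ‖y + h - ω‖ ∧
      z - (y + h) ∈ D.N y ∧ ∀ x, (∀ k, D.g k y = 0 → D.g k x = 0) → ‖z - x‖ = ‖y + h - x‖ := by
  obtain ⟨hyF, hyv, hiω, hrω, hle, hneg⟩ := mem_T_iff.1 hi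
  have hloc : ∀ᶠ z in 𝓝 y, (∀ k, D.g k y ≠ 0 → D.g k z < 0) ∧ z ≠ D.v ∧
      ∀ i' ω', (i', ω') ∈ D.T z →
      (i' = i ∧ ω' = ω) ∨ (i ≠ i' ∧ ω' = D.refl i i' ω ∧ 0 < D.g i ω' ∧ D.g i' y = 0) :=
    (eventually_lt y hy.1).and ((eventually_ne_nhds hyv).and (eventually_image hy hflat hT hi))
  have hsame : ∀ h : E, ⟪D.n i, h⟫ = 0 → (∀ k, D.g k y = 0 → ⟪D.n k, h⟫ ≤ 0) →
      ((∀ k, D.g k y ≠ 0 → D.g k (y + h) < 0) ∧ y + h ≠ D.v ∧ ∀ i' ω', (i', ω') ∈ D.T (y + h) →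
      (i' = i ∧ ω' = ω) ∨ (i ≠ i' ∧ ω' = D.refl i i' ω ∧ 0 < D.g i ω' ∧ D.g i' y = 0)) →
      ∃ z ∈ D.S, D.rho z = ‖y + h - ω‖ ∧
      z - (y + h) ∈ D.N y ∧ ∀ x, (∀ k, D.g k y = 0 → D.g k x = 0) → ‖z - x‖ = ‖y + h - x‖ := by
    rintro h hih hk ⟨h1, h2, h3⟩
    have hzi : D.g i (y + h) = 0 := by rw [g_add, hyF.2, hih, add_zero]
    have hzP : y + h ∈ D.P := by
      intro k
      by_cases hky : D.g k y = 0
      · rw [g_add, hky, zero_add]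
        exact hk k hky
      · exact (h1 k hky).le
    have hzS : y + h ∈ D.S := ⟨hzP, i, hzi⟩
    refine ⟨y + h, hzS, ?_, by rw [sub_self]; exact Submodule.zero_mem _, fun _ _ => rfl⟩
    obtain ⟨⟨i', ω'⟩, hi'⟩ := T_nonempty hzS h2
    have hi'' := mem_T_iff.1 hi'
    rcases h3 i' ω' hi' with ⟨rfl, rfl⟩ | ⟨hne, -, hpos, -⟩
    · exact hi''.2.2.2.1.symm
    · have := hi''.2.2.2.2.2 i hne hzi
      linarith
  have hadd : Tendsto (fun h : E => y + h) (𝓝 0) (𝓝 y) := by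
    have := (by fun_prop : Continuous fun h : E => y + h).tendsto 0
    rwa [add_zero] at this
  by_cases hex : ∃ k, k ≠ i ∧ D.g k y = 0
  · obtain ⟨k₀, hk₀, hk₀y⟩ := hex
    set e := ω - y with he
    have hie : ⟪D.n i, e⟫ = 0 := by rw [he, ← g_sub, hiω, hyF.2, sub_zero]
    have hke : ∀ k, k ≠ i → D.g k y = 0 → ⟪D.n k, e⟫ < 0 := by
      intro k hk hky
      rw [he, ← g_sub, hky, sub_zero]
      exact hneg k hk hky
    -- The maximal ratio selects the genuine second facet among the active constraints: w then lies
    -- in its hyperplane and satisfies all of them.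
    obtain ⟨j, ⟨hji, hjy⟩, hmax⟩ := exists_max_image {k | k ≠ i ∧ D.g k y = 0}
      (fun k => ⟪D.n k, D.n i⟫ / ⟪D.n k, e⟫) (toFinite _) ⟨k₀, hk₀, hk₀y⟩
    set μ := ⟪D.n j, D.n i⟫ / ⟪D.n j, e⟫ with hμ
    set w := -D.n i + μ • e with hw
    have hwi : ⟪D.n i, w⟫ = -1 := by
      rw [hw, inner_add_right, inner_neg_right, inner_smul_right, hie, real_inner_self_eq_norm_sq,
        D.norm_n]
      ring
    have hwj : ⟪D.n j, w⟫ = 0 := by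
      rw [hw, inner_add_right, inner_neg_right, inner_smul_right, hμ,
        div_mul_cancel₀ _ (hke j hji hjy).ne]
      ring
    have hwk : ∀ k, D.g k y = 0 → ⟪D.n k, w⟫ ≤ 0 := by
      intro k hky
      by_cases hki : k = i
      · rw [hki, hwi]; norm_num
      have h1 : ⟪D.n k, D.n i⟫ / ⟪D.n k, e⟫ ≤ μ := hmax k ⟨hki, hky⟩
      rw [div_le_iff_of_neg (hke k hki hky)] at h1
      rw [hw, inner_add_right, inner_neg_right, inner_smul_right]
      linarith
    have hij : i ≠ j := hji.symm
    have hcn := (inner_n_lt hij hyF.2 hjy).1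
    have hspan := fun l hl => hflat.mem_span (l := l) hij hyF.2 hjy hl
    have hcont : Tendsto (fun h : E => D.refl i j (y + h)) (𝓝 0) (𝓝 y) := by
      have hc : Continuous fun h : E => D.refl i j (y + h) := by
        unfold HalfspaceSystem.refl
        have h1 := continuous_g (D := D.toHalfspaceSystem) i
        have h2 := continuous_g (D := D.toHalfspaceSystem) j
        fun_prop
      have := hc.tendsto 0
      rwa [add_zero, refl_of_mem hyF.2 hjy] at this
    filter_upwards [hadd.eventually hloc, hcont.eventually hloc] with h h1 h2 hih
    by_cases hjh : ⟪D.n j, h⟫ ≤ 0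
    · refine hsame h hih (fun k hky => ?_) h1
      by_cases hki : k = i
      · rw [hki, hih]
      obtain ⟨a, b, hab⟩ := Submodule.mem_span_pair.1 (hspan k hky)
      have e1 : ⟪D.n k, e⟫ = b * ⟪D.n j, e⟫ := by
        rw [← hab, inner_add_left, real_inner_smul_left, real_inner_smul_left, hie]; ring
      have e2 : ⟪D.n k, h⟫ = b * ⟪D.n j, h⟫ := by
        rw [← hab, inner_add_left, real_inner_smul_left, real_inner_smul_left, hih]; ring
      have hb : 0 < b := by
        by_contra hcon
        push Not at hcon
        have := hke k hki hky
        have := hke j hji hjy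
        nlinarith
      rw [e2]
      exact mul_nonpos_of_nonneg_of_nonpos hb.le hjh
    -- Now y + h lies beyond the ridge in the hyperplane of facet i, and folding it back by the
    -- reflection gives the boundary point in facet j.
    · push Not at hjh
      obtain ⟨h3, h4, h5⟩ := h2
      set z := D.refl i j (y + h) with hz
      have hiz : D.g i z = -⟪D.n j, h⟫ := by
        rw [hz, g_refl_left hcn, g_add, hjy, zero_add]
      have hjz : D.g j z = 0 := by
        rw [hz, g_refl_right hcn, g_add, hyF.2, hih, add_zero, neg_zero]
      have hkz : ∀ k, D.g k y = 0 → D.g k z = ⟪D.n j, h⟫ * ⟪D.n k, w⟫ := by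
        intro k hky
        obtain ⟨a, b, hab⟩ := Submodule.mem_span_pair.1 (hspan k hky)
        have e1 : D.g k z = a * D.g i z + b * D.g j z := by
          have h6 := g_sub (D := D.toHalfspaceSystem) k z y
          rw [← hab, inner_add_left, real_inner_smul_left, real_inner_smul_left, ← g_sub, ← g_sub,
            hky, hyF.2, hjy] at h6
          linarith
        have e2 : ⟪D.n k, w⟫ = -a := by
          rw [← hab, inner_add_left, real_inner_smul_left, real_inner_smul_left, hwi, hwj]; ring
        rw [e1, hiz, hjz, e2]; ring
      have hzP : z ∈ D.P := by
        intro k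
        by_cases hky : D.g k y = 0
        · rw [hkz k hky]
          exact mul_nonpos_of_nonneg_of_nonpos hjh.le (hwk k hky)
        · exact (h3 k hky).le
      have hzS : z ∈ D.S := ⟨hzP, j, hjz⟩
      refine ⟨z, hzS, ?_, ?_, fun x hx => ?_⟩
      · obtain ⟨⟨i', ω'⟩, hi'⟩ := T_nonempty hzS h4
        have hi'' := mem_T_iff.1 hi'
        rcases h5 i' ω' hi' with ⟨rfl, rfl⟩ | ⟨hne, hω', -, hi'y⟩
        · have := hi''.1.2
          rw [hiz] at this
          linarith
        · have e1 := hkz i' hi'y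
          rw [hi''.1.2] at e1
          have e2 : ⟪D.n i', w⟫ = 0 := by
            rcases mul_eq_zero.1 e1.symm with h | h
            · exact absurd h hjh.ne'
            · exact h
          -- The image seen from z might sit in another facet i'; vanishing on w makes n i' parallel
          -- to n j, so i' = j.
          obtain ⟨a, b, hab⟩ := Submodule.mem_span_pair.1 (hspan i' hi'y)
          rw [← hab, inner_add_left, real_inner_smul_left, real_inner_smul_left, hwi, hwj] at e2
          have ha : a = 0 := by linarith
          rw [ha, zero_smul, zero_add] at hab
          obtain rfl := eq_of_mem_span_singleton hjy hi'y hab.symm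
          rw [← hi''.2.2.2.1, hω', hz, norm_refl_sub hcn]
      · rw [hz, HalfspaceSystem.refl, sub_sub_cancel_left]
        exact Submodule.neg_mem _ (Submodule.smul_mem _ _
          (Submodule.add_mem _ (n_mem_N hyF.2) (n_mem_N hjy)))
      · rw [norm_sub_rev, hz, norm_refl_sub_of_mem hcn (hx i hyF.2) (hx j hjy), norm_sub_rev]
  · push Not at hex
    filter_upwards [hadd.eventually hloc] with h h1 hih
    refine hsame h hih (fun k hky => ?_) h1
    have : k = i := by
      by_contra hcon
      exact hex k hcon hky
    rw [this, hih]

end SourcedSystem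

/-! ### Minima of linear functionals on spheres, and normal spaces. -/

section Spheres

variable {E : Type*} [NormedAddCommGroup E] [InnerProductSpace ℝ E] [FiniteDimensional ℝ E]

theorem exists_orthogonal_of_finrank_lt {N K : Submodule ℝ E}
    (h : Module.finrank ℝ K < Module.finrank ℝ N) :
    ∃ u ∈ N, u ≠ 0 ∧ ∀ z ∈ K, ⟪z, u⟫ = 0 := by
  have hker := LinearMap.ker_ne_bot_of_finrank_lt
    (f := (K.orthogonalProjectionOnto : E →ₗ[ℝ] K) ∘ₗ N.subtype) h
  obtain ⟨⟨u, hu⟩, hk, hne⟩ := Submodule.exists_mem_ne_zero_of_ne_bot hker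
  refine ⟨u, hu, fun h0 => hne (Subtype.ext h0), fun z hz => ?_⟩
  have h1 : K.orthogonalProjectionOnto u = 0 := hk
  have h2 : u ∈ Kᗮ := Submodule.orthogonalProjectionOnto_eq_zero_iff.1 h1
  exact (K.mem_orthogonal u).1 h2 z hz

open Classical in
/-- The first and second order conditions for a linear functional that attains a local minimum on a
sphere. -/
theorem inner_eq_mul_of_sphere_min {N : Submodule ℝ E} (hN : 3 ≤ Module.finrank ℝ N) {n a o : E}
    (hn : n ∈ N) (hn1 : ‖n‖ = 1) (ha : a ∈ N) (ha0 : a ≠ 0) (hna : ⟪n, a⟫ = 0) (hno : ⟪n, o⟫ = 0)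
    (hloc : ∀ᶠ h in 𝓝 (0 : E), h ∈ N → ⟪n, h⟫ = 0 → ‖a + h‖ = ‖a‖ → 0 ≤ ⟪h, o⟫) :
    ∃ c ≤ (0 : ℝ), ∀ z ∈ N, ⟪z, o⟫ = c * ⟪z, a⟫ := by
  have key : ∀ u ∈ N, ⟪n, u⟫ = 0 → ⟪a, u⟫ = 0 → ‖u‖ = ‖a‖ → ⟪u, o⟫ = 0 ∧ ⟪a, o⟫ ≤ 0 := by
    intro u hu hnu hau hua
    -- The test curve is the great circle through a in the direction u; its derivative at 0 gives
    -- the first order condition, and cos t < 1 gives the sign.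
    have hc : Tendsto (fun t : ℝ => (Real.cos t - 1) • a + Real.sin t • u) (𝓝 0) (𝓝 0) := by
      have : Continuous fun t : ℝ => (Real.cos t - 1) • a + Real.sin t • u := by fun_prop
      have h0 := this.tendsto 0
      simpa using h0
    have hev : ∀ᶠ t : ℝ in 𝓝 0, 0 ≤ (Real.cos t - 1) * ⟪a, o⟫ + Real.sin t * ⟪u, o⟫ := by
      filter_upwards [hc.eventually hloc] with t ht
      have h1 := ht (N.add_mem (N.smul_mem _ ha) (N.smul_mem _ hu))
        (by rw [inner_add_right, inner_smul_right, inner_smul_right, hna, hnu]; ring) ?_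
      · rwa [inner_add_left, real_inner_smul_left, real_inner_smul_left] at h1
      · have e : a + ((Real.cos t - 1) • a + Real.sin t • u) = Real.cos t • a + Real.sin t • u := by
          rw [sub_smul, one_smul]; abel
        rw [e, ← sq_eq_sq₀ (norm_nonneg _) (norm_nonneg _), norm_add_sq_real, norm_smul, norm_smul,
          mul_pow, mul_pow, hua, inner_smul_left, inner_smul_right, hau]
        simp only [Real.norm_eq_abs, sq_abs]
        have := Real.sin_sq_add_cos_sq t
        linear_combination ‖a‖ ^ 2 * this
    have hd : HasDerivAt (fun t : ℝ => (Real.cos t - 1) * ⟪a, o⟫ + Real.sin t * ⟪u, o⟫)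
        (-Real.sin 0 * ⟪a, o⟫ + Real.cos 0 * ⟪u, o⟫) 0 :=
      (((Real.hasDerivAt_cos 0).sub_const 1).mul_const _).add
        ((Real.hasDerivAt_sin 0).mul_const _)
    have hmin : IsLocalMin (fun t : ℝ => (Real.cos t - 1) * ⟪a, o⟫ + Real.sin t * ⟪u, o⟫) 0 := by
      filter_upwards [hev] with t ht
      simpa using ht
    have h0 := hmin.hasDerivAt_eq_zero hd
    rw [Real.sin_zero, Real.cos_zero] at h0
    have h1 : ⟪u, o⟫ = 0 := by linarith
    refine ⟨h1, ?_⟩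
    have hpos : ∀ᶠ t : ℝ in 𝓝[>] 0, 0 < t := self_mem_nhdsWithin
    obtain ⟨t, ht, ht0, ht1⟩ := ((hev.filter_mono (nhdsWithin_le_nhds (s := Ioi 0))).and
      (hpos.and ((eventually_lt_nhds one_pos).filter_mono nhdsWithin_le_nhds))).exists
    rw [h1, mul_zero, add_zero] at ht
    have h2 : Real.cos t < 1 := by
      rw [← Real.cos_zero]
      exact Real.cos_lt_cos_of_nonneg_of_le_pi le_rfl (by linarith [Real.pi_gt_three]) ht0
    by_contra hcon
    push Not at hcon
    nlinarith
  have hapos : 0 < ‖a‖ := norm_pos_iff.2 ha0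
  have key2 : ∀ u ∈ N, u ≠ 0 → ⟪n, u⟫ = 0 → ⟪a, u⟫ = 0 → ⟪u, o⟫ = 0 ∧ ⟪a, o⟫ ≤ 0 := by
    intro u hu hu0 hnu hau
    have hupos : 0 < ‖u‖ := norm_pos_iff.2 hu0
    obtain ⟨h1, h2⟩ := key ((‖a‖ / ‖u‖) • u) (N.smul_mem _ hu)
      (by rw [inner_smul_right, hnu, mul_zero]) (by rw [inner_smul_right, hau, mul_zero])
      (by rw [norm_smul, norm_div, norm_norm, norm_norm, div_mul_cancel₀ _ hupos.ne'])
    rw [real_inner_smul_left] at h1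
    exact ⟨(mul_eq_zero.1 h1).resolve_left (by positivity), h2⟩
  refine ⟨⟪a, o⟫ / ‖a‖ ^ 2, ?_, fun z hz => ?_⟩
  -- The sign of c needs a direction in N orthogonal to both n and a; here dimension at least three,
  -- that is, warpedness, enters.
  · have hK : Module.finrank ℝ (Submodule.span ℝ {n, a}) < Module.finrank ℝ N := by
      have h1 := finrank_span_finset_le_card (R := ℝ) (M := E) (Multiset.toFinset {n, a})
      have h2 : (Multiset.toFinset {n, a}).card ≤ 2 := Multiset.toFinset_card_le _
      rw [show ((Multiset.toFinset {n, a} : Finset E) : Set E) = {n, a} by ext; simp] at h1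
      exact (h1.trans h2).trans_lt hN
    obtain ⟨u, hu, hu0, hperp⟩ := exists_orthogonal_of_finrank_lt hK
    have := (key2 u hu hu0 (hperp n (Submodule.subset_span (by simp)))
      (hperp a (Submodule.subset_span (by simp)))).2
    exact div_nonpos_of_nonpos_of_nonneg this (by positivity)
  · set u := z - ⟪n, z⟫ • n - (⟪a, z⟫ / ‖a‖ ^ 2) • a with hu
    have huN : u ∈ N := N.sub_mem (N.sub_mem hz (N.smul_mem _ hn)) (N.smul_mem _ ha)
    have h1 : ⟪n, u⟫ = 0 := by
      rw [hu, inner_sub_right, inner_sub_right, inner_smul_right, inner_smul_right, hna,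
        real_inner_self_eq_norm_sq, hn1]
      ring
    have h2 : ⟪a, u⟫ = 0 := by
      rw [hu, inner_sub_right, inner_sub_right, inner_smul_right, inner_smul_right,
        real_inner_comm n a, hna, real_inner_self_eq_norm_sq]
      field_simp
      ring
    have h3 : ⟪u, o⟫ = 0 := by
      by_cases hu0 : u = 0
      · rw [hu0, inner_zero_left]
      · exact (key2 u huN hu0 h1 h2).1
    have h4 : ⟪u, o⟫ = ⟪z, o⟫ - ⟪n, z⟫ * ⟪n, o⟫ - ⟪a, z⟫ / ‖a‖ ^ 2 * ⟪a, o⟫ := by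
      rw [hu, inner_sub_left, inner_sub_left, real_inner_smul_left, real_inner_smul_left]
    rw [h3, hno] at h4
    rw [real_inner_comm a z]
    have : ⟪z, o⟫ = ⟪a, z⟫ / ‖a‖ ^ 2 * ⟪a, o⟫ := by linarith
    rw [this]
    ring

end Spheres

namespace HalfspaceSystem

variable {E : Type*} [NormedAddCommGroup E] [InnerProductSpace ℝ E] [FiniteDimensional ℝ E]
variable {ι : Type*} [Finite ι] {D : HalfspaceSystem E ι}

theorem N_mono {x y : E} (h : ∀ k, D.g k y = 0 → D.g k x = 0) : D.N y ≤ D.N x :=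
  Submodule.span_mono (image_mono h)

/-- The vector y - x is orthogonal to `D.N y` but is a nonzero element of `D.N x`. -/
theorem N_lt {x y : E} (h : ∀ k, D.g k y = 0 → D.g k x = 0) (hN : y - x ∈ D.N x) (hne : y ≠ x) :
    D.N y < D.N x := by
  refine lt_of_le_of_ne (N_mono h) fun heq => hne ?_
  have h1 : ∀ z ∈ D.N y, ⟪z, y - x⟫ = 0 := by
    intro z hz
    induction hz using Submodule.span_induction with
    | mem z hz =>
      obtain ⟨k, hk, rfl⟩ := hz
      rw [← g_sub, h k hk, show D.g k y = 0 from hk, sub_zero]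
    | zero => exact inner_zero_left _
    | add a b _ _ ha hb => rw [inner_add_left, ha, hb, add_zero]
    | smul c a _ ha => rw [real_inner_smul_left, ha, mul_zero]
  exact sub_eq_zero.1 (inner_self_eq_zero.1 (h1 _ (heq ▸ hN)))

end HalfspaceSystem

/-! ### Warped points are limits of cut points. -/

namespace SourcedSystem

open HalfspaceSystem

variable {E : Type*} [NormedAddCommGroup E] [InnerProductSpace ℝ E] [FiniteDimensional ℝ E]
variable {ι : Type*} [Finite ι] {D : SourcedSystem E ι}

theorem not_isFlat_ne_v {x : E} (hx : ¬D.IsFlat x) : x ≠ D.v := by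
  rintro rfl
  exact hx (isFlat_of_unique fun k hk => (D.hact k).1 hk)

/-- A shortest path does not pass through a warped point. -/
theorem isFlat_of_desc {p x : E} {i : ι} (hd : D.Desc p i x) (hxv : x ≠ D.v) : D.IsFlat x := by
  obtain ⟨r, hr, hex⟩ := exists_desc (F_subset_S i hd.2.1) hxv
  obtain ⟨j, m, hm, -⟩ := hex (r / 2) (by linarith) (by linarith)
  rcases corner_image hd.1 hd.2.2.1.symm hd.2.1 (by rw [hd.2.2.2, norm_sub_rev]) hm with
    ⟨-, -, h⟩ | ⟨hij, -, h, -⟩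
  · exact isFlat_of_unique fun k hk => eq_of_mem_Fo h hk
  · exact isFlat_of_mem_span hij hd.2.1.2 hm.1.2 h

/-- The distance from the image of the source seen at `y` computes `rho` on segments from `y` that
avoid cut points. -/
theorem rho_eq_of_segment {y q : E} {i : ι} {ω : E} (hi : (i, ω) ∈ D.T y) (hq : q ∈ D.F i)
    (hact : ∀ k, D.g k y = 0 → D.g k q = 0) (hgood : ∀ s : ℝ, 0 ≤ s → s < 1 →
      y + s • (q - y) ∈ D.S → D.N (y + s • (q - y)) = D.N y →
      y + s • (q - y) ≠ D.v ∧ D.IsFlat (y + s • (q - y)) ∧ (D.T (y + s • (q - y))).Subsingleton) :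
    D.rho q = ‖q - ω‖ := by
  obtain ⟨hyF, hyv, hgω, hr, hle, hneg⟩ := mem_T_iff.1 hi
  set c : ℝ → E := fun s => y + s • (q - y) with hc
  have hcont : Continuous c := by fun_prop
  have hF : ∀ s, 0 ≤ s → s ≤ 1 → c s ∈ D.F i := fun s h0 h1 => F_combo hyF hq h0 h1
  have hiff : ∀ s, 0 ≤ s → s < 1 → ∀ k, D.g k (c s) = 0 ↔ D.g k y = 0 := by
    intro s h0 h1 k
    rw [hc, g_combo]
    constructor
    · intro h
      have h2 := hyF.1 k
      have h3 := hq.1 k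
      have h4 : (1 - s) * D.g k y ≤ 0 := mul_nonpos_of_nonneg_of_nonpos (by linarith) h2
      have h5 : s * D.g k q ≤ 0 := mul_nonpos_of_nonneg_of_nonpos h0 h3
      have h6 : (1 - s) * D.g k y = 0 := by linarith
      exact (mul_eq_zero.1 h6).resolve_left (by linarith)
    · intro h
      rw [h, hact k h]
      ring
  have hN : ∀ s, 0 ≤ s → s < 1 → D.N (c s) = D.N y := fun s h0 h1 =>
    (N_mono fun k => (hiff s h0 h1 k).1).antisymm (N_mono fun k => (hiff s h0 h1 k).2)
  have hg : ∀ s, 0 ≤ s → s < 1 → c s ≠ D.v ∧ D.IsFlat (c s) ∧ (D.T (c s)).Subsingleton :=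
    fun s h0 h1 => hgood s h0 h1 (F_subset_S i (hF s h0 h1.le)) (hN s h0 h1)
  have hT : ∀ s, 0 ≤ s → s < 1 → D.T (c s) = D.T y := by
    intro s h0 h1
    have hA : IsPreconnected (c '' Ico 0 1) := isPreconnected_Ico.image c hcont.continuousOn
    have h0' : c 0 = y := by simp [hc]
    refine T_eq_of_isPreconnected hA ?_ ?_ ?_ ?_ ?_ ⟨s, ⟨h0, h1⟩, rfl⟩
      ⟨0, ⟨le_rfl, one_pos⟩, h0'⟩
    · rintro _ ⟨t, ht, rfl⟩
      exact F_subset_S i (hF t ht.1 ht.2.le)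
    · rintro ⟨t, ht, h⟩
      exact (hg t ht.1 ht.2).1 h
    · rintro _ ⟨t, ht, rfl⟩
      exact (hg t ht.1 ht.2).2.1
    · rintro _ ⟨t, ht, rfl⟩
      exact (hg t ht.1 ht.2).2.2
    · rintro _ ⟨t, ht, rfl⟩ _ ⟨t', ht', rfl⟩ k hk
      exact (hiff t' ht'.1 ht'.2 k).2 ((hiff t ht.1 ht.2 k).1 hk)
  -- The images are constant on the half-open segment; continuity extends the equality to q, where
  -- the active constraints may differ.
  have hcl : IsClosed {z | z ∈ D.F i ∧ D.rho z - ‖z - ω‖ = 0} := by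
    have h1 : ContinuousOn (fun z => D.rho z - ‖z - ω‖) (D.F i) :=
      (continuousOn_rho.mono (F_subset_S i)).sub (by fun_prop)
    exact h1.preimage_isClosed_of_isClosed (isClosed_F i) isClosed_singleton
  have hsub : Icc (0 : ℝ) 1 ⊆ c ⁻¹' {z | z ∈ D.F i ∧ D.rho z - ‖z - ω‖ = 0} := by
    rw [← closure_Ico (zero_ne_one' ℝ)]
    refine (hcl.preimage hcont).closure_subset_iff.2 fun s hs => ?_
    have h1 : (i, ω) ∈ D.T (c s) := (hT s hs.1 hs.2).symm ▸ hi
    exact ⟨hF s hs.1 hs.2.le, by rw [(mem_T_iff.1 h1).2.2.2.1, sub_self]⟩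
  have h1 := (hsub (right_mem_Icc.2 zero_le_one)).2
  have h2 : c 1 = q := by simp [hc]
  rw [h2] at h1
  linarith

/-- If every nearby point of smaller rank were flat and not a cut point, the farthest point from the
source in the link of x would lie opposite to the source image, and a shortest path would run
through the warped point x. -/
theorem exists_bad_near_warped {x : E} (hx : x ∈ D.S) (hnf : ¬D.IsFlat x) {r : ℝ} (hr : 0 < r) :
    ∃ y ∈ D.S, ‖y - x‖ < r ∧ Module.finrank ℝ (D.N y) < Module.finrank ℝ (D.N x) ∧
      ¬(D.IsFlat y ∧ (D.T y).Subsingleton) := by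
  by_contra! hgood
  have hxv := not_isFlat_ne_v hnf
  have h3 : 3 ≤ Module.finrank ℝ (D.N x) := by
    unfold IsFlat at hnf
    omega
  obtain ⟨r', hr', hball⟩ := Metric.eventually_nhds_iff.1
    ((eventually_lt x hx.1).and (eventually_ne_nhds hxv))
  have hball' : ∀ z, ‖z - x‖ < r' → (∀ k, D.g k x ≠ 0 → D.g k z < 0) ∧ z ≠ D.v := fun z hz =>
    hball (by rwa [dist_eq_norm])
  obtain ⟨ε, hε, hεr⟩ := exists_between (lt_min hr hr')
  have hεr1 := hεr.trans_le (min_le_left _ _)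
  have hεr2 := hεr.trans_le (min_le_right _ _)
  have hactx : ∀ z, ‖z - x‖ < r' → ∀ k, D.g k z = 0 → D.g k x = 0 := by
    intro z hz k hk
    by_contra hcon
    exact ((hball' z hz).1 k hcon).ne hk
  -- The link of x: a small sphere in the boundary, restricted to the normal space of the face of x.
  set M : Set E := D.S ∩ {y | y - x ∈ D.N x} ∩ {y | ‖y - x‖ = ε} with hM
  have hMc : IsCompact M := by
    refine (isCompact_closedBall x ε).of_isClosed_subset ?_ ?_
    · refine (isClosed_S.inter ?_).inter (isClosed_eq (by fun_prop) continuous_const)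
      exact (Submodule.closed_of_finiteDimensional (D.N x)).preimage (by fun_prop :
        Continuous fun y : E => y - x)
    · rintro y ⟨-, hy⟩
      rw [Metric.mem_closedBall, dist_eq_norm]
      exact le_of_eq hy
  obtain ⟨⟨i₁, ω₁⟩, m₁, hd₁, -⟩ := T_nonempty hx hxv
  -- An initial segment from x is projected to the normal space. Were the projection zero, all
  -- active constraints would vanish along the segment, so only one could be active.
  have hMne : M.Nonempty := by
    simp only at hd₁
    set e := (D.N x).starProjection (m₁ - x) with he
    have heN : e ∈ D.N x := (D.N x).starProjection_apply_mem _
    have hek : ∀ k, D.g k x = 0 → ⟪D.n k, e⟫ = D.g k m₁ := by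
      intro k hk
      have h1 := (D.N x).starProjection_inner_eq_zero (m₁ - x) _ (n_mem_N hk)
      rw [inner_sub_left, real_inner_comm, real_inner_comm (D.n k)] at h1
      have h2 := g_sub (D := D.toHalfspaceSystem) k m₁ x
      rw [hk] at h2
      linarith
    have he0 : e ≠ 0 := by
      intro h0
      refine hnf (isFlat_of_unique (i := i₁) fun k hk => ?_)
      by_contra hne
      have h1 := hd₁.inner_neg hk hne
      have h2 := hek k hk
      rw [h0, inner_zero_right] at h2
      have h3 := g_sub (D := D.toHalfspaceSystem) k m₁ x
      rw [hk, ← h2, ← norm_smul_udir x m₁, inner_smul_right] at h3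
      have h4 : 0 < ‖m₁ - x‖ := norm_pos_iff.2 (sub_ne_zero.2 hd₁.2.2.1)
      nlinarith
    have hepos : 0 < ‖e‖ := norm_pos_iff.2 he0
    have hyn : ‖x + (ε / ‖e‖) • e - x‖ = ε := by
      rw [add_sub_cancel_left, norm_smul, norm_div, norm_norm, Real.norm_of_nonneg hε.le,
        div_mul_cancel₀ _ hepos.ne']
    refine ⟨x + (ε / ‖e‖) • e, ⟨⟨⟨fun k => ?_, i₁, ?_⟩, ?_⟩, hyn⟩⟩
    · by_cases hk : D.g k x = 0
      · rw [g_add_smul, hk, hek k hk, zero_add]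
        exact mul_nonpos_of_nonneg_of_nonpos (by positivity) (hd₁.2.1.1 k)
      · exact ((hball' _ (hyn.trans_lt hεr2)).1 k hk).le
    · rw [g_add_smul, hd₁.1.2, hek _ hd₁.1.2, hd₁.2.1.2]
      ring
    · change x + (ε / ‖e‖) • e - x ∈ D.N x
      rw [add_sub_cancel_left]
      exact Submodule.smul_mem _ _ heN
  obtain ⟨y, ⟨⟨hyS, hyN⟩, hyε⟩, hmax⟩ := hMc.exists_isMaxOn hMne
    (continuousOn_rho.mono fun z hz => hz.1.1)
  have hyN' : y - x ∈ D.N x := hyN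
  have hyε' : ‖y - x‖ = ε := hyε
  have hyact := hactx y (by rw [hyε']; exact hεr2)
  have hne : y ≠ x := by
    intro h
    rw [h, sub_self, norm_zero] at hyε'
    exact hε.ne hyε'
  have hyN_lt : Module.finrank ℝ (D.N y) < Module.finrank ℝ (D.N x) :=
    Submodule.finrank_lt_finrank_of_lt (N_lt hyact hyN' hne)
  obtain ⟨hyflat, hyT⟩ := hgood y hyS (by rw [hyε']; exact hεr1) hyN_lt
  have hyv : y ≠ D.v := (hball' y (by rw [hyε']; exact hεr2)).2
  obtain ⟨⟨i, ω⟩, hi⟩ := T_nonempty hyS hyv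
  obtain ⟨hyF, -, hgω, hrω, hle, hneg⟩ := mem_T_iff.1 hi
  have hix : D.g i x = 0 := hyact i hyF.2
  have hnN : D.n i ∈ D.N x := n_mem_N hix
  set a := y - x with ha
  set o := ω - x with ho
  have hna : ⟪D.n i, a⟫ = 0 := by rw [ha, ← g_sub, hyF.2, hix, sub_zero]
  have hno : ⟪D.n i, o⟫ = 0 := by rw [ho, ← g_sub, hgω, hix, sub_zero]
  -- In the unfolded chart at y, maximality of `rho` on the link says ‖a + h - o‖ ≤ ‖a - o‖ for
  -- small moves on the sphere, that is, 0 ≤ ⟪h, o⟫.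
  obtain ⟨c, hc, hco⟩ := inner_eq_mul_of_sphere_min h3 hnN (D.norm_n i) hyN'
    (sub_ne_zero.2 hne) hna hno (by
      filter_upwards [eventually_chart hyS hyflat hyT hi] with h hch hhN hih hnorm
      obtain ⟨z, hzS, hzr, hzN, hzx⟩ := hch hih
      have hzM : z ∈ M := by
        refine ⟨⟨hzS, ?_⟩, ?_⟩
        · change z - x ∈ D.N x
          have e : z - x = (z - (y + h)) + (a + h) := by rw [ha]; abel
          rw [e]
          exact Submodule.add_mem _ (N_mono hyact hzN) (Submodule.add_mem _ hyN' hhN)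
        · change ‖z - x‖ = ε
          rw [hzx x hyact, show y + h - x = a + h by rw [ha]; abel, hnorm, hyε']
      have h1 : D.rho z ≤ D.rho y := hmax hzM
      rw [hzr, ← hrω, show y + h - ω = (a + h) - o by rw [ha, ho]; abel,
        show y - ω = a - o by rw [ha, ho]; abel] at h1
      have h2 := pow_le_pow_left₀ (norm_nonneg _) h1 2
      rw [norm_sub_sq_real (a + h) o, norm_sub_sq_real a o, hnorm, inner_add_left] at h2
      linarith)
  have hxF : x ∈ D.F i := ⟨hx.1, hix⟩
  have hrq : ∀ q ∈ D.F i, (∀ k, D.g k y = 0 → D.g k q = 0) → ‖q - x‖ < ε →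
      D.rho q = ‖q - ω‖ := by
    intro q hq hqact hqε
    refine rho_eq_of_segment hi hq hqact fun s h0 h1 hS hN => ?_
    have hn : ‖y + s • (q - y) - x‖ ≤ ε := by
      have e : y + s • (q - y) - x = (1 - s) • (y - x) + s • (q - x) := by
        simp only [sub_smul, smul_sub, one_smul]; abel
      rw [e]
      refine (norm_add_le _ _).trans ?_
      rw [norm_smul, norm_smul, Real.norm_of_nonneg h0, Real.norm_of_nonneg (by linarith), ← ha,
        hyε']
      nlinarith
    exact ⟨(hball' _ (hn.trans_lt hεr2)).2, hgood _ hS (hn.trans_lt hεr1) (by rw [hN]; exact hyN_lt)⟩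
  have hrx := hrq x hxF hyact (by rw [sub_self, norm_zero]; exact hε)
  have hxpos := D.rho_pos hx hxv
  have hon : ‖o‖ = D.rho x := by rw [hrx, ho, norm_sub_rev]
  obtain ⟨t, ht0, htε⟩ := exists_between (div_pos hε hxpos)
  rw [lt_div_iff₀ hxpos] at htε
  -- The point behind x as seen from ω. In the normal space -o is a nonnegative multiple of y - x,
  -- so p satisfies the constraints near x and keeps those active at y.
  set p := x - t • o with hp
  have hpx : ‖p - x‖ = t * D.rho x := by
    rw [hp, sub_sub_cancel_left, norm_neg, norm_smul, Real.norm_of_nonneg ht0.le, hon]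
  have hgp : ∀ k, D.g k x = 0 → D.g k p = -(t * c) * D.g k y := by
    intro k hk
    have h1 := g_sub (D := D.toHalfspaceSystem) k p x
    have h2 := g_sub (D := D.toHalfspaceSystem) k y x
    rw [hk, sub_zero] at h1 h2
    rw [h1, h2, hp, sub_sub_cancel_left, inner_neg_right, inner_smul_right, hco _ (n_mem_N hk)]
    ring
  have hpF : p ∈ D.F i := by
    refine ⟨fun k => ?_, by rw [hgp i hix, hyF.2, mul_zero]⟩
    by_cases hk : D.g k x = 0
    · rw [hgp k hk]
      refine mul_nonpos_of_nonneg_of_nonpos ?_ (hyF.1 k)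
      rw [neg_nonneg]
      exact mul_nonpos_of_nonneg_of_nonpos ht0.le hc
    · exact ((hball' p (by rw [hpx]; exact htε.trans hεr2)).1 k hk).le
  have hrp := hrq p hpF (fun k hk => by rw [hgp k (hyact k hk), hk, mul_zero])
    (by rw [hpx]; exact htε)
  have hpω : ‖p - ω‖ = (1 + t) * D.rho x := by
    have e : p - ω = -((1 + t) • o) := by rw [hp, ho, add_smul, one_smul]; abel
    rw [e, norm_neg, norm_smul, Real.norm_of_nonneg (by linarith), hon]
  have hd : D.Desc p i x := by
    refine ⟨hpF, hxF, ?_, ?_⟩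
    · intro h
      rw [← h, sub_self, norm_zero] at hpx
      have : 0 < t * D.rho x := by positivity
      linarith
    · rw [hrp, hpω, norm_sub_rev, hpx]
      ring
  exact hnf (isFlat_of_desc hd hxv)

/-- Warped points are limits of flat cut points. -/
theorem warped_mem_closure {x : E} (hx : x ∈ D.S) (hnf : ¬D.IsFlat x) :
    x ∈ closure {y | y ∈ D.S ∧ D.IsFlat y ∧ ¬(D.T y).Subsingleton} := by
  obtain ⟨n, hn⟩ : ∃ n, Module.finrank ℝ (D.N x) ≤ n := ⟨_, le_rfl⟩
  induction n generalizing x with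
  | zero =>
    unfold IsFlat at hnf
    omega
  | succ n ih =>
    rw [← closure_closure, Metric.mem_closure_iff]
    intro r hr
    obtain ⟨y, hyS, hyr, hyN, hy⟩ := exists_bad_near_warped hx hnf hr
    refine ⟨y, ?_, by rwa [dist_comm, dist_eq_norm]⟩
    by_cases hyf : D.IsFlat y
    · exact subset_closure ⟨hyS, hyf, fun h => hy ⟨hyf, h⟩⟩
    · exact ih hyS hyf (by omega)

theorem cutLocus_eq_closure :
    cutLocus D.P D.v = closure {y | y ∈ D.S ∧ ¬(D.T y).Subsingleton} := by
  rw [cutLocus]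
  congr 1
  ext x
  exact mem_cutPoints_iff

/-- A flat point that is not a cut point has a neighbourhood without cut points; warped points are
limits of cut points. -/
theorem cutLocus_eq :
    cutLocus D.P D.v = cutPoints D.P D.v ∪ {x | x ∈ D.S ∧ ¬D.IsFlat x} := by
  apply Subset.antisymm
  · intro x hx
    have hxS : x ∈ D.S := by
      rw [cutLocus_eq_closure] at hx
      exact closure_minimal (fun _ h => h.1) isClosed_S hx
    by_cases hf : D.IsFlat x
    · left
      rw [mem_cutPoints_iff]
      refine ⟨hxS, fun hT => ?_⟩
      rw [cutLocus_eq_closure] at hx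
      obtain ⟨y, hy, hyK⟩ := ((mem_closure_iff_frequently.1 hx).and_eventually
        (eventually_T_subsingleton hxS hf hT)).exists
      exact hy.2 hyK
    · exact Or.inr ⟨hxS, hf⟩
  · rintro x (hx | ⟨hxS, hnf⟩)
    · exact subset_closure hx
    · rw [cutLocus_eq_closure]
      refine closure_mono ?_ (warped_mem_closure hxS hnf)
      rintro y ⟨hy, -, hyT⟩
      exact ⟨hy, hyT⟩

end SourcedSystem

/-! ### Nonemptiness of the cut locus. -/

namespace HalfspaceSystem

variable {E : Type*} [NormedAddCommGroup E] [InnerProductSpace ℝ E] [FiniteDimensional ℝ E]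
variable {ι : Type*} [Finite ι] {D : HalfspaceSystem E ι}

/-- Some boundary point has active normals that span all normals. -/
theorem exists_forall_n_mem_N (hS : D.S.Nonempty) : ∃ y ∈ D.S, ∀ l, D.n l ∈ D.N y := by
  have hfin : ((fun y => Module.finrank ℝ (D.N y)) '' D.S).Finite :=
    (finite_Iic (Module.finrank ℝ E)).subset (by
      rintro _ ⟨y, -, rfl⟩
      exact Submodule.finrank_le _)
  obtain ⟨_, ⟨y, hy, rfl⟩, hmax⟩ := exists_max_image _ id hfin (hS.image _)
  refine ⟨y, hy, fun l => ?_⟩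
  by_contra hl
  -- From a point of maximal rank, moving orthogonally to the active normals until the first new
  -- constraint is met would increase the rank.
  obtain ⟨u, hu, hlu⟩ := exists_orthogonal_pos (D.N y) hl
  obtain ⟨k, hk, hmin⟩ := exists_min_image {k | 0 < ⟪D.n k, u⟫}
    (fun k => -D.g k y / ⟪D.n k, u⟫) (toFinite _) ⟨l, hlu⟩
  have hk' : 0 < ⟪D.n k, u⟫ := hk
  set t := -D.g k y / ⟪D.n k, u⟫ with ht
  have ht0 : 0 ≤ t := div_nonneg (neg_nonneg.2 (hy.1 k)) hk'.le
  have hkz : D.g k (y + t • u) = 0 := by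
    rw [g_add_smul, ht, div_mul_cancel₀ _ hk'.ne', add_neg_cancel]
  have hz : y + t • u ∈ D.S := by
    refine ⟨fun m => ?_, k, hkz⟩
    rw [g_add_smul]
    by_cases hm : 0 < ⟪D.n m, u⟫
    · have h1 : t ≤ -D.g m y / ⟪D.n m, u⟫ := hmin m hm
      rw [le_div_iff₀ hm] at h1
      linarith
    · push Not at hm
      have h1 := mul_nonpos_of_nonneg_of_nonpos ht0 hm
      have h2 := hy.1 m
      linarith
  have hlt : D.N y < D.N (y + t • u) := by
    refine lt_of_le_of_ne (N_mono fun m hm => ?_) fun heq => ?_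
    · rw [g_add_smul, hm, hu _ (n_mem_N hm)]
      ring
    · have h1 : D.n k ∈ D.N y := heq ▸ n_mem_N hkz
      exact hk'.ne' (hu _ h1)
  exact (hmax _ ⟨_, hz, rfl⟩).not_gt (Submodule.finrank_lt_finrank_of_lt hlt)

/-- Without such a direction the sum of the positive parts of ⟪n k, u⟫ is bounded below by some c >
0 on the unit sphere of N, which bounds the section. -/
theorem exists_recession {N : Submodule ℝ E} {p : E} (hp : p ∈ D.P)
    (h : ¬Bornology.IsBounded {x | x ∈ D.P ∧ x - p ∈ N}) :
    ∃ u ∈ N, u ≠ 0 ∧ ∀ k, ⟪D.n k, u⟫ ≤ 0 := by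
  by_contra! hcon
  apply h
  cases nonempty_fintype ι
  set f : E → ℝ := fun u => ∑ k, max 0 ⟪D.n k, u⟫ with hf
  have hfc : Continuous f := by fun_prop
  have hK : IsCompact ((N : Set E) ∩ Metric.sphere 0 1) :=
    (isCompact_sphere 0 1).inter_left (Submodule.closed_of_finiteDimensional N)
  obtain ⟨c, hc, hle⟩ := hK.exists_forall_le' hfc.continuousOn (a := 0) (by
    rintro u ⟨huN, hu⟩
    have hu0 : u ≠ 0 := by
      rintro rfl
      simp at hu
    obtain ⟨k, hk⟩ := hcon u huN hu0
    exact Finset.sum_pos' (fun _ _ => le_max_left _ _) ⟨k, Finset.mem_univ k, lt_max_of_lt_right hk⟩)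
  refine (Metric.isBounded_closedBall (x := p) (r := (∑ k, -D.g k p) / c)).subset ?_
  rintro x ⟨hx, hxN⟩
  rw [Metric.mem_closedBall, dist_eq_norm, le_div_iff₀ hc]
  set u := x - p with hu
  have h1 : f u ≤ ∑ k, -D.g k p := by
    refine Finset.sum_le_sum fun k _ => max_le (neg_nonneg.2 (hp k)) ?_
    rw [hu, ← g_sub]
    linarith [hx k]
  refine le_trans ?_ h1
  by_cases hu0 : u = 0
  · rw [hu0, norm_zero, zero_mul]
    exact Finset.sum_nonneg fun _ _ => le_max_left _ _
  have hpos : 0 < ‖u‖ := norm_pos_iff.2 hu0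
  have h2 := hle (‖u‖⁻¹ • u) ⟨N.smul_mem _ hxN, by
    rw [mem_sphere_zero_iff_norm, norm_smul, norm_inv, norm_norm, inv_mul_cancel₀ hpos.ne']⟩
  have h3 : f (‖u‖⁻¹ • u) = ‖u‖⁻¹ * f u := by
    rw [hf]
    simp only
    rw [Finset.mul_sum]
    refine Finset.sum_congr rfl fun k _ => ?_
    rw [inner_smul_right, mul_max_of_nonneg _ _ (by positivity), mul_zero]
  rw [h3, inv_mul_eq_div, le_div_iff₀ hpos] at h2
  linarith

theorem two_le_finrank_of_pair {i j : ι} (h1 : D.n i ≠ D.n j) (h2 : D.n i ≠ -D.n j)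
    {N : Submodule ℝ E} (hi : D.n i ∈ N) (hj : D.n j ∈ N) : 2 ≤ Module.finrank ℝ N := by
  have hne : ∀ k, D.n k ≠ 0 := fun k h => by
    have := D.norm_n k
    rw [h, norm_zero] at this
    exact zero_ne_one this
  have hli : LinearIndependent ℝ ![D.n i, D.n j] := by
    rw [LinearIndependent.pair_iff' (hne i)]
    intro a ha
    have h3 := congrArg norm ha
    rw [norm_smul, D.norm_n, D.norm_n, mul_one, Real.norm_eq_abs] at h3
    rcases (abs_eq zero_le_one).1 h3 with rfl | rfl
    · exact h1 (by rw [← ha, one_smul])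
    · exact h2 (by rw [← ha, neg_one_smul, neg_neg])
  have h3 := finrank_span_eq_card hli
  have h4 : Submodule.span ℝ (range ![D.n i, D.n j]) ≤ N := by
    rw [Submodule.span_le]
    rintro _ ⟨k, rfl⟩
    fin_cases k
    exacts [hi, hj]
  have h5 := Submodule.finrank_mono h4
  rw [h3] at h5
  simpa using h5

end HalfspaceSystem

namespace SourcedSystem

open HalfspaceSystem

variable {E : Type*} [NormedAddCommGroup E] [InnerProductSpace ℝ E] [FiniteDimensional ℝ E]
variable {ι : Type*} [Finite ι] {D : SourcedSystem E ι}

/-- With no warped points all normals span a plane N, and P is invariant under its orthogonal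
complement, of dimension d-1. If the planar section is unbounded, a recession direction completes
the half-flat; if it is bounded, a farthest point on its boundary leads to a contradiction. -/
theorem containsHalfFlat_of_cutLocus_eq_empty (hpair : ∃ i j, D.n i ≠ D.n j ∧ D.n i ≠ -D.n j)
    (hempty : cutLocus D.P D.v = ∅) {d : ℕ} (hd : Module.finrank ℝ E = d + 1) :
    ContainsHalfFlat D.P d := by
  have hflat : ∀ x ∈ D.S, D.IsFlat x := by
    intro x hx
    by_contra hf
    have : x ∈ cutLocus D.P D.v := by
      rw [cutLocus_eq]
      exact Or.inr ⟨hx, hf⟩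
    rw [hempty] at this
    exact this
  have hT : ∀ x ∈ D.S, (D.T x).Subsingleton := by
    intro x hx
    by_contra hf
    have : x ∈ cutLocus D.P D.v := subset_closure (mem_cutPoints_iff.2 ⟨hx, hf⟩)
    rw [hempty] at this
    exact this
  obtain ⟨y₀, hy₀, hall⟩ := exists_forall_n_mem_N ⟨D.v, D.v_mem_S⟩
  obtain ⟨i, j, h1, h2⟩ := hpair
  have hrank : Module.finrank ℝ (D.N y₀) = 2 :=
    le_antisymm (hflat y₀ hy₀) (two_le_finrank_of_pair h1 h2 (hall i) (hall j))
  set N := D.N y₀ with hN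
  have hNle : ∀ y, D.N y ≤ N := fun y => by
    rw [HalfspaceSystem.N, Submodule.span_le]
    rintro _ ⟨k, -, rfl⟩
    exact hall k
  by_cases hbdd : Bornology.IsBounded {x | x ∈ D.P ∧ x - D.v ∈ N}
  · exfalso
    set M := {x | x ∈ D.S ∧ x - D.v ∈ N} with hM
    have hMc : IsCompact M := by
      refine Metric.isCompact_of_isClosed_isBounded (isClosed_S.inter ?_)
        (hbdd.subset fun x hx => ⟨hx.1.1, hx.2⟩)
      exact (Submodule.closed_of_finiteDimensional N).preimage (by fun_prop :
        Continuous fun y : E => y - D.v)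
    have hvM : D.v ∈ M := ⟨v_mem_S, by rw [sub_self]; exact N.zero_mem⟩
    obtain ⟨y, hyM, hmax⟩ := hMc.exists_isMaxOn ⟨_, hvM⟩ (continuousOn_rho.mono fun z hz => hz.1)
    have hdir : ∀ k, ∃ u ∈ N, u ≠ 0 ∧ ⟪D.n k, u⟫ = 0 := by
      intro k
      obtain ⟨u, hu, hu0, hku⟩ := exists_orthogonal_of_finrank_lt (N := N)
        (K := Submodule.span ℝ {D.n k}) (by
          rw [hrank]
          have := finrank_span_finset_le_card (R := ℝ) ({D.n k} : Finset E)
          rw [Finset.coe_singleton, Finset.card_singleton] at this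
          change Module.finrank ℝ (Submodule.span ℝ {D.n k}) ≤ 1 at this
          omega)
      exact ⟨u, hu, hu0, hku _ (Submodule.mem_span_singleton_self _)⟩
    have hsmall : ∀ u : E, Tendsto (fun t : ℝ => t • u) (𝓝[>] 0) (𝓝 0) := by
      intro u
      have : Continuous fun t : ℝ => t • u := by fun_prop
      have h0 := this.tendsto 0
      rw [zero_smul] at h0
      exact h0.mono_left nhdsWithin_le_nhds
    have hpos : ∀ᶠ t : ℝ in 𝓝[>] 0, 0 < t := self_mem_nhdsWithin
    have hyv : y ≠ D.v := by
      rintro hyv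
      obtain ⟨u, hu, hu0, hku⟩ := hdir D.i₀
      have h3 : Tendsto (fun t : ℝ => D.v + t • u) (𝓝[>] 0) (𝓝 D.v) := by
        simpa using (hsmall u).const_add D.v
      obtain ⟨t, ht, ht0⟩ := ((h3.eventually (eventually_lt D.v D.hv)).and hpos).exists
      have hiz : D.g D.i₀ (D.v + t • u) = 0 := by
        rw [g_add_smul, v_mem_F.2, hku]
        ring
      have hzS : D.v + t • u ∈ D.S := by
        refine ⟨fun k => ?_, D.i₀, hiz⟩
        by_cases hk : D.g k D.v = 0
        · rw [(D.hact k).1 hk, hiz]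
        · exact (ht k hk).le
      have hle : D.rho (D.v + t • u) ≤ D.rho y :=
        hmax ⟨hzS, by rw [add_sub_cancel_left]; exact N.smul_mem _ hu⟩
      rw [hyv, rho_v] at hle
      have := D.rho_pos hzS (by simp [ht0.ne', hu0])
      linarith
    obtain ⟨⟨i, ω⟩, hi⟩ := T_nonempty hyM.1 hyv
    have hrω := (mem_T_iff.1 hi).2.2.2.1
    obtain ⟨u, hu, hu0, hiu⟩ := hdir i
    have hch := eventually_chart hyM.1 (hflat y hyM.1) (hT y hyM.1) hi
    obtain ⟨t, ⟨hp, hm⟩, ht0⟩ := (((hsmall u).eventually hch).and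
      ((by simpa using (hsmall u).neg : Tendsto (fun t : ℝ => -(t • u)) (𝓝[>] 0) (𝓝 0)).eventually
        hch) |>.and hpos).exists
    have hle : ∀ h ∈ N, (∃ z ∈ D.S, D.rho z = ‖y + h - ω‖ ∧ z - (y + h) ∈ D.N y ∧
        ∀ x, (∀ k, D.g k y = 0 → D.g k x = 0) → ‖z - x‖ = ‖y + h - x‖) →
        ‖y + h - ω‖ ≤ ‖y - ω‖ := by
      rintro h hh ⟨z, hz, hzr, hzN, -⟩
      rw [← hzr, hrω]
      refine hmax ⟨hz, ?_⟩
      have e : z - D.v = (z - (y + h)) + h + (y - D.v) := by abel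
      change z - D.v ∈ N
      rw [e]
      exact N.add_mem (N.add_mem (hNle y hzN) hh) hyM.2
    have e1 := hle _ (N.smul_mem t hu) (hp (by rw [inner_smul_right, hiu, mul_zero]))
    have e2 := hle _ (N.neg_mem (N.smul_mem t hu))
      (hm (by rw [inner_neg_right, inner_smul_right, hiu, mul_zero, neg_zero]))
    -- Moving from y both ways in the unfolding does not increase the distance to ω, whereas the
    -- parallelogram law makes the mean of the two squared distances strictly larger.
    have e3 := parallelogram_law_with_norm ℝ (y - ω) (t • u)
    rw [show y - ω + t • u = y + t • u - ω by abel,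
      show y - ω - t • u = y + -(t • u) - ω by abel] at e3
    have e4 : 0 < ‖t • u‖ := norm_pos_iff.2 (smul_ne_zero ht0.ne' hu0)
    have e5 := norm_nonneg (y + t • u - ω)
    have e6 := norm_nonneg (y + -(t • u) - ω)
    nlinarith
  · obtain ⟨u, hu, hu0, hrec⟩ := exists_recession D.hv hbdd
    refine ⟨D.v, u, Nᗮ, ?_, fun h => hu0 ?_, fun z hz t ht k => ?_⟩
    · have := N.finrank_add_finrank_orthogonal
      omega
    · exact inner_self_eq_zero.1 ((N.mem_orthogonal u).1 h u hu)
    · rw [g_add_smul, g_add, (N.mem_orthogonal z).1 hz _ (hall k)]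
      have h3 := D.hv k
      have h4 := mul_nonpos_of_nonneg_of_nonpos ht (hrec k)
      linarith

end SourcedSystem

/-! ### Hyperplane arrangements and polyhedral complexes. -/

section Arrangement

variable {E : Type*} [NormedAddCommGroup E] [NormedSpace ℝ E]

theorem isPolyhedron_of_finite {κ : Type*} [Finite κ] (a : κ → E →L[ℝ] ℝ) (b : κ → ℝ) :
    IsPolyhedron {x | ∀ k, a k x ≤ b k} := by
  obtain ⟨n, ⟨e⟩⟩ := Finite.exists_equiv_fin κ
  refine ⟨n, a ∘ e.symm, b ∘ e.symm, ?_⟩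
  ext x
  exact ⟨fun h i => h _, fun h k => by simpa using h (e k)⟩

variable {J : Type*} [Finite J] (a : J → E →L[ℝ] ℝ) (b : J → ℝ)

/-- The closed cell of the arrangement of the hyperplanes `a j = b j` with `p` in its relative
interior. -/
def cell (p : E) : Set E :=
  {x | ∀ j, (a j p ≤ b j → a j x ≤ b j) ∧ (b j ≤ a j p → b j ≤ a j x)}

variable {a b}

theorem mem_cell_self (p : E) : p ∈ cell a b p := fun _ => ⟨id, id⟩

theorem cell_subset {p q : E} (h : q ∈ cell a b p) : cell a b q ⊆ cell a b p := fun _ hx j =>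
  ⟨fun hj => (hx j).1 ((h j).1 hj), fun hj => (hx j).2 ((h j).2 hj)⟩

theorem finite_cells : (range (cell a b)).Finite := by
  have h : range (cell a b) ⊆ range fun σ : (J → Prop) × (J → Prop) =>
      {x : E | ∀ j, (σ.1 j → a j x ≤ b j) ∧ (σ.2 j → b j ≤ a j x)} := by
    rintro _ ⟨p, rfl⟩
    exact ⟨(fun j => a j p ≤ b j, fun j => b j ≤ a j p), rfl⟩
  exact (finite_range _).subset h

theorem isPolyhedron_cell (p : E) : IsPolyhedron (cell a b p) := by
  have h := isPolyhedron_of_finite (κ := {j // a j p ≤ b j} ⊕ {j // b j ≤ a j p})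
    (Sum.elim (fun j => a j) fun j => -a j) (Sum.elim (fun j => b j) fun j => -b j)
  convert h using 1
  ext x
  constructor
  · rintro hx (⟨j, hj⟩ | ⟨j, hj⟩)
    · exact (hx j).1 hj
    · exact neg_le_neg ((hx j).2 hj)
  · intro hx j
    exact ⟨fun hj => hx (Sum.inl ⟨j, hj⟩), fun hj => neg_le_neg_iff.1 (hx (Sum.inr ⟨j, hj⟩))⟩

/-- A face is the cell of any of its points that lies on as few hyperplanes as possible. -/
theorem exists_eq_cell_of_isFace {p : E} {t : Set E} (ht : IsFace (cell a b p) t) :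
    ∃ q ∈ cell a b p, t = cell a b q := by
  obtain ⟨hne, hexp⟩ := ht
  obtain ⟨l, hl⟩ := hexp hne
  have hfin : ((fun x => {j | a j x ≠ b j}.ncard) '' t).Finite :=
    (finite_Iic (univ : Set J).ncard).subset (by
      rintro _ ⟨y, -, rfl⟩
      exact ncard_le_ncard (subset_univ _) (toFinite _))
  obtain ⟨_, ⟨q, hq, rfl⟩, hmax⟩ := exists_max_image _ id hfin (hne.image _)
  have htp : ∀ x ∈ t, x ∈ cell a b p ∧ ∀ y ∈ cell a b p, l y ≤ l x := by
    intro x hx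
    rwa [hl] at hx
  have hstrict : ∀ x ∈ t, ∀ j, a j q = b j → a j x = b j := by
    intro x hx j hj
    have hmid : ∀ k, a k ((1 / 2 : ℝ) • x + (1 / 2 : ℝ) • q) = (a k x + a k q) / 2 := by
      intro k
      rw [map_add, map_smul, map_smul, smul_eq_mul, smul_eq_mul]
      ring
    have hmt : (1 / 2 : ℝ) • x + (1 / 2 : ℝ) • q ∈ t := by
      rw [hl]
      refine ⟨fun k => ⟨fun hk => ?_, fun hk => ?_⟩, fun y hy => ?_⟩
      · have h1 := ((htp x hx).1 k).1 hk
        have h2 := ((htp q hq).1 k).1 hk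
        rw [hmid]
        linarith
      · have h1 := ((htp x hx).1 k).2 hk
        have h2 := ((htp q hq).1 k).2 hk
        rw [hmid]
        linarith
      · have h1 := (htp x hx).2 y hy
        have h2 := (htp q hq).2 y hy
        rw [map_add, map_smul, map_smul, smul_eq_mul, smul_eq_mul]
        linarith
    -- The midpoint of two points of a cell avoids every hyperplane that one of them avoids.
    have hsub : {j | a j x ≠ b j} ∪ {j | a j q ≠ b j} ⊆
        {j | a j ((1 / 2 : ℝ) • x + (1 / 2 : ℝ) • q) ≠ b j} := by
      intro k hk hmk
      rw [hmid] at hmk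
      have hxq : a k x = b k ∧ a k q = b k := by
        rcases le_total (a k p) (b k) with h | h
        · have h1 := ((htp x hx).1 k).1 h
          have h2 := ((htp q hq).1 k).1 h
          constructor <;> linarith
        · have h1 := ((htp x hx).1 k).2 h
          have h2 := ((htp q hq).1 k).2 h
          constructor <;> linarith
      rcases hk with hk | hk
      · exact hk hxq.1
      · exact hk hxq.2
    have hle : _ ≤ {j | a j q ≠ b j}.ncard := hmax _ ⟨_, hmt, rfl⟩
    have heq := eq_of_subset_of_ncard_le (subset_union_right.trans hsub) hle (toFinite _)
    by_contra hcon
    have hjq : j ∈ {j | a j q ≠ b j} := heq ▸ hsub (Or.inl hcon)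
    exact hjq hj
  refine ⟨q, (htp q hq).1, Subset.antisymm (fun x hx j => ?_) fun x hx => ?_⟩
  · constructor
    · intro hj
      rcases hj.eq_or_lt with hj | hj
      · exact (hstrict x hx j hj).le
      · refine ((htp x hx).1 j).1 ?_
        by_contra hcon
        exact hj.not_ge (((htp q hq).1 j).2 (not_le.1 hcon).le)
    · intro hj
      rcases hj.eq_or_lt with hj | hj
      · exact (hstrict x hx j hj.symm).ge
      · refine ((htp x hx).1 j).2 ?_
        by_contra hcon
        exact hj.not_ge (((htp q hq).1 j).1 (not_le.1 hcon).le)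
  · have hxq := cell_subset (htp q hq).1 hx
    have heq : ∀ j, a j q = b j → a j x = b j := fun j hj =>
      le_antisymm ((hx j).1 hj.le) ((hx j).2 hj.ge)
    have hev : ∀ᶠ ε : ℝ in 𝓝 0, ∀ j, (a j q < b j → a j (q + ε • (q - x)) < b j) ∧
        (b j < a j q → b j < a j (q + ε • (q - x))) := by
      rw [eventually_all]
      intro j
      have hc : Continuous fun ε : ℝ => a j (q + ε • (q - x)) := by fun_prop
      have h0 := hc.tendsto 0
      simp only [zero_smul, add_zero] at h0
      refine Eventually.and ?_ ?_
      · by_cases hj : a j q < b j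
        · filter_upwards [h0.eventually_lt_const hj] with ε hε _ using hε
        · exact Eventually.of_forall fun _ h => absurd h hj
      · by_cases hj : b j < a j q
        · filter_upwards [h0.eventually_const_lt hj] with ε hε _ using hε
        · exact Eventually.of_forall fun _ h => absurd h hj
    have hpos : ∀ᶠ t : ℝ in 𝓝[>] 0, 0 < t := self_mem_nhdsWithin
    -- The segment from x to q can be prolonged beyond q inside the cell of p; as the functional is
    -- maximal at q, it cannot be smaller at x.
    obtain ⟨ε, hε, hε0⟩ := ((hev.filter_mono nhdsWithin_le_nhds).and hpos).exists
    have hval : ∀ j, a j q = b j → a j (q + ε • (q - x)) = b j := by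
      intro j hj
      rw [map_add, map_smul, map_sub, hj, heq j hj, sub_self, smul_zero, add_zero]
    have hmem : q + ε • (q - x) ∈ cell a b p := by
      intro j
      constructor
      · intro hj
        rcases (((htp q hq).1 j).1 hj).eq_or_lt with h | h
        · exact (hval j h).le
        · exact ((hε j).1 h).le
      · intro hj
        rcases (((htp q hq).1 j).2 hj).eq_or_lt with h | h
        · exact (hval j h.symm).ge
        · exact ((hε j).2 h).le
    have h1 := (htp q hq).2 _ hmem
    rw [map_add, map_smul, map_sub, smul_eq_mul] at h1
    rw [hl]
    refine ⟨hxq, fun y hy => ((htp q hq).2 y hy).trans ?_⟩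
    by_contra hcon
    push Not at hcon
    nlinarith

theorem isFace_cell_inter {p q : E} (hne : (cell a b p ∩ cell a b q).Nonempty) :
    IsFace (cell a b p) (cell a b p ∩ cell a b q) := by
  classical
  cases nonempty_fintype J
  refine ⟨hne, fun _ => ?_⟩
  -- The exposing functional adds up, with signs, the hyperplanes whose strict side at p is excluded
  -- at q; on the cell of p its maximum is attained exactly where all of these are equalities.
  set c : J → ℝ := fun j => if a j p < b j ∧ b j ≤ a j q then 1 else
    if b j < a j p ∧ a j q ≤ b j then -1 else 0 with hc
  have hle : ∀ x ∈ cell a b p, ∀ j, c j * a j x ≤ c j * b j := by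
    intro x hx j
    simp only [hc]
    split_ifs with h1 h2
    · linarith [(hx j).1 h1.1.le]
    · linarith [(hx j).2 h2.1.le]
    · simp
  have hiff : ∀ x ∈ cell a b p, x ∈ cell a b q ↔ ∀ j, c j * a j x = c j * b j := by
    intro x hx
    constructor
    · intro hxq j
      simp only [hc]
      split_ifs with h1 h2
      · rw [le_antisymm ((hx j).1 h1.1.le) ((hxq j).2 h1.2)]
      · rw [le_antisymm ((hxq j).1 h2.2) ((hx j).2 h2.1.le)]
      · simp
    · intro h j
      have hj := h j
      simp only [hc] at hj
      constructor
      · intro hq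
        by_cases hp : a j p ≤ b j
        · exact (hx j).1 hp
        · push Not at hp
          rw [if_neg (fun h => h.1.not_gt hp), if_pos ⟨hp, hq⟩] at hj
          linarith
      · intro hq
        by_cases hp : b j ≤ a j p
        · exact (hx j).2 hp
        · push Not at hp
          rw [if_pos ⟨hp, hq⟩] at hj
          linarith
  have hsum : ∀ x, (∑ j, c j • a j : E →L[ℝ] ℝ) x = ∑ j, c j * a j x := by
    intro x
    simp
  have hmax : ∀ x ∈ cell a b p, ∑ j, c j * a j x ≤ ∑ j, c j * b j := fun x hx =>
    Finset.sum_le_sum fun j _ => hle x hx j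
  obtain ⟨z, hzp, hzq⟩ := hne
  refine ⟨∑ j, c j • a j, ?_⟩
  ext x
  constructor
  · rintro ⟨hxp, hxq⟩
    refine ⟨hxp, fun y hy => ?_⟩
    rw [hsum, hsum, Finset.sum_congr rfl fun j _ => (hiff x hxp).1 hxq j]
    exact hmax y hy
  · rintro ⟨hxp, hx⟩
    refine ⟨hxp, (hiff x hxp).2 fun j => ?_⟩
    have h1 := hx z hzp
    rw [hsum, hsum, Finset.sum_congr rfl fun j _ => (hiff z hzp).1 hzq j] at h1
    have h2 := (Finset.sum_eq_sum_iff_of_le fun j _ => hle x hxp j).1 (le_antisymm (hmax x hxp) h1)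
    exact h2 j (Finset.mem_univ j)

/-- A finite union of polyhedra is the support of a polyhedral complex. -/
theorem exists_polyhedralComplex {Q : Set (Set E)} (hQ : Q.Finite)
    (hpoly : ∀ q ∈ Q, IsPolyhedron q) : ∃ C : PolyhedralComplex E, C.support = ⋃₀ Q ∧
      ∀ s ∈ C.cells, ∃ q ∈ Q, s ⊆ q := by
  choose! n a b h using hpoly
  have := hQ.to_subtype
  -- In the arrangement of all hyperplanes of all members of Q, every cell meets Q's members only by
  -- inclusion as soon as its defining point lies in them.
  set a' : (Σ q : Q, Fin (n q)) → E →L[ℝ] ℝ := fun j => a j.1 j.2 with ha'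
  set b' : (Σ q : Q, Fin (n q)) → ℝ := fun j => b j.1 j.2 with hb'
  have hsub : ∀ q ∈ Q, ∀ p ∈ q, cell a' b' p ⊆ q := by
    intro q hq p hp x hx
    rw [h q hq] at hp ⊢
    intro i
    exact (hx ⟨⟨q, hq⟩, i⟩).1 (hp i)
  refine ⟨⟨cell a' b' '' ⋃₀ Q, finite_cells.subset (image_subset_range _ _), ?_, ?_, ?_, ?_⟩,
    ?_, ?_⟩
  · rintro _ ⟨p, -, rfl⟩
    exact ⟨p, mem_cell_self p⟩
  · rintro _ ⟨p, -, rfl⟩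
    exact isPolyhedron_cell p
  · rintro _ ⟨p, ⟨q, hq, hp⟩, rfl⟩ t ht
    obtain ⟨r, hr, rfl⟩ := exists_eq_cell_of_isFace ht
    exact ⟨r, ⟨q, hq, hsub q hq p hp hr⟩, rfl⟩
  · rintro _ ⟨p, -, rfl⟩ _ ⟨q, -, rfl⟩ hne
    refine ⟨isFace_cell_inter hne, ?_⟩
    rw [inter_comm] at hne ⊢
    exact isFace_cell_inter hne
  · apply Subset.antisymm
    · rintro x ⟨_, ⟨p, ⟨q, hq, hp⟩, rfl⟩, hx⟩
      exact ⟨q, hq, hsub q hq p hp hx⟩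
    · rintro x hx
      exact ⟨_, ⟨x, hx, rfl⟩, mem_cell_self x⟩
  · rintro _ ⟨p, ⟨q, hq, hp⟩, rfl⟩
    exact ⟨q, hq, hsub q hq p hp⟩

end Arrangement

/-! ### Dimension estimates. -/

section Dimension

variable {E : Type*} [NormedAddCommGroup E] [InnerProductSpace ℝ E] [FiniteDimensional ℝ E]

theorem dim_mono {s t : Set E} (h : s ⊆ t) : dim s ≤ dim t :=
  Submodule.finrank_mono (vectorSpan_mono ℝ h)

/-- A finite union of sets whose projection to a subspace has interior points contains one of at
least the dimension of the subspace. -/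
theorem exists_finrank_le_dim {C : Set (Set E)} (hC : C.Finite) (L : Submodule ℝ E) (c : E)
    (h : ∀ᶠ u in 𝓝 (0 : E), u ∈ L → ∃ z ∈ ⋃₀ C, z - (c + u) ∈ Lᗮ) :
    ∃ s ∈ C, Module.finrank ℝ L ≤ dim s := by
  by_contra! hcon
  let _ : MeasurableSpace L := borel L
  have : BorelSpace L := ⟨rfl⟩
  set μ : MeasureTheory.Measure L := MeasureTheory.Measure.addHaar
  set f : E →L[ℝ] L := L.orthogonalProjectionOnto with hf
  -- The affine span of a projected set of too small dimension is a proper affine subspace, hence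
  -- Haar null; finitely many such sets cannot cover a neighbourhood.
  have hnull : μ (⋃ s ∈ C, f '' s) = 0 := by
    rw [MeasureTheory.measure_biUnion_null_iff hC.countable]
    intro s hs
    refine MeasureTheory.measure_mono_null (subset_affineSpan ℝ _)
      (MeasureTheory.Measure.addHaar_affineSubspace μ _ fun htop => ?_)
    have h1 : vectorSpan ℝ (f '' s) = ⊤ := by
      rw [← direction_affineSpan, htop, AffineSubspace.direction_top]
    have h2 : vectorSpan ℝ (f '' s) = (vectorSpan ℝ s).map (f : E →ₗ[ℝ] L) :=
      (f : E →ₗ[ℝ] L).toAffineMap.map_vectorSpan.symm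
    have h3 := Submodule.finrank_map_le (f : E →ₗ[ℝ] L) (vectorSpan ℝ s)
    rw [← h2, h1, finrank_top] at h3
    exact (hcon s hs).not_ge h3
  have hnhds : (⋃ s ∈ C, f '' s) ∈ 𝓝 (f c) := by
    have hc : Tendsto (fun w : L => ((w - f c : L) : E)) (𝓝 (f c)) (𝓝 0) := by
      have : Continuous fun w : L => ((w - f c : L) : E) := by fun_prop
      have h0 := this.tendsto (f c)
      simpa using h0
    filter_upwards [hc.eventually h] with w hw
    obtain ⟨z, ⟨s, hs, hz⟩, hzL⟩ := hw (Subtype.coe_prop _)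
    refine mem_biUnion hs ⟨z, hz, ?_⟩
    have h1 : f (z - (c + ((w - f c : L) : E))) = 0 :=
      Submodule.orthogonalProjectionOnto_eq_zero_iff.2 hzL
    rw [map_sub, map_add, hf, Submodule.orthogonalProjectionOnto_mem_subspace_eq_self, ← hf] at h1
    rw [sub_eq_zero.1 h1]
    abel
  exact (MeasureTheory.Measure.measure_pos_of_mem_nhds μ hnhds).ne' hnull

theorem dim_add_two_le {s : Set E} {n m : E} (hli : LinearIndependent ℝ ![n, m])
    (h : ∀ x ∈ s, ∀ y ∈ s, ⟪n, x - y⟫ = 0 ∧ ⟪m, x - y⟫ = 0) :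
    dim s + 2 ≤ Module.finrank ℝ E := by
  set W := Submodule.span ℝ (range ![n, m]) with hW
  have h1 : Module.finrank ℝ W = 2 := by simpa using finrank_span_eq_card hli
  have h2 : vectorSpan ℝ s ≤ Wᗮ := by
    rw [vectorSpan_def, Submodule.span_le]
    rintro _ ⟨x, hx, y, hy, rfl⟩
    refine (Submodule.mem_orthogonal _ _).2 fun u hu => ?_
    rw [hW, Matrix.range_cons, Matrix.range_cons, Matrix.range_empty, union_empty,
      singleton_union] at hu
    obtain ⟨a, b, rfl⟩ := Submodule.mem_span_pair.1 hu
    obtain ⟨h3, h4⟩ := h x hx y hy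
    change ⟪a • n + b • m, x - y⟫ = 0
    rw [inner_add_left, real_inner_smul_left, real_inner_smul_left, h3, h4]
    ring
  have h3 := Submodule.finrank_mono h2
  have h4 := W.finrank_add_finrank_orthogonal
  unfold dim
  omega

end Dimension

/-! ### The cut locus as a finite union of polyhedra. -/

namespace SourcedSystem

open HalfspaceSystem

variable {E : Type*} [NormedAddCommGroup E] [InnerProductSpace ℝ E] [FiniteDimensional ℝ E]
variable {ι : Type*} [Finite ι] {D : SourcedSystem E ι}

/-- The polyhedron of points at which all constraints in `A` are active and the two given source
images are nearest among those seen from facets in `A`. -/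
def cutPiece (D : SourcedSystem E ι) (τ : Set ι × (ι × E) × (ι × E)) : Set E :=
  {x | x ∈ D.P ∧ (∀ k ∈ τ.1, D.g k x = 0) ∧ ∀ q ∈ D.images, q.1 ∈ τ.1 →
    ‖x - τ.2.1.2‖ ≤ ‖x - q.2‖ ∧ ‖x - τ.2.2.2‖ ≤ ‖x - q.2‖}

/-- Comparing distances to two points is a linear condition on x. -/
theorem norm_sub_le_iff (x ω ω' : E) :
    ‖x - ω‖ ≤ ‖x - ω'‖ ↔ ⟪(2 : ℝ) • (ω' - ω), x⟫ ≤ ‖ω'‖ ^ 2 - ‖ω‖ ^ 2 := by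
  rw [← pow_le_pow_iff_left₀ (norm_nonneg _) (norm_nonneg _) two_ne_zero, norm_sub_sq_real,
    norm_sub_sq_real, real_inner_smul_left, inner_sub_left, real_inner_comm ω, real_inner_comm ω']
  constructor <;> intro h <;> linarith

theorem isPolyhedron_cutPiece (τ : Set ι × (ι × E) × (ι × E)) : IsPolyhedron (D.cutPiece τ) := by
  have := D.finite_images.to_subtype
  have h := isPolyhedron_of_finite
    (κ := (ι ⊕ {k // k ∈ τ.1}) ⊕ ({q : D.images // q.1.1 ∈ τ.1} ⊕ {q : D.images // q.1.1 ∈ τ.1}))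
    (Sum.elim (Sum.elim (fun k => innerSL ℝ (D.n k)) fun k => -innerSL ℝ (D.n k))
      (Sum.elim (fun q => innerSL ℝ ((2 : ℝ) • (q.1.1.2 - τ.2.1.2)))
        fun q => innerSL ℝ ((2 : ℝ) • (q.1.1.2 - τ.2.2.2))))
    (Sum.elim (Sum.elim (fun k => D.b k) fun k => -D.b k)
      (Sum.elim (fun q => ‖q.1.1.2‖ ^ 2 - ‖τ.2.1.2‖ ^ 2)
        fun q => ‖q.1.1.2‖ ^ 2 - ‖τ.2.2.2‖ ^ 2))
  convert h using 1
  ext x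
  constructor
  · rintro ⟨hP, hA, hq⟩ ((k | ⟨k, hk⟩) | (⟨q, hqA⟩ | ⟨q, hqA⟩))
    · have := hP k
      unfold g at this
      simp only [Sum.elim_inl, innerSL_apply_apply]
      linarith
    · have := hA k hk
      unfold g at this
      simp only [Sum.elim_inl, Sum.elim_inr, neg_apply, innerSL_apply_apply]
      linarith
    · exact (norm_sub_le_iff _ _ _).1 (hq q q.2 hqA).1
    · exact (norm_sub_le_iff _ _ _).1 (hq q q.2 hqA).2
  · intro hx
    have hP : x ∈ D.P := fun k => by
      have := hx (Sum.inl (Sum.inl k))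
      simp only [Sum.elim_inl, innerSL_apply_apply] at this
      unfold g
      linarith
    refine ⟨hP, fun k hk => le_antisymm (hP k) ?_, fun q hq hqA => ⟨?_, ?_⟩⟩
    · have := hx (Sum.inl (Sum.inr ⟨k, hk⟩))
      simp only [Sum.elim_inl, Sum.elim_inr, neg_apply,
        innerSL_apply_apply] at this
      unfold g
      linarith
    · exact (norm_sub_le_iff _ _ _).2 (hx (Sum.inr (Sum.inl ⟨⟨q, hq⟩, hqA⟩)))
    · exact (norm_sub_le_iff _ _ _).2 (hx (Sum.inr (Sum.inr ⟨⟨q, hq⟩, hqA⟩)))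

/-- The data of two source images seen from a cut point, with its active constraints. -/
def cutTypes (D : SourcedSystem E ι) : Set (Set ι × (ι × E) × (ι × E)) :=
  {τ | ∃ x, τ.1 = {k | D.g k x = 0} ∧ τ.2.1 ∈ D.T x ∧ τ.2.2 ∈ D.T x ∧ τ.2.1 ≠ τ.2.2}

theorem finite_cutTypes : D.cutTypes.Finite := by
  refine (finite_univ.prod (D.finite_images.prod D.finite_images)).subset ?_
  rintro τ ⟨x, -, h1, h2, -⟩
  exact ⟨mem_univ _, T_subset_images _ h1, T_subset_images _ h2⟩

theorem norm_combo_le {x z ω ω' : E} (hx : ‖x - ω‖ ≤ ‖x - ω'‖) (hz : ‖z - ω‖ ≤ ‖z - ω'‖) {t : ℝ}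
    (h0 : 0 ≤ t) (h1 : t ≤ 1) : ‖x + t • (z - x) - ω‖ ≤ ‖x + t • (z - x) - ω'‖ := by
  rw [norm_sub_le_iff] at *
  rw [inner_add_right, inner_smul_right, inner_sub_right]
  nlinarith

theorem mem_cutPiece {x : E} {p p' : ι × E} (hp : p ∈ D.T x) (hp' : p' ∈ D.T x) :
    x ∈ D.cutPiece ({k | D.g k x = 0}, p, p') := by
  obtain ⟨i, ω⟩ := p
  obtain ⟨j, ω'⟩ := p'
  have h1 := mem_T_iff.1 hp
  have h2 := mem_T_iff.1 hp'
  refine ⟨h1.1.1, fun k hk => hk, ?_⟩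
  rintro ⟨k, ω''⟩ ⟨z, hz⟩ hk
  have h3 := (mem_T_iff.1 hz).2.2.2.2.1 x ⟨h1.1.1, hk⟩
  exact ⟨h1.2.2.2.1.trans_le h3, h2.2.2.2.1.trans_le h3⟩

/-- On the segment from x to the witness x₀, every point except possibly x and the source has
exactly the active constraints of x₀, and both images are still tied nearest; so x is a limit of cut
points. -/
theorem cutPiece_subset {τ : Set ι × (ι × E) × (ι × E)} (hτ : τ ∈ D.cutTypes) :
    D.cutPiece τ ⊆ cutLocus D.P D.v := by
  obtain ⟨A, ⟨i, ω⟩, ⟨j, ω'⟩⟩ := τ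
  obtain ⟨x₀, hA, hp, hp', hne⟩ := hτ
  simp only at hA hp hp' hne
  subst hA
  have h1 := mem_T_iff.1 hp
  have h2 := mem_T_iff.1 hp'
  intro x hx
  have hx₀ := mem_cutPiece hp hp'
  rw [cutLocus_eq_closure]
  have key : ∀ t : ℝ, 0 < t → t ≤ 1 → x + t • (x₀ - x) ≠ D.v →
      x + t • (x₀ - x) ∈ {y | y ∈ D.S ∧ ¬(D.T y).Subsingleton} := by
    intro t ht0 ht1 hv
    set z := x + t • (x₀ - x) with hz
    have hzP : z ∈ D.P := P_combo hx.1 h1.1.1 ht0.le ht1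
    have hact : ∀ k, D.g k z = 0 ↔ D.g k x₀ = 0 := by
      intro k
      rw [hz, g_combo]
      constructor
      · intro h
        have h3 := mul_nonpos_of_nonneg_of_nonpos (by linarith : 0 ≤ 1 - t) (hx.1 k)
        have h4 := h1.1.1 k
        by_contra hcon
        have h5 := lt_of_le_of_ne h4 hcon
        nlinarith
      · intro h
        rw [h, hx.2.1 k h]
        ring
    have hzS : z ∈ D.S := ⟨hzP, i, (hact i).2 h1.1.2⟩
    obtain ⟨⟨k, ω''⟩, hk⟩ := T_nonempty hzS hv
    have h3 := mem_T_iff.1 hk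
    have hkA := (hact k).1 h3.1.2
    have h4 := hx.2.2 _ (T_subset_images _ hk) hkA
    have h5 := hx₀.2.2 _ (T_subset_images _ hk) hkA
    have e1 : ‖z - ω‖ ≤ D.rho z := by
      rw [← h3.2.2.2.1]
      exact norm_combo_le h4.1 h5.1 ht0.le ht1
    have e2 : ‖z - ω'‖ ≤ D.rho z := by
      rw [← h3.2.2.2.1]
      exact norm_combo_le h4.2 h5.2 ht0.le ht1
    have m1 : (i, ω) ∈ D.T z := by
      have hzF : z ∈ D.F i := ⟨hzP, (hact i).2 h1.1.2⟩
      exact mem_T_iff.2 ⟨hzF, hv, h1.2.2.1, le_antisymm e1 (h1.2.2.2.2.1 z hzF), h1.2.2.2.2.1,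
        fun l hl hlz => h1.2.2.2.2.2 l hl ((hact l).1 hlz)⟩
    have m2 : (j, ω') ∈ D.T z := by
      have hzF : z ∈ D.F j := ⟨hzP, (hact j).2 h2.1.2⟩
      exact mem_T_iff.2 ⟨hzF, hv, h2.2.2.1, le_antisymm e2 (h2.2.2.2.2.1 z hzF), h2.2.2.2.2.1,
        fun l hl hlz => h2.2.2.2.2.2 l hl ((hact l).1 hlz)⟩
    exact ⟨hzS, fun h => hne (h m1 m2)⟩
  by_cases hxx : x = x₀
  · have h3 := key 1 one_pos le_rfl (by rw [hxx]; simpa using h1.2.1)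
    rw [hxx, sub_self, smul_zero, add_zero] at h3
    rw [hxx]
    exact subset_closure h3
  have hc : Tendsto (fun t : ℝ => x + t • (x₀ - x)) (𝓝[>] 0) (𝓝 x) := by
    have : Continuous fun t : ℝ => x + t • (x₀ - x) := by fun_prop
    have h0 := this.tendsto 0
    rw [zero_smul, add_zero] at h0
    exact h0.mono_left nhdsWithin_le_nhds
  refine mem_closure_of_tendsto hc ?_
  have hpos : ∀ᶠ t : ℝ in 𝓝[>] 0, 0 < t := self_mem_nhdsWithin
  have hlt : ∀ r : ℝ, 0 < r → ∀ᶠ t : ℝ in 𝓝[>] 0, t < r := fun r hr =>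
    (eventually_lt_nhds hr).filter_mono nhdsWithin_le_nhds
  -- If the ray from x to x₀ meets the source, only parameters before it are used.
  by_cases hv : ∃ s : ℝ, 0 < s ∧ x + s • (x₀ - x) = D.v
  · obtain ⟨s, hs0, hs⟩ := hv
    filter_upwards [hpos, hlt 1 one_pos, hlt s hs0] with t ht0 ht1 hts
    refine key t ht0 ht1.le fun h => hts.ne ?_
    rw [← hs] at h
    exact smul_left_injective ℝ (sub_ne_zero.2 (Ne.symm hxx)) (add_left_cancel h)
  · push Not at hv
    filter_upwards [hpos, hlt 1 one_pos] with t ht0 ht1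
    exact key t ht0 ht1.le (hv t ht0)

theorem sUnion_cutPiece : ⋃₀ (D.cutPiece '' D.cutTypes) = cutLocus D.P D.v := by
  apply Subset.antisymm
  · rintro x ⟨_, ⟨τ, hτ, rfl⟩, hx⟩
    exact cutPiece_subset hτ hx
  · rw [cutLocus_eq_closure]
    refine closure_minimal ?_ ?_
    · rintro x ⟨-, hT⟩
      rw [not_subsingleton_iff] at hT
      obtain ⟨p, hp, p', hp', hne⟩ := hT
      exact ⟨_, ⟨({k | D.g k x = 0}, p, p'), ⟨x, rfl, hp, hp', hne⟩, rfl⟩, mem_cutPiece hp hp'⟩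
    · rw [sUnion_image]
      refine finite_cutTypes.isClosed_biUnion fun τ _ => ?_
      obtain ⟨n, a, b, h⟩ := D.isPolyhedron_cutPiece τ
      rw [h, ofPred_forall]
      exact isClosed_iInter fun i => isClosed_le (a i).continuous continuous_const

/-- Two independent linear equations hold: the facet and the bisector of the images if they are seen
in the same facet, and otherwise the equations of the two facets. -/
theorem dim_cutPiece {τ : Set ι × (ι × E) × (ι × E)} (hτ : τ ∈ D.cutTypes) :
    dim (D.cutPiece τ) + 2 ≤ Module.finrank ℝ E := by
  obtain ⟨A, ⟨i, ω⟩, ⟨j, ω'⟩⟩ := τ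
  obtain ⟨x₀, hA, hp, hp', hne⟩ := hτ
  simp only at hA hp hp' hne
  subst hA
  have h1 := mem_T_iff.1 hp
  have h2 := mem_T_iff.1 hp'
  have hn : ∀ k, D.g k x₀ = 0 → ∀ x ∈ D.cutPiece ({k | D.g k x₀ = 0}, (i, ω), (j, ω')),
      ∀ y ∈ D.cutPiece ({k | D.g k x₀ = 0}, (i, ω), (j, ω')), ⟪D.n k, x - y⟫ = 0 := by
    intro k hk x hx y hy
    rw [← g_sub, hx.2.1 k hk, hy.2.1 k hk, sub_zero]
  by_cases hij : i = j
  · subst hij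
    have hωω : ω ≠ ω' := fun h => hne (by rw [h])
    have hperp : ⟪D.n i, ω - ω'⟫ = 0 := by rw [← g_sub, h1.2.2.1, h2.2.2.1, sub_zero]
    refine dim_add_two_le (n := D.n i) (m := ω - ω') ?_ fun x hx y hy =>
      ⟨hn i h1.1.2 x hx y hy, ?_⟩
    · have hi0 : D.n i ≠ 0 := fun h => by
        have := D.norm_n i
        rw [h, norm_zero] at this
        exact zero_ne_one this
      rw [LinearIndependent.pair_iff' hi0]
      intro a ha
      rw [← ha, inner_smul_right, real_inner_self_eq_norm_sq, D.norm_n] at hperp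
      have ha0 : a = 0 := by linarith
      rw [ha0, zero_smul] at ha
      exact hωω (sub_eq_zero.1 ha.symm)
    · have heq : ∀ z ∈ D.cutPiece ({k | D.g k x₀ = 0}, (i, ω), (i, ω')),
          ‖z - ω‖ ≤ ‖z - ω'‖ ∧ ‖z - ω'‖ ≤ ‖z - ω‖ := fun z hz =>
        ⟨(hz.2.2 _ (T_subset_images _ hp') h2.1.2).1, (hz.2.2 _ (T_subset_images _ hp) h1.1.2).2⟩
      obtain ⟨a1, a2⟩ := heq x hx
      obtain ⟨b1, b2⟩ := heq y hy
      rw [norm_sub_le_iff, real_inner_smul_left, inner_sub_left] at a1 a2 b1 b2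
      rw [inner_sub_left, inner_sub_right, inner_sub_right]
      linarith
  · exact dim_add_two_le (linearIndependent_n hij h1.1.2 h2.1.2) fun x hx y hy =>
      ⟨hn i h1.1.2 x hx y hy, hn j h2.1.2 x hx y hy⟩

end SourcedSystem

/-! ### The lower bound for the dimension. -/

namespace SourcedSystem

open HalfspaceSystem

variable {E : Type*} [NormedAddCommGroup E] [InnerProductSpace ℝ E] [FiniteDimensional ℝ E]
variable {ι : Type*} [Finite ι] {D : SourcedSystem E ι}

theorem tendsto_add_left (y : E) : Tendsto (fun h : E => y + h) (𝓝 0) (𝓝 y) := by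
  have := (by fun_prop : Continuous fun h : E => y + h).tendsto 0
  rwa [add_zero] at this

/-- Close to the beginning of a shortest path from `y`, the boundary is a flat space in which only
the source image of that path is seen. -/
theorem eventually_T_near {y : E} {i : ι} {ω : E} (hi : (i, ω) ∈ D.T y) :
    ∀ᶠ r : ℝ in 𝓝[>] 0, ∀ᶠ h in 𝓝 (0 : E), ⟪D.n i, h⟫ = 0 →
      y + r • (ω - y) + h ∈ D.Fo i ∧ (i, ω) ∈ D.T (y + r • (ω - y) + h) := by
  obtain ⟨hyF, hyv, hgω, hr, hle, hneg⟩ := mem_T_iff.1 hi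
  have hpos := D.rho_pos (F_subset_S i hyF) hyv
  have hc : Tendsto (fun r : ℝ => y + r • (ω - y)) (𝓝[>] 0) (𝓝 y) := by
    have : Continuous fun r : ℝ => y + r • (ω - y) := by fun_prop
    have h0 := this.tendsto 0
    rw [zero_smul, add_zero] at h0
    exact h0.mono_left nhdsWithin_le_nhds
  have hp : ∀ᶠ t : ℝ in 𝓝[>] 0, 0 < t := self_mem_nhdsWithin
  have h1 : ∀ᶠ t : ℝ in 𝓝[>] 0, t < 1 :=
    (eventually_lt_nhds one_pos).filter_mono nhdsWithin_le_nhds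
  filter_upwards [hc.eventually (eventually_lt y hyF.1), hc.eventually (eventually_ne_nhds hyv),
    hp, h1] with r hlt hqv hr0 hr1
  set q := y + r • (ω - y) with hq
  have hqi : D.g i q = 0 := by rw [hq, g_combo, hyF.2, hgω]; ring
  have hqFo : q ∈ D.Fo i := by
    refine ⟨hqi, fun k hk => ?_⟩
    by_cases hky : D.g k y = 0
    · rw [hq, g_combo, hky, mul_zero, zero_add]
      exact mul_neg_of_pos_of_neg hr0 (hneg k hk hky)
    · exact hlt k hky
  have hqF := Fo_subset_F i hqFo
  have hcr := norm_crossing (z := y) (ω := ω) hr0.le hr1.le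
  rw [← hq] at hcr
  have hle1 := rho_le_of_facet hyF hqF
  have hle2 := hle q hqF
  have hrho : D.rho y = ‖y - q‖ + D.rho q := by rw [norm_sub_rev]; linarith
  have hqT : (i, ω) ∈ D.T q := mem_T_iff.2 ⟨hqF, hqv, hgω, by rw [norm_sub_rev] at hrho; linarith,
    hle, fun k hk hkq => absurd (eq_of_mem_Fo hqFo hkq) hk⟩
  have hyq : y ≠ q := by
    intro h
    rw [hq] at h
    have h2 : r • (ω - y) = 0 := by simpa using h.symm
    rcases smul_eq_zero.1 h2 with h2 | h2
    · exact hr0.ne' h2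
    · rw [← hr, norm_sub_rev, h2, norm_zero] at hpos
      exact lt_irrefl _ hpos
  -- As q lies inside a shortest path from y, it sees no other image, and the stability at flat
  -- points applies.
  have hsub := T_subsingleton hyF hyq hqF hrho
  have hflat : D.IsFlat q := isFlat_of_unique fun k hk => eq_of_mem_Fo hqFo hk
  have htend := tendsto_add_left q
  filter_upwards [htend.eventually (eventually_lt q hqF.1), htend.eventually
    (eventually_ne_nhds hqv), htend.eventually (eventually_image (F_subset_S i hqF) hflat hsub hqT)]
    with h hl hv him hih
  have hFo : q + h ∈ D.Fo i := by
    refine ⟨by rw [g_add, hqi, hih, add_zero], fun k hk => hl k fun hkq => ?_⟩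
    exact hk (eq_of_mem_Fo hqFo hkq)
  refine ⟨hFo, ?_⟩
  obtain ⟨⟨i', ω'⟩, hi'⟩ := T_nonempty (F_subset_S i (Fo_subset_F i hFo)) hv
  rcases him i' ω' hi' with ⟨rfl, rfl⟩ | ⟨hne, -, -, -⟩
  · exact hi'
  · exact absurd (eq_of_mem_Fo hFo (mem_T_iff.1 hi').1.2).symm hne

theorem eventually_mem_ball_combo (y : E) (w : E) {R : ℝ} (hR : 0 < R) :
    ∀ᶠ r : ℝ in 𝓝[>] 0, ∀ᶠ h in 𝓝 (0 : E), y + r • w + h ∈ Metric.ball y R := by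
  have hc : Tendsto (fun r : ℝ => y + r • w) (𝓝[>] 0) (𝓝 y) := by
    have : Continuous fun r : ℝ => y + r • w := by fun_prop
    have h0 := this.tendsto 0
    rw [zero_smul, add_zero] at h0
    exact h0.mono_left nhdsWithin_le_nhds
  filter_upwards [hc.eventually (Metric.ball_mem_nhds y hR)] with r hr
  exact (tendsto_add_left _).eventually (Metric.isOpen_ball.mem_nhds hr)

/-- Near a cut point in the relative interior of a facet, the cut points project onto an open subset
of a subspace of codimension two. -/
theorem cutPoints_near_facet {y : E} {i : ι} {ω ω' : E} (h1 : (i, ω) ∈ D.T y)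
    (h2 : (i, ω') ∈ D.T y) (hne : ω ≠ ω') : ∃ c : E, ∀ᶠ u in 𝓝 (0 : E),
      u ∈ (Submodule.span ℝ {D.n i, ω' - ω})ᗮ → ∃ z ∈ D.S, ¬(D.T z).Subsingleton ∧
        z - (c + u) ∈ (Submodule.span ℝ {D.n i, ω' - ω})ᗮᗮ := by
  have hyv := (mem_T_iff.1 h1).2.1
  have hR : 0 < dist D.v y := dist_pos.2 hyv.symm
  obtain ⟨r, ⟨⟨ha, ha'⟩, hb⟩, hb'⟩ := (((eventually_T_near h1).and (eventually_T_near h2)).and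
    (eventually_mem_ball_combo y (ω - y) hR) |>.and
    (eventually_mem_ball_combo y (ω' - y) hR)).exists
  refine ⟨y + r • (ω - y), ?_⟩
  filter_upwards [ha, ha', hb, hb'] with u hu hu' hv hv' huL
  have hiu : ⟪D.n i, u⟫ = 0 :=
    (Submodule.mem_orthogonal _ _).1 huL _ (Submodule.subset_span (by simp))
  obtain ⟨hFo, hT⟩ := hu hiu
  obtain ⟨hFo', hT'⟩ := hu' hiu
  set p := y + r • (ω - y) + u with hp
  set p' := y + r • (ω' - y) + u with hp'
  have hseg : ∀ z ∈ segment ℝ p p', z ∈ D.Fo i ∧ ∃ t : ℝ, z = p + t • (p' - p) := by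
    intro z hz
    rw [segment_eq_image'] at hz
    obtain ⟨t, ⟨ht0, ht1⟩, rfl⟩ := hz
    refine ⟨?_, t, rfl⟩
    rcases ht0.eq_or_lt with rfl | ht0
    · simpa using hFo
    · exact F_combo_mem_Fo (Fo_subset_F i hFo) hFo' ht0 ht1
  -- Without a cut point on the segment from p to p', which is parallel to ω' - ω, the set of images
  -- would be constant on it, although p sees ω and p' sees ω'.
  by_contra! hcon
  have hmem : ∀ z ∈ segment ℝ p p', (D.T z).Subsingleton := by
    intro z hz
    obtain ⟨hzFo, t, ht⟩ := hseg z hz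
    by_contra hns
    refine hcon z (F_subset_S i (Fo_subset_F i hzFo)) (not_subsingleton_iff.1 hns) ?_
    have e : z - (y + r • (ω - y) + u) = (t * r) • (ω' - ω) := by
      have e1 : p' - p = r • (ω' - ω) := by
        rw [hp, hp']
        simp only [smul_sub]
        abel
      rw [ht, e1, smul_smul, hp]
      abel
    rw [e, Submodule.orthogonal_orthogonal]
    exact Submodule.smul_mem _ _ (Submodule.subset_span (by simp))
  have heq : D.T p = D.T p' := by
    refine T_eq_of_isPreconnected (convex_segment p p').isPreconnected
      (fun z hz => F_subset_S i (Fo_subset_F i (hseg z hz).1)) ?_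
      (fun z hz => isFlat_of_unique fun k hk => eq_of_mem_Fo (hseg z hz).1 hk) hmem
      (fun z hz z' hz' k hk => ?_) (left_mem_segment ℝ p p') (right_mem_segment ℝ p p')
    · intro hv0
      have := (convex_ball y (dist D.v y)).segment_subset hv hv' hv0
      exact lt_irrefl _ (Metric.mem_ball.1 this)
    · rw [eq_of_mem_Fo (hseg z hz).1 hk]
      exact (hseg z' hz').1.1
  rw [← heq] at hT'
  exact hne (Prod.ext_iff.1 (hmem p (left_mem_segment ℝ p p') hT hT')).2

/-- A point slightly inside the facet towards ω sees ω stably under small translations along the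
face of y. Walking back to y + h inside the facet meets no cut points, so `rho` remains the distance
to ω. -/
theorem eventually_T_along_ridge (hnone : ∀ i, ∀ z ∈ D.Fo i, (D.T z).Subsingleton) {y : E} {i : ι}
    {ω : E} (hi : (i, ω) ∈ D.T y) :
    ∀ᶠ h in 𝓝 (0 : E), h ∈ (D.N y)ᗮ → (i, ω) ∈ D.T (y + h) := by
  obtain ⟨hyF, hyv, hgω, hr, hle, hneg⟩ := mem_T_iff.1 hi
  have hR : 0 < dist D.v y := dist_pos.2 hyv.symm
  obtain ⟨r, ha, hb⟩ := ((eventually_T_near hi).and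
    (eventually_mem_ball_combo y (ω - y) hR)).exists
  have htend := tendsto_add_left y
  filter_upwards [ha, hb, htend.eventually (eventually_lt y hyF.1),
    htend.eventually (Metric.ball_mem_nhds y hR)] with h hu hv hlt hv' hhL
  have hact : ∀ k, D.g k y = 0 → ⟪D.n k, h⟫ = 0 := fun k hk =>
    (Submodule.mem_orthogonal _ _).1 hhL _ (n_mem_N hk)
  have hgk : ∀ k, D.g k y = 0 → D.g k (y + h) = 0 := fun k hk => by
    rw [g_add, hk, hact k hk, add_zero]
  obtain ⟨hFo, hT⟩ := hu (hact i hyF.2)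
  have hF : y + h ∈ D.F i := by
    refine ⟨fun k => ?_, hgk i hyF.2⟩
    by_cases hk : D.g k y = 0
    · exact (hgk k hk).le
    · exact (hlt k hk).le
  have hne : y + h ≠ D.v := by
    intro h0
    rw [h0] at hv'
    exact lt_irrefl _ (Metric.mem_ball.1 hv')
  refine mem_T_iff.2 ⟨hF, hne, hgω, (rho_eq_of_segment hT hF (fun k hk => ?_) ?_).symm, hle,
    fun k hk hky => hneg k hk ?_⟩
  · rw [eq_of_mem_Fo hFo hk]
    exact hF.2
  · intro s hs0 hs1 _ _
    set p := y + r • (ω - y) + h with hp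
    have hz : p + s • (y + h - p) ∈ D.Fo i := by
      have := F_combo_mem_Fo hF hFo (t := 1 - s) (by linarith) (by linarith)
      convert this using 1
      rw [sub_smul, one_smul, smul_sub, smul_sub]
      abel
    refine ⟨?_, isFlat_of_unique fun k hk => eq_of_mem_Fo hz hk, hnone i _ hz⟩
    intro h0
    have hseg : D.v ∈ segment ℝ p (y + h) := by
      rw [segment_eq_image', ← h0]
      exact ⟨s, ⟨hs0, hs1.le⟩, rfl⟩
    have := (convex_ball y (dist D.v y)).segment_subset hv hv' hseg
    exact lt_irrefl _ (Metric.mem_ball.1 this)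
  · by_contra hcon
    exact (hlt k hcon).ne hky

/-- The dimension of a nonempty cut locus is at least the codimension two. -/
theorem exists_le_dim_of_cutLocus_nonempty (hne : (cutLocus D.P D.v).Nonempty) {C : Set (Set E)}
    (hC : C.Finite) (hcover : ⋃₀ C = cutLocus D.P D.v) :
    ∃ s ∈ C, Module.finrank ℝ E ≤ dim s + 2 := by
  have hmem : ∀ z ∈ D.S, ¬(D.T z).Subsingleton → z ∈ ⋃₀ C := by
    intro z hz hT
    rw [hcover]
    exact subset_closure (mem_cutPoints_iff.2 ⟨hz, hT⟩)
  by_cases hnone : ∀ i, ∀ z ∈ D.Fo i, (D.T z).Subsingleton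
  -- No cut points inside facets: a flat cut point carries its two images along the whole
  -- neighbourhood in its face, which has codimension at most two.
  · obtain ⟨y, hyS, hyf, hyT⟩ : ∃ y ∈ D.S, D.IsFlat y ∧ ¬(D.T y).Subsingleton := by
      obtain ⟨x, hx⟩ := hne
      rw [cutLocus_eq] at hx
      by_cases hf : D.IsFlat x
      · rcases hx with hx | hx
        · rw [mem_cutPoints_iff] at hx
          exact ⟨x, hx.1, hf, hx.2⟩
        · exact absurd hf hx.2
      · have hxS : x ∈ D.S := by
          rcases hx with hx | hx
          · exact (mem_cutPoints_iff.1 hx).1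
          · exact hx.1
        obtain ⟨y, hy⟩ := closure_nonempty_iff.1 ⟨x, warped_mem_closure hxS hf⟩
        exact ⟨y, hy⟩
    rw [not_subsingleton_iff] at hyT
    obtain ⟨⟨i, ω⟩, h1, ⟨j, ω'⟩, h2, hne'⟩ := hyT
    obtain ⟨s, hs, hd⟩ := exists_finrank_le_dim hC (D.N y)ᗮ y (by
      filter_upwards [eventually_T_along_ridge hnone h1, eventually_T_along_ridge hnone h2]
        with u hu hu' huL
      have m1 := hu huL
      refine ⟨y + u, hmem _ (F_subset_S i (mem_T_iff.1 m1).1) fun h => hne' (h m1 (hu' huL)), ?_⟩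
      rw [sub_self]
      exact Submodule.zero_mem _)
    refine ⟨s, hs, ?_⟩
    have := (D.N y).finrank_add_finrank_orthogonal
    unfold IsFlat at hyf
    omega
  · push Not at hnone
    obtain ⟨i, y, hy, hyT⟩ := hnone
    obtain ⟨⟨j, ω⟩, h1, ⟨k, ω'⟩, h2, hne'⟩ := hyT
    obtain rfl := eq_of_mem_Fo hy (mem_T_iff.1 h1).1.2
    obtain rfl := eq_of_mem_Fo hy (mem_T_iff.1 h2).1.2
    obtain ⟨c, hc⟩ := cutPoints_near_facet h1 h2 fun h => hne' (by rw [h])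
    obtain ⟨s, hs, hd⟩ := exists_finrank_le_dim hC _ c (by
      filter_upwards [hc] with u hu huL
      obtain ⟨z, hz, hzT, hzL⟩ := hu huL
      exact ⟨z, hmem z hz hzT, hzL⟩)
    refine ⟨s, hs, ?_⟩
    classical
    have h3 := (Submodule.span ℝ {D.n k, ω' - ω}).finrank_add_finrank_orthogonal
    have h4 := finrank_span_finset_le_card (R := ℝ) ({D.n k, ω' - ω} : Finset E)
    have h5 : ({D.n k, ω' - ω} : Finset E).card ≤ 2 := Finset.card_le_two
    rw [Finset.coe_insert, Finset.coe_singleton] at h4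
    change Module.finrank ℝ (Submodule.span ℝ {D.n k, ω' - ω}) ≤ _ at h4
    omega

/-- The cut locus is the support of a polyhedral complex of codimension two. -/
theorem exists_complex_cutLocus {d : ℕ} (hd : 1 ≤ d) (hE : Module.finrank ℝ E = d + 1) :
    ∃ C : PolyhedralComplex E, C.support = cutLocus D.P D.v ∧
      ((cutLocus D.P D.v).Nonempty → C.HasDim (d - 1)) := by
  obtain ⟨C, hC, hsub⟩ := exists_polyhedralComplex (D.finite_cutTypes.image D.cutPiece) (by
    rintro _ ⟨τ, -, rfl⟩
    exact isPolyhedron_cutPiece τ)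
  rw [sUnion_cutPiece] at hC
  refine ⟨C, hC, fun hne => ?_⟩
  have hle : ∀ s ∈ C.cells, dim s ≤ d - 1 := by
    intro s hs
    obtain ⟨_, ⟨τ, hτ, rfl⟩, hq⟩ := hsub s hs
    have h1 := dim_mono hq
    have h2 := dim_cutPiece hτ
    omega
  obtain ⟨s, hs, hs'⟩ := exists_le_dim_of_cutLocus_nonempty hne C.finite hC
  have := hle s hs
  exact ⟨hle, s, hs, by omega⟩

end SourcedSystem

/-! ### Faces, source points and warped points. -/

section Segments

variable {E : Type*} [NormedAddCommGroup E] [InnerProductSpace ℝ E]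

theorem range_eq_segment_of_isShortestPath {S : Set E} {x v : E} {γ : Path x v}
    (hγ : IsShortestPath S γ) (hS : segment ℝ x v ⊆ S) : range γ = segment ℝ x v := by
  have hd := intrinsicDist_eq_edist hS
  have hsub : ∀ t, γ t ∈ segment ℝ x v := by
    intro t
    have h1 := hγ.add_le (by rw [hd]; exact edist_ne_top _ _) (show (0 : unitInterval) ≤ t from t.2.1)
    rw [γ.source, hd] at h1
    have h2 := (add_le_add (edist_le_intrinsicDist S x (γ t))
      (edist_le_intrinsicDist S (γ t) v)).trans h1
    rw [edist_dist, edist_dist, edist_dist, ← ENNReal.ofReal_add dist_nonneg dist_nonneg,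
      ENNReal.ofReal_le_ofReal_iff dist_nonneg] at h2
    rw [mem_segment_iff_wbtw]
    exact dist_add_dist_eq_iff.1 (le_antisymm h2 (dist_triangle _ _ _))
  apply Subset.antisymm
  · rintro _ ⟨t, rfl⟩
    exact hsub t
  · intro z hz
    have hcont : ContinuousOn (fun s : unitInterval => ‖γ s - x‖) (Icc 0 1) := by fun_prop
    have hivt := intermediate_value_Icc (zero_le_one' unitInterval) hcont
    have hz' := hz
    rw [segment_eq_image'] at hz'
    obtain ⟨a, ⟨ha0, ha1⟩, rfl⟩ := hz'
    obtain ⟨s, -, hs⟩ := hivt (show ‖x + a • (v - x) - x‖ ∈ _ by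
      rw [γ.source, γ.target, sub_self, norm_zero, add_sub_cancel_left, norm_smul,
        Real.norm_of_nonneg ha0]
      exact ⟨by positivity, mul_le_of_le_one_left (norm_nonneg _) ha1⟩)
    have h3 := hsub s
    rw [segment_eq_image'] at h3
    obtain ⟨c, ⟨hc0, hc1⟩, hc⟩ := h3
    simp only at hc hs
    refine ⟨s, ?_⟩
    rw [← hc, add_sub_cancel_left, add_sub_cancel_left, norm_smul, norm_smul,
      Real.norm_of_nonneg ha0, Real.norm_of_nonneg hc0] at hs
    rw [← hc]
    by_cases hvx : v - x = 0
    · simp [hvx]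
    · rw [mul_right_cancel₀ (norm_ne_zero_iff.2 hvx) hs]

theorem exists_extension_of_mem_intrinsicInterior {F : Set E} {v x : E}
    (hv : v ∈ intrinsicInterior ℝ F) (hx : x ∈ F) : ∃ ε > (0 : ℝ), v + ε • (v - x) ∈ F := by
  obtain ⟨w, hw, rfl⟩ := hv
  have hxA : x ∈ affineSpan ℝ F := subset_affineSpan ℝ F hx
  set c : ℝ → affineSpan ℝ F := fun t =>
    ⟨AffineMap.lineMap (w : E) x (-t), AffineMap.lineMap_mem _ w.2 hxA⟩ with hc
  have hcc : Continuous c := by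
    refine Continuous.subtype_mk ?_ _
    exact AffineMap.lineMap_continuous.comp continuous_neg
  have hc0 : c 0 = w := by
    apply Subtype.ext
    simp [hc]
  have hev : ∀ᶠ t in 𝓝 (0 : ℝ), (c t : E) ∈ F := by
    have h1 : ∀ᶠ u : affineSpan ℝ F in 𝓝 w, (u : E) ∈ F := mem_interior_iff_mem_nhds.1 hw
    rw [← hc0] at h1
    exact hcc.continuousAt.eventually h1
  have hpos : ∀ᶠ t : ℝ in 𝓝[>] 0, 0 < t := self_mem_nhdsWithin
  obtain ⟨t, ht, ht0⟩ := ((hev.filter_mono nhdsWithin_le_nhds).and hpos).exists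
  refine ⟨t, ht0, ?_⟩
  convert ht using 1
  simp only [hc, AffineMap.lineMap_apply_module']
  rw [neg_smul, ← smul_neg, neg_sub]
  abel

end Segments

namespace HalfspaceSystem

section Faces

variable {E : Type*} [NormedAddCommGroup E] [InnerProductSpace ℝ E] [FiniteDimensional ℝ E]
variable {ι : Type*} [Finite ι] {D : HalfspaceSystem E ι}

/-- A face through x contains small displacements orthogonal to the active normals, so a face of
dimension at most d-2 forces rank at least three. Conversely, the sum of the active normals exposes
a face through x of complementary dimension or less. -/
theorem warpedPoints_eq {d : ℕ} (hE : Module.finrank ℝ E = d + 1) :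
    warpedPoints D.P d = {x | x ∈ D.S ∧ ¬D.IsFlat x} := by
  classical
  cases nonempty_fintype ι
  ext x
  constructor
  · rintro ⟨F, ⟨⟨hne, hexp⟩, hdim⟩, hx⟩
    obtain ⟨l, rfl⟩ := hexp hne
    have hle : (D.N x)ᗮ ≤ vectorSpan ℝ {x | x ∈ D.P ∧ ∀ y ∈ D.P, l y ≤ l x} := by
      intro h hh
      have hperp : ∀ k, D.g k x = 0 → ⟪D.n k, h⟫ = 0 := fun k hk =>
        (Submodule.mem_orthogonal _ _).1 hh _ (n_mem_N hk)
      have hcont : ∀ w : E, Tendsto (fun t : ℝ => x + t • w) (𝓝[>] 0) (𝓝 x) := by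
        intro w
        have : Continuous fun t : ℝ => x + t • w := by fun_prop
        have h0 := this.tendsto 0
        rw [zero_smul, add_zero] at h0
        exact h0.mono_left nhdsWithin_le_nhds
      have hpos : ∀ᶠ t : ℝ in 𝓝[>] 0, 0 < t := self_mem_nhdsWithin
      obtain ⟨t, ⟨h1, h2⟩, ht⟩ := (((hcont h).eventually (eventually_lt x hx.1)).and
        ((hcont (-h)).eventually (eventually_lt x hx.1)) |>.and hpos).exists
      have m1 : x + t • h ∈ D.P := fun k => by
        by_cases hk : D.g k x = 0
        · rw [g_add_smul, hk, hperp k hk]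
          simp
        · exact (h1 k hk).le
      have m2 : x + t • -h ∈ D.P := fun k => by
        by_cases hk : D.g k x = 0
        · rw [g_add_smul, hk, inner_neg_right, hperp k hk]
          simp
        · exact (h2 k hk).le
      have l1 := hx.2 _ m1
      have l2 := hx.2 _ m2
      rw [map_add, map_smul, smul_eq_mul] at l1 l2
      rw [map_neg] at l2
      have l3 : t * l h = 0 := by linarith
      have m3 : x + t • h ∈ {x | x ∈ D.P ∧ ∀ y ∈ D.P, l y ≤ l x} := by
        refine ⟨m1, fun y hy => ?_⟩
        rw [map_add, map_smul, smul_eq_mul, l3, add_zero]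
        exact hx.2 y hy
      have m4 := vsub_mem_vectorSpan ℝ m3 hx
      rw [vsub_eq_sub, add_sub_cancel_left] at m4
      exact (Submodule.smul_mem_iff _ ht.ne').1 m4
    have h1 := Submodule.finrank_mono hle
    have h2 := (D.N x).finrank_add_finrank_orthogonal
    have hnf : ¬D.IsFlat x := by
      unfold IsFlat
      unfold dim at hdim
      omega
    refine ⟨⟨hx.1, ?_⟩, hnf⟩
    by_contra hcon
    push Not at hcon
    refine hnf ?_
    have : D.N x = ⊥ := by
      rw [N, Submodule.span_eq_bot]
      rintro _ ⟨k, hk, rfl⟩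
      exact absurd hk (hcon k)
    unfold IsFlat
    rw [this, finrank_bot]
    omega
  · rintro ⟨hx, hnf⟩
    set F : Set E := {y | y ∈ D.P ∧ ∀ k, D.g k x = 0 → D.g k y = 0} with hF
    have hxF : x ∈ F := ⟨hx.1, fun _ h => h⟩
    refine ⟨F, ⟨⟨⟨x, hxF⟩, fun _ => ?_⟩, ?_⟩, hxF⟩
    · refine ⟨innerSL ℝ (∑ k with D.g k x = 0, D.n k), ?_⟩
      have hval : ∀ y, innerSL ℝ (∑ k with D.g k x = 0, D.n k) y =
          ∑ k with D.g k x = 0, D.g k y + ∑ k with D.g k x = 0, D.b k := by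
        intro y
        rw [innerSL_apply_apply, sum_inner, ← Finset.sum_add_distrib]
        exact Finset.sum_congr rfl fun k _ => by unfold g; ring
      have hnonpos : ∀ y ∈ D.P, ∑ k with D.g k x = 0, D.g k y ≤ 0 := fun y hy =>
        Finset.sum_nonpos fun k _ => hy k
      have hzero : ∀ y ∈ D.P, y ∈ F ↔ ∑ k with D.g k x = 0, D.g k y = 0 := by
        intro y hy
        rw [Finset.sum_eq_zero_iff_of_nonpos fun k _ => hy k]
        constructor
        · intro h k hk
          exact h.2 k (Finset.mem_filter.1 hk).2
        · intro h
          exact ⟨hy, fun k hk => h k (Finset.mem_filter.2 ⟨Finset.mem_univ k, hk⟩)⟩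
      ext y
      constructor
      · intro hy
        refine ⟨hy.1, fun z hz => ?_⟩
        rw [hval, hval, (hzero y hy.1).1 hy]
        linarith [hnonpos z hz]
      · rintro ⟨hy, hmax⟩
        have h1 := hmax x hx.1
        rw [hval, hval, (hzero x hx.1).1 hxF] at h1
        exact (hzero y hy).2 (le_antisymm (hnonpos y hy) (by linarith))
    · have hle : vectorSpan ℝ F ≤ (D.N x)ᗮ := by
        rw [vectorSpan_def, Submodule.span_le]
        rintro _ ⟨y, hy, z, hz, rfl⟩
        change y - z ∈ (D.N x)ᗮ
        refine (Submodule.mem_orthogonal _ _).2 fun w hw => ?_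
        induction hw using Submodule.span_induction with
        | mem w hw =>
          obtain ⟨k, hk, rfl⟩ := hw
          rw [← g_sub, hy.2 k hk, hz.2 k hk, sub_zero]
        | zero => exact inner_zero_left _
        | add a b _ _ ha hb => rw [inner_add_left, ha, hb, add_zero]
        | smul c a _ ha => rw [real_inner_smul_left, ha, mul_zero]
      have h1 := Submodule.finrank_mono hle
      have h2 := (D.N x).finrank_add_finrank_orthogonal
      unfold IsFlat at hnf
      unfold dim
      omega

theorem exists_active_of_isSourcePoint {d : ℕ} (hE : Module.finrank ℝ E = d + 1) {v : E}
    (hv : IsSourcePoint D.P d v) : v ∈ D.P ∧ ∃ i, ∀ k, D.g k v = 0 ↔ k = i := by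
  obtain ⟨F, ⟨hne, hexp⟩, hdim, hvF⟩ := hv
  obtain ⟨l, hl⟩ := hexp hne
  have hvF' := intrinsicInterior_subset hvF
  have hv' : v ∈ D.P ∧ ∀ y ∈ D.P, l y ≤ l v := by rwa [hl] at hvF'
  have hFP : F ⊆ D.P := by
    rw [hl]
    exact fun y hy => hy.1
  have hexists : ∃ i, D.g i v = 0 := by
    -- At an interior point a maximal functional vanishes, and the face would be P itself, of
    -- dimension d+1.
    by_contra! hcon
    have hl0 : l = 0 := by
      ext w
      have hev : ∀ᶠ t : ℝ in 𝓝[>] 0, v + t • w ∈ D.P := by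
        have : Continuous fun t : ℝ => v + t • w := by fun_prop
        have h0 := this.tendsto 0
        rw [zero_smul, add_zero] at h0
        filter_upwards [(h0.mono_left nhdsWithin_le_nhds).eventually (eventually_lt v hv'.1)]
          with t ht k using (ht k (hcon k)).le
      have hev' : ∀ᶠ t : ℝ in 𝓝[>] 0, v + t • -w ∈ D.P := by
        have : Continuous fun t : ℝ => v + t • -w := by fun_prop
        have h0 := this.tendsto 0
        rw [zero_smul, add_zero] at h0
        filter_upwards [(h0.mono_left nhdsWithin_le_nhds).eventually (eventually_lt v hv'.1)]
          with t ht k using (ht k (hcon k)).le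
      have hpos : ∀ᶠ t : ℝ in 𝓝[>] 0, 0 < t := self_mem_nhdsWithin
      obtain ⟨t, ⟨h1, h2⟩, ht⟩ := ((hev.and hev').and hpos).exists
      have l1 := hv'.2 _ h1
      have l2 := hv'.2 _ h2
      rw [map_add, map_smul, smul_eq_mul] at l1 l2
      rw [map_neg] at l2
      have l3 : t * l w = 0 := by linarith
      exact (mul_eq_zero.1 l3).resolve_left ht.ne'
    have hFeq : F = D.P := by
      rw [hl, hl0]
      ext y
      simp
    have hint : (interior D.P).Nonempty := ⟨D.x₀, by rw [interior_P]; exact g_x₀⟩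
    have htop := AffineSubspace.vectorSpan_eq_top_of_affineSpan_eq_top ℝ E E
      (convex_P.interior_nonempty_iff_affineSpan_eq_top.1 hint)
    unfold dim at hdim
    rw [hFeq, htop, finrank_top] at hdim
    omega
  obtain ⟨i, hi⟩ := hexists
  refine ⟨hv'.1, i, fun k => ⟨fun hk => ?_, fun hk => hk ▸ hi⟩⟩
  by_contra hki
  -- A constraint active at a relative interior point is active on the whole face; two of them would
  -- leave dimension at most d-1.
  have hzero : ∀ m, D.g m v = 0 → ∀ x ∈ F, D.g m x = 0 := by
    intro m hm x hx
    obtain ⟨ε, hε, hmem⟩ := exists_extension_of_mem_intrinsicInterior hvF hx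
    have h1 := hFP hmem m
    have h2 := hFP hx m
    have h3 := g_sub (D := D) m v x
    rw [g_add_smul, hm, zero_add, ← h3, hm] at h1
    nlinarith
  have := dim_add_two_le (linearIndependent_n hki hk hi) (s := F) fun x hx y hy =>
    ⟨by rw [← g_sub, hzero k hk x hx, hzero k hk y hy, sub_zero],
      by rw [← g_sub, hzero i hi x hx, hzero i hi y hy, sub_zero]⟩
  omega

end Faces

end HalfspaceSystem

/-! ### The case of parallel hyperplanes. -/

namespace HalfspaceSystem

section Parallel

variable {E : Type*} [NormedAddCommGroup E] [InnerProductSpace ℝ E] [FiniteDimensional ℝ E]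
variable {ι : Type*} [Finite ι] {D : HalfspaceSystem E ι}

theorem eq_of_active_of_parallel (hpar : ∀ i j, D.n i = D.n j ∨ D.n i = -D.n j) {x : E} {i j : ι}
    (hi : D.g i x = 0) (hj : D.g j x = 0) : i = j := by
  rcases hpar i j with h | h
  · exact eq_of_mem_span_singleton hj hi (a := 1) (by rw [one_smul, h])
  · exact eq_of_mem_span_singleton hj hi (a := -1) (by rw [neg_one_smul, h])

theorem warped_eq_empty_of_parallel (hpar : ∀ i j, D.n i = D.n j ∨ D.n i = -D.n j) :
    {x | x ∈ D.S ∧ ¬D.IsFlat x} = ∅ := by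
  rw [eq_empty_iff_forall_notMem]
  rintro x ⟨⟨-, i, hi⟩, hnf⟩
  exact hnf (isFlat_of_unique fun k hk => eq_of_active_of_parallel hpar hk hi)

theorem cutPoints_eq_empty_of_parallel (hpar : ∀ i j, D.n i = D.n j ∨ D.n i = -D.n j) {v : E}
    (hv : v ∈ D.S) : cutPoints D.P v = ∅ := by
  obtain ⟨hvP, i, hi⟩ := hv
  have hvF : v ∈ D.F i := ⟨hvP, hi⟩
  rw [cutPoints, frontier_P, eq_empty_iff_forall_notMem]
  have hin : ∀ (x : E) (γ : Path x v), range γ ⊆ D.S → ∀ t, γ t ∈ D.F i := by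
    intro x γ hγ
    -- Different facets are disjoint here, so a path in the boundary ending at v stays in the facet
    -- of v, where shortest paths are segments.
    have hclopen : IsClopen {t | γ t ∈ D.F i} := by
      refine ⟨(isClosed_F i).preimage γ.continuous, isOpen_iff_eventually.2 fun t ht => ?_⟩
      filter_upwards [γ.continuous.continuousAt.eventually (eventually_common_facet ht.1)] with s hs
      obtain ⟨hsP, k, hk⟩ := hγ (mem_range_self s)
      obtain rfl := eq_of_active_of_parallel hpar (hs k ⟨hsP, hk⟩).2 ht.2
      exact ⟨hsP, hk⟩
    have huniv := hclopen.eq_univ ⟨1, by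
      change γ 1 ∈ D.F i
      rwa [γ.target]⟩
    intro t
    exact eq_univ_iff_forall.1 huniv t
  rintro x ⟨-, γ, γ', hγ, hγ', hne⟩
  have hxF : x ∈ D.F i := γ.source ▸ hin x γ hγ.1 0
  have hseg : segment ℝ x v ⊆ D.S := ((convex_F i).segment_subset hxF hvF).trans (F_subset_S i)
  exact hne ((range_eq_segment_of_isShortestPath hγ hseg).trans
    (range_eq_segment_of_isShortestPath hγ' hseg).symm)

theorem containsHalfFlat_of_parallel (hpar : ∀ i j, D.n i = D.n j ∨ D.n i = -D.n j) {v : E}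
    (hv : v ∈ D.S) {d : ℕ} (hd : 1 ≤ d) (hE : Module.finrank ℝ E = d + 1) :
    ContainsHalfFlat D.P d := by
  obtain ⟨hvP, i, hi⟩ := hv
  have hi0 : D.n i ≠ 0 := fun h => by
    have := D.norm_n i
    rw [h, norm_zero] at this
    exact zero_ne_one this
  obtain ⟨u, -, hu0, hu⟩ := exists_orthogonal_of_finrank_lt (N := (⊤ : Submodule ℝ E))
    (K := Submodule.span ℝ {D.n i}) (by
      rw [finrank_span_singleton hi0, finrank_top]
      omega)
  have hiu := hu _ (Submodule.mem_span_singleton_self _)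
  have hli : LinearIndependent ℝ ![D.n i, u] := by
    rw [LinearIndependent.pair_iff' hi0]
    intro a ha
    rw [← ha, inner_smul_right, real_inner_self_eq_norm_sq, D.norm_n] at hiu
    have ha0 : a = 0 := by linarith
    rw [ha0, zero_smul] at ha
    exact hu0 ha.symm
  set W := Submodule.span ℝ (range ![D.n i, u]) with hW
  have hW2 : Module.finrank ℝ W = 2 := by simpa using finrank_span_eq_card hli
  have hnW : D.n i ∈ W := Submodule.subset_span ⟨0, rfl⟩
  have huW : u ∈ W := Submodule.subset_span ⟨1, rfl⟩
  refine ⟨v, u, Wᗮ, ?_, fun h => hu0 ?_, fun y hy t _ k => ?_⟩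
  · have := W.finrank_add_finrank_orthogonal
    omega
  · exact inner_self_eq_zero.1 ((W.mem_orthogonal u).1 h u huW)
  · have h1 : ⟪D.n k, y⟫ = 0 ∧ ⟪D.n k, u⟫ = 0 := by
      have h2 := (W.mem_orthogonal y).1 hy _ hnW
      rcases hpar k i with h | h
      · rw [h]
        exact ⟨h2, hiu⟩
      · rw [h, inner_neg_left, inner_neg_left, h2, hiu, neg_zero]
        exact ⟨rfl, rfl⟩
    rw [g_add_smul, g_add, h1.1, h1.2]
    simpa using hvP k

end Parallel

end HalfspaceSystem

/-! ### From polyhedra to half-space systems, and the theorem. -/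

section Main

universe u

variable {E : Type u} [NormedAddCommGroup E] [InnerProductSpace ℝ E] [FiniteDimensional ℝ E]

/-- A full-dimensional polyhedron is given by a system of normalized half-spaces. -/
theorem exists_halfspaceSystem {P : Set E} (hP : IsPolyhedron P) (hdim : affineSpan ℝ P = ⊤) :
    ∃ (ι : Type u) (_ : Finite ι) (D : HalfspaceSystem E ι), D.P = P := by
  obtain ⟨m, a, b, rfl⟩ := hP
  have hconv : Convex ℝ {x | ∀ i, a i x ≤ b i} := by
    rw [ofPred_forall]
    exact convex_iInter fun i => convex_halfSpace_le (a i).isBoundedLinearMap.toIsLinearMap _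
  obtain ⟨x₀, hx₀⟩ := hconv.interior_nonempty_iff_affineSpan_eq_top.2 hdim
  set w : Fin m → E := fun i => (InnerProductSpace.toDual ℝ E).symm (a i) with hw
  have hwa : ∀ i x, ⟪w i, x⟫ = a i x := fun i x => InnerProductSpace.toDual_symm_apply
  have hstrict : ∀ i, w i ≠ 0 → a i x₀ < b i := by
    intro i hi
    have hev : ∀ᶠ t : ℝ in 𝓝[>] 0, x₀ + t • w i ∈ {x | ∀ i, a i x ≤ b i} := by
      have : Continuous fun t : ℝ => x₀ + t • w i := by fun_prop
      have h0 := this.tendsto 0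
      rw [zero_smul, add_zero] at h0
      exact (h0.mono_left nhdsWithin_le_nhds).eventually (mem_interior_iff_mem_nhds.1 hx₀)
    have hpos : ∀ᶠ t : ℝ in 𝓝[>] 0, 0 < t := self_mem_nhdsWithin
    obtain ⟨t, ht, ht0⟩ := (hev.and hpos).exists
    have h1 : a i (x₀ + t • w i) ≤ b i := ht i
    rw [map_add, map_smul, ← hwa i (w i), real_inner_self_eq_norm_sq, smul_eq_mul] at h1
    have h2 : 0 < ‖w i‖ := norm_pos_iff.2 hi
    have h3 : 0 < t * ‖w i‖ ^ 2 := by positivity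
    linarith
  -- Indexing by normalized pairs drops zero functionals and merges repeated constraints, as
  -- distinctness requires.
  set K : Set (E × ℝ) := (fun i => (‖w i‖⁻¹ • w i, ‖w i‖⁻¹ * b i)) '' {i | w i ≠ 0} with hK
  have hfin : K.Finite := (toFinite _).image _
  refine ⟨K, hfin.to_subtype, ⟨fun k => k.1.1, fun k => k.1.2, ?_, ?_, x₀, ?_⟩, ?_⟩
  · rintro ⟨_, i, hi, rfl⟩
    have : ‖w i‖ ≠ 0 := norm_ne_zero_iff.2 hi
    simp only
    rw [norm_smul, norm_inv, norm_norm, inv_mul_cancel₀ this]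
  · rintro k l h1 h2
    exact Subtype.ext (Prod.ext h1 h2)
  · rintro ⟨_, i, hi, rfl⟩
    have h1 : 0 < ‖w i‖ := norm_pos_iff.2 hi
    simp only
    rw [real_inner_smul_left, hwa]
    exact mul_lt_mul_of_pos_left (hstrict i hi) (by positivity)
  · ext x
    constructor
    · intro hx i
      by_cases hi : w i = 0
      · have h1 : a i x = 0 := by rw [← hwa, hi, inner_zero_left]
        have h2 : a i x₀ = 0 := by rw [← hwa, hi, inner_zero_left]
        rw [h1, ← h2]
        exact interior_subset hx₀ i
      · have h1 := hx ⟨_, i, hi, rfl⟩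
        have h2 : 0 < ‖w i‖ := norm_pos_iff.2 hi
        simp only [HalfspaceSystem.g] at h1
        rw [real_inner_smul_left, hwa, sub_nonpos] at h1
        exact le_of_mul_le_mul_left h1 (by positivity)
    · rintro hx ⟨_, i, hi, rfl⟩
      simp only [HalfspaceSystem.g]
      rw [real_inner_smul_left, hwa, sub_nonpos]
      exact mul_le_mul_of_nonneg_left (hx i) (by positivity)

/-- The parallel case is separate because the boundary may then be disconnected and `rho` infinite;
there the cut points and warped points are absent and P contains a half-flat. -/
theorem cutLocus_structure {d : ℕ} (hd : 1 ≤ d) (hE : Module.finrank ℝ E = d + 1) {P : Set E}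
    (hP : IsPolyhedron P) (hdim : affineSpan ℝ P = ⊤) {v : E} (hv : IsSourcePoint P d v) :
    (∃ C : PolyhedralComplex E, C.support = cutLocus P v ∧
      ((cutLocus P v).Nonempty → C.HasDim (d - 1))) ∧
    (¬ContainsHalfFlat P d → (cutLocus P v).Nonempty) ∧
    cutLocus P v = cutPoints P v ∪ warpedPoints P d := by
  obtain ⟨ι, hι, D, rfl⟩ := exists_halfspaceSystem hP hdim
  obtain ⟨hvP, i₀, hact⟩ := HalfspaceSystem.exists_active_of_isSourcePoint hE hv
  have hvS : v ∈ D.S := ⟨hvP, i₀, (hact i₀).2 rfl⟩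
  rw [HalfspaceSystem.warpedPoints_eq hE]
  by_cases hpair : ∃ i j, D.n i ≠ D.n j ∧ D.n i ≠ -D.n j
  · let D' : SourcedSystem E ι :=
      ⟨D, v, i₀, hvP, hact, fun x hx => HalfspaceSystem.intrinsicDist_ne_top hpair hx hvS⟩
    refine ⟨D'.exists_complex_cutLocus hd hE, fun hhalf => ?_, D'.cutLocus_eq⟩
    by_contra hempty
    exact hhalf (D'.containsHalfFlat_of_cutLocus_eq_empty hpair
      (not_nonempty_iff_eq_empty.1 hempty) hE)
  · push Not at hpair
    have hpar : ∀ i j, D.n i = D.n j ∨ D.n i = -D.n j := fun i j =>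
      or_iff_not_imp_left.2 (hpair i j)
    have hempty : cutPoints D.P v = ∅ := HalfspaceSystem.cutPoints_eq_empty_of_parallel hpar hvS
    have hcl : cutLocus D.P v = ∅ := by rw [cutLocus, hempty, closure_empty]
    rw [hcl, hempty, HalfspaceSystem.warped_eq_empty_of_parallel hpar]
    refine ⟨?_, fun h => absurd (HalfspaceSystem.containsHalfFlat_of_parallel hpar hvS hd hE) h,
      (union_self _).symm⟩
    obtain ⟨C, hC, -⟩ := exists_polyhedralComplex (E := E) (Q := ∅) finite_empty (by simp)
    exact ⟨C, by rw [hC, sUnion_empty], fun h => absurd h not_nonempty_empty⟩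

end Main

end CutLoci

theorem mainTheorem3 (d : ℕ) (hd : 1 ≤ d)
    (P : Set (EuclideanSpace ℝ (Fin (d + 1))))
    (hP : CutLoci.IsPolyhedron P) (hdim : affineSpan ℝ P = ⊤)
    (v : EuclideanSpace ℝ (Fin (d + 1))) (hv : CutLoci.IsSourcePoint P d v) :
    (∃ C : CutLoci.PolyhedralComplex (EuclideanSpace ℝ (Fin (d + 1))),
      C.support = CutLoci.cutLocus P v ∧
      ((CutLoci.cutLocus P v).Nonempty → C.HasDim (d - 1))) ∧
    (¬ CutLoci.ContainsHalfFlat P d → (CutLoci.cutLocus P v).Nonempty) ∧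
    CutLoci.cutLocus P v = CutLoci.cutPoints P v ∪ CutLoci.warpedPoints P d :=
  CutLoci.cutLocus_structure hd finrank_euclideanSpace_fin hP hdim hv
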